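/- Let $\lambda\in\mathbb{C}$, $\lambda\neq 0$, and let $\mathcal{X}_\lambda$ be the quartic surface $X_0^4+X_1^4+X_2^4+X_3^4+4\lambda X_0X_1X_2X_3=0$ in $\mathbb{P}^3$. Let $G\cong(\mathbb{Z}/4\mathbb{Z})^2$ be the group of automorphisms of $\mathcal{X}_\lambda$ generated by $(X_0,X_j)\mapsto(\zeta^3X_0,\zeta X_j)$, $j=1,2,3$, $\zeta=e^{2\pi i/4}$, and let $\mathcal{Y}_{\lambda^2}$ be the mirror quartic, i.e. the resolution of $\mathcal{X}_\lambda/G$; the quotient map induces the Greene–Plesser rational map $\mathcal{X}_\lambda\dashrightarrow\mathcal{Y}_{\lambda^2}$. Fix a square root $\sqrt{\lambda^2-1}$ and put $$l=2\lambda^2-1-2\lambda\sqrt{\lambda^2-1}=\bigl(\lambda-\sqrt{\lambda^2-1}\bigr)^2 .$$ (a) There are $\lambda_1,\lambda_2\in\mathbb{C}\setminus\{0,1\}$ with $$\lambda_1^2\lambda_2^2-2\lambda_1\lambda_2(\lambda_1+\lambda_2)+\lambda_1^2+\lambda_2^2-12\lambda_1\lambda_2-2(\lambda_1+\lambda_2)+1=0,$$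 $$\lambda^2=-\frac{(\lambda_1+1)(\lambda_2+1)}{2(\lambda_1-1)(\lambda_2-1)},\qquad (\lambda_1-1)(\lambda_2-1)=-4l .$$ (b) Let $\lambda_1,\lambda_2$ be any such pair. Then $l^2=\lambda_1\lambda_2$, the curves $$\mathcal{E}:\ y^2=x(x-1)(x-\lambda_1),\qquad \mathcal{E}':\ y^2=x^3+\tfrac{1+\lambda_1}{2}x^2+\tfrac{(1-\lambda_1)^2}{16}x$$ are elliptic curves, there is a two-isogeny $\mathcal{E}\to\mathcal{E}'$ given on $x$-coordinates by $x\mapsto y^2/(4x^2)$, and $\mathcal{E}'$ is isomorphic to the Legendre curve $y^2=x(x-1)(x-\lambda_2)$. The surface $\mathcal{Y}_{\lambda^2}$ is birational to the elliptic surface $$Y^2=X^3+u^2\bigl((\lambda_1-1)(\lambda_2-1)(u+u^{-1})-2(\lambda_1+1)(\lambda_2+1)\bigr)X^2+16\lambda_1\lambda_2u^4X ,\qquad u=-\Bigl(\frac{X_2X_3}{X_0X_1}\Bigr)^2,$$ and the Greene–Plesser map factors through a Kummer sandwich: there are dominant rational maps $$\mathcal{X}_\lambda\overset{\pi}{\dashrightarrow}\operatorname{Kum}(\mathcal{E}\times\mathcal{E}')\overset{\psi}{\dashrightarrow}\mathcal{Y}_{\lambda^2}\overset{\phi}{\dashrightarrow}\operatorname{Kum}(\mathcal{E}\times\mathcal{E}')\overset{\chi}{\dashrightarrow}\mathcal{Y}'_{\lambda^2},$$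 with $\psi,\phi,\chi$ of degree two, such that $\psi\circ\pi$ is the Greene–Plesser map, and there are two distinct commuting Nikulin involutions $\imath,\jmath$ of $\operatorname{Kum}(\mathcal{E}\times\mathcal{E}')$ (involutions preserving the holomorphic two-form) such that $\psi$ is the quotient by $\langle\imath\rangle$ and $\phi\circ\psi$ is the quotient by $\langle\imath,\jmath\rangle$, up to birational equivalence. Here $\operatorname{Kum}(\mathcal{E}\times\mathcal{E}')$ is the resolution of $(\mathcal{E}\times\mathcal{E}')/\{\pm1\}$, and $\mathcal{Y}'_{\lambda^2}$ is the twisted Legendre pencil $$y^2=16\,l\,x(x-1)(x-w)(w-\lambda^2)(w-1-\lambda^2).$$ Moreover, with $\omega_{\mathcal{Y}}=du\wedge dX/Y$ and $\omega_{\mathcal{Y}'}=dw\wedge dx/y$, the birational identification of $\mathcal{Y}_{\lambda^2}$ with the elliptic surface and the maps can be chosen such that $\omega_{\mathcal{Y}}=\phi^*\chi^*\omega_{\mathcal{Y}'}$. -/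

import Mathlib

open Polynomial

noncomputable section

namespace KummerSandwich

/-! ### Rational maps and two-forms

A dominant rational map `V ⇢ W` of complex varieties is, contravariantly, a `ℂ`-algebra
homomorphism `ℂ(W) →ₐ[ℂ] ℂ(V)` of function fields; a birational map is an isomorphism. -/

/-- The degree of a dominant rational map `V ⇢ W` of varieties of the same dimension, given by
its comorphism `f : ℂ(W) → ℂ(V)`: the degree of the field extension `ℂ(V) / f(ℂ(W))`. -/
def mapDegree {A B : Type*} [Field A] [Field B] [Algebra ℂ A] [Algebra ℂ B]
    (f : A →ₐ[ℂ] B) : ℕ :=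
  Module.finrank f.fieldRange B

/-- The rational two-forms on a variety with function field `A`. -/
abbrev TwoForm (A : Type*) [Field A] [Algebra ℂ A] : Type _ := ⋀[A]^2 (Ω[A⁄ℂ])

/-- The rational two-form `dg ∧ dh`. -/
def dWedge {A : Type*} [Field A] [Algebra ℂ A] (g h : A) : TwoForm A :=
  exteriorPower.ιMulti A 2 ![KaehlerDifferential.D ℂ A g, KaehlerDifferential.D ℂ A h]

/-- The rational two-form `(dg ∧ dh) / a`. -/
def ratForm {A : Type*} [Field A] [Algebra ℂ A] (a g h : A) : TwoForm A :=
  a⁻¹ • dWedge g h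

/-- The pullback of rational two-forms along the dominant rational map with comorphism `f`. -/
def pullback {A B : Type*} [Field A] [Field B] [Algebra ℂ A] [Algebra ℂ B]
    (f : A →ₐ[ℂ] B) : TwoForm A → TwoForm B :=
  letI : Algebra A B := f.toRingHom.toAlgebra
  haveI : IsScalarTower ℂ A B := IsScalarTower.of_algebraMap_eq fun r => (f.commutes r).symm
  exteriorPower.alternatingMapLinearEquiv (R := A) (n := 2)
    (AlternatingMap.compLinearMap
      { (exteriorPower.ιMulti B 2 (M := Ω[B⁄ℂ])).toMultilinearMap.restrictScalars A with
        map_eq_zero_of_eq' := fun v _ _ h hij =>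
          (exteriorPower.ιMulti B 2).map_eq_zero_of_eq v h hij }
      (KaehlerDifferential.map ℂ ℂ A B))

theorem pullback_smul_dWedge {A B : Type*} [Field A] [Field B] [Algebra ℂ A] [Algebra ℂ B]
    (f : A →ₐ[ℂ] B) (a g h : A) :
    pullback f (a • dWedge g h) = f a • dWedge (f g) (f h) := by
  let _ : Algebra A B := f.toRingHom.toAlgebra
  have _ : IsScalarTower ℂ A B := IsScalarTower.of_algebraMap_eq fun r => (f.commutes r).symm
  unfold pullback dWedge
  rw [map_smul, exteriorPower.alternatingMapLinearEquiv_apply_ιMulti]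
  rw [show f a = algebraMap A B a from rfl, algebraMap_smul]
  congr 1
  change exteriorPower.ιMulti B 2 _ = exteriorPower.ιMulti B 2 _
  congr 1
  funext i
  fin_cases i
  · exact KaehlerDifferential.map_D ℂ ℂ A B g
  · exact KaehlerDifferential.map_D ℂ ℂ A B h

theorem pullback_ratForm {A B : Type*} [Field A] [Field B] [Algebra ℂ A] [Algebra ℂ B]
    (f : A →ₐ[ℂ] B) (a g h : A) :
    pullback f (ratForm a g h) = ratForm (f a) (f g) (f h) := by
  rw [ratForm, pullback_smul_dWedge, map_inv₀, ratForm]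

/-! ### Diagonal automorphisms of affine hypersurfaces -/

/-- The coordinate ring of the affine surface `p = 0` in three-space. -/
abbrev SurfaceRing (p : MvPolynomial (Fin 3) ℂ) : Type :=
  MvPolynomial (Fin 3) ℂ ⧸ Ideal.span {p}

/-- The function field of the affine surface `p = 0`. -/
abbrev SurfaceField (p : MvPolynomial (Fin 3) ℂ) : Type := FractionRing (SurfaceRing p)

/-- The `i`-th coordinate function on the surface `p = 0`. -/
def coord (p : MvPolynomial (Fin 3) ℂ) (i : Fin 3) : SurfaceField p :=
  algebraMap (SurfaceRing p) (SurfaceField p) (Ideal.Quotient.mk _ (MvPolynomial.X i))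

/-- The automorphism `X i ↦ c i * X i` of the polynomial ring. -/
def scale (c : Fin 3 → ℂˣ) : MvPolynomial (Fin 3) ℂ ≃ₐ[ℂ] MvPolynomial (Fin 3) ℂ :=
  AlgEquiv.ofAlgHom
    (MvPolynomial.aeval fun i => MvPolynomial.C (c i : ℂ) * MvPolynomial.X i)
    (MvPolynomial.aeval fun i => MvPolynomial.C ((c i)⁻¹ : ℂˣ).val * MvPolynomial.X i)
    (by
      ext i : 1
      simp [← mul_assoc, ← MvPolynomial.C_mul])
    (by
      ext i : 1
      simp [← mul_assoc, ← MvPolynomial.C_mul])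

/-- The automorphism of the function field of `p = 0` induced by a diagonal scaling of the
coordinates that leaves `p` invariant. -/
def scaleAut (p : MvPolynomial (Fin 3) ℂ) (c : Fin 3 → ℂˣ) (h : scale c p = p) :
    SurfaceField p ≃ₐ[ℂ] SurfaceField p :=
  IsFractionRing.algEquivOfAlgEquiv
    (Ideal.quotientEquivAlg (Ideal.span {p}) (Ideal.span {p}) (scale c) (by
      rw [Ideal.map_span, Set.image_singleton]
      exact congrArg (fun q => Ideal.span {q}) h.symm))

/-! ### The quartic Dwork pencil and its Greene-Plesser quotient -/

/-- The quartic `X₀⁴ + X₁⁴ + X₂⁴ + X₃⁴ + 4 lam X₀X₁X₂X₃` in the chart `X₀ = 1`; the variable of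
index `i` is `X_{i+1} / X₀`. -/
def dworkPoly (lam : ℂ) : MvPolynomial (Fin 3) ℂ :=
  1 + MvPolynomial.X 0 ^ 4 + MvPolynomial.X 1 ^ 4 + MvPolynomial.X 2 ^ 4 +
    MvPolynomial.C (4 * lam) * (MvPolynomial.X 0 * MvPolynomial.X 1 * MvPolynomial.X 2)

theorem dworkPoly_irreducible (lam : ℂ) : Irreducible (dworkPoly lam) := by
  rw [← MulEquiv.irreducible_iff (MvPolynomial.finSuccEquiv ℂ 2)]
  obtain ⟨z, hz⟩ := IsAlgClosed.exists_pow_nat_eq (-1 : ℂ) (n := 4) (by norm_num)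
  set θ : MvPolynomial (Fin 2) ℂ →ₐ[ℂ] ℂ[X] := MvPolynomial.aeval ![0, Polynomial.X] with hθ
  have e1 : (1 : Fin 3) = Fin.succ 0 := rfl
  have e2 : (2 : Fin 3) = Fin.succ 1 := rfl
  set b : MvPolynomial (Fin 2) ℂ := MvPolynomial.C (4 * lam) *
    (MvPolynomial.X 0 * MvPolynomial.X 1) with hb
  set c : MvPolynomial (Fin 2) ℂ := 1 + MvPolynomial.X 0 ^ 4 + MvPolynomial.X 1 ^ 4 with hc
  have hp : MvPolynomial.finSuccEquiv ℂ 2 (dworkPoly lam) =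
      Polynomial.X ^ 4 + (Polynomial.C b * Polynomial.X + Polynomial.C c) := by
    have hC (r : ℂ) : MvPolynomial.finSuccEquiv ℂ 2 (MvPolynomial.C r) =
        Polynomial.C (MvPolynomial.C r) := by
      simp [MvPolynomial.finSuccEquiv_apply]
    simp only [dworkPoly, map_add, map_one, map_mul, map_pow, e1, e2,
      MvPolynomial.finSuccEquiv_X_zero, MvPolynomial.finSuccEquiv_X_succ, hC, hb, hc]
    ring
  have hq : (Polynomial.C b * Polynomial.X + Polynomial.C c).degree < ((4 : ℕ) : WithBot ℕ) :=
    lt_of_le_of_lt Polynomial.degree_linear_le (by norm_num)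
  rw [hp]
  have hm : (Polynomial.X ^ 4 + (Polynomial.C b * Polynomial.X + Polynomial.C c)).Monic :=
    Polynomial.monic_X_pow_add hq
  have hd : (Polynomial.X ^ 4 + (Polynomial.C b * Polynomial.X + Polynomial.C c)).degree = 4 := by
    rw [Polynomial.degree_add_eq_left_of_degree_lt (by rwa [Polynomial.degree_X_pow]),
      Polynomial.degree_X_pow]
    rfl
  have hP : (Ideal.span {Polynomial.X - Polynomial.C z} : Ideal ℂ[X]).IsPrime :=
    Ideal.isPrime_span_singleton_of_prime (Polynomial.prime_X_sub_C z)
  have hθb : θ b = 0 := by simp [hθ, hb]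
  have hθc : θ c = 1 + Polynomial.X ^ 4 := by simp [hθ, hc]
  refine Polynomial.irreducible_of_eisenstein_criterion
    (P := (Ideal.span {Polynomial.X - Polynomial.C z}).comap θ) (hP.comap θ) ?_ ?_ ?_ ?_
    hm.isPrimitive
  · rw [hm.leadingCoeff]
    exact (Ideal.ne_top_iff_one _).1 (hP.comap θ).ne_top
  · intro n hn
    rw [hd] at hn
    have hn' : n < 4 := by exact_mod_cast hn
    have hcm : c ∈ (Ideal.span {Polynomial.X - Polynomial.C z}).comap θ := by
      rw [Ideal.mem_comap, hθc, Ideal.mem_span_singleton, Polynomial.dvd_iff_isRoot]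
      simp [hz]
    have hbm : b ∈ (Ideal.span {Polynomial.X - Polynomial.C z}).comap θ := by
      rw [Ideal.mem_comap, hθb]
      exact zero_mem _
    interval_cases n <;>
      simp [Polynomial.coeff_X_pow, Polynomial.coeff_X, Polynomial.coeff_C, hcm, hbm]
  · rw [hd]
    norm_num
  · intro h0
    have h1 : (Polynomial.X ^ 4 + (Polynomial.C b * Polynomial.X + Polynomial.C c)).coeff 0 = c := by
      simp
    rw [h1] at h0
    have h2 : θ c ∈ (Ideal.span {Polynomial.X - Polynomial.C z}) ^ 2 := by
      have := Ideal.le_comap_pow θ 2 h0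
      exact this
    rw [hθc, Ideal.span_singleton_pow, Ideal.mem_span_singleton] at h2
    obtain ⟨q, hq⟩ := h2
    have h3 := congrArg (fun p => (Polynomial.derivative p).eval z) hq
    have h4 : z ^ 3 = 0 := by simpa [Polynomial.derivative_pow] using h3
    have h5 : z = 0 := by simpa using h4
    rw [h5] at hz
    norm_num at hz

instance dworkPoly_isPrime (lam : ℂ) : (Ideal.span {dworkPoly lam}).IsPrime :=
  Ideal.isPrime_span_singleton_of_prime (dworkPoly_irreducible lam).prime

/-- The function field of the quartic surface `X_lam`. -/
abbrev DworkField (lam : ℂ) : Type := SurfaceField (dworkPoly lam)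

/-- In the chart `X₀ = 1`, the symmetry `(X₀, X_j) ↦ (ζ³ X₀, ζ X_j)` with `ζ = i` multiplies
`X_j / X₀` by `ζ^{-2} = -1` and the other two affine coordinates by `ζ^{-3} = i`. -/
def dworkScale (j : Fin 3) : Fin 3 → ℂˣ :=
  fun k => if k = j then -1 else Units.mk0 Complex.I Complex.I_ne_zero

theorem scale_dworkPoly (lam : ℂ) (j : Fin 3) :
    scale (dworkScale j) (dworkPoly lam) = dworkPoly lam := by
  have hI : (MvPolynomial.C Complex.I : MvPolynomial (Fin 3) ℂ) ^ 2 = -1 := by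
    rw [← map_pow, Complex.I_sq, map_neg, map_one]
  have hI4 : (MvPolynomial.C Complex.I : MvPolynomial (Fin 3) ℂ) ^ 4 = 1 := by
    linear_combination (MvPolynomial.C Complex.I ^ 2 - 1) * hI
  simp only [scale, dworkPoly, AlgEquiv.ofAlgHom_apply, map_add, map_mul, map_pow, map_one,
    MvPolynomial.aeval_X, MvPolynomial.algHom_C, MvPolynomial.algebraMap_eq]
  fin_cases j <;> simp [dworkScale, mul_pow, hI4] <;>
    linear_combination (-MvPolynomial.C 4 * MvPolynomial.C lam * MvPolynomial.X 0 * MvPolynomial.X 1 *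
      MvPolynomial.X 2) * hI

/-- The group `(ℤ/4ℤ)²` of Greene-Plesser symmetries, acting on the function field of `X_lam`. -/
def greenePlesserGroup (lam : ℂ) : Subgroup (DworkField lam ≃ₐ[ℂ] DworkField lam) :=
  Subgroup.closure
    (Set.range fun j : Fin 3 => scaleAut (dworkPoly lam) (dworkScale j) (scale_dworkPoly lam j))

/-- The function field of the mirror quartic, i.e. of (a resolution of) the quotient of `X_lam` by
the Greene-Plesser group. The inclusion into `DworkField lam` is the comorphism of the
Greene-Plesser map from `X_lam` to the mirror quartic. -/
abbrev MirrorField (lam : ℂ) : IntermediateField ℂ (DworkField lam) :=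
  IntermediateField.fixedField (greenePlesserGroup lam)

/-! ### Weierstrass equations -/

/-- The function `x` on a Weierstrass curve. -/
def xFun {R : Type} [CommRing R] (W : WeierstrassCurve R) : W.toAffine.FunctionField :=
  algebraMap W.toAffine.CoordinateRing _
    (WeierstrassCurve.Affine.CoordinateRing.mk W.toAffine (Polynomial.C Polynomial.X))

/-- The function `y` on a Weierstrass curve. -/
def yFun {R : Type} [CommRing R] (W : WeierstrassCurve R) : W.toAffine.FunctionField :=
  algebraMap W.toAffine.CoordinateRing _
    (WeierstrassCurve.Affine.CoordinateRing.mk W.toAffine Polynomial.X)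

/-- The Legendre curve `y² = x (x - 1) (x - t)`. -/
def legendre (t : ℂ) : WeierstrassCurve ℂ := ⟨0, -(1 + t), 0, t, 0⟩

/-- The curve `y² = x³ + (1 + t)/2 x² + (1 - t)²/16 x`, the quotient of the Legendre curve by the
two-torsion point `(0, 0)`. -/
def legendreDual (t : ℂ) : WeierstrassCurve ℂ := ⟨0, (1 + t) / 2, 0, (1 - t) ^ 2 / 16, 0⟩

/-- The Weierstrass equation over `ℂ[u]`
`Y² = X³ + u² ((t₁-1)(t₂-1)(u + u⁻¹) - 2 (t₁+1)(t₂+1)) X² + 16 t₁ t₂ u⁴ X`.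
Its function field is the function field of the corresponding elliptic surface. -/
def ellipticSurface (t₁ t₂ : ℂ) : WeierstrassCurve ℂ[X] where
  a₁ := 0
  a₂ := C ((t₁ - 1) * (t₂ - 1)) * (X ^ 3 + X) - C (2 * ((t₁ + 1) * (t₂ + 1))) * X ^ 2
  a₃ := 0
  a₄ := C (16 * (t₁ * t₂)) * X ^ 4
  a₆ := 0

/-- The function field of the elliptic surface. -/
abbrev EllipticSurfaceField (t₁ t₂ : ℂ) : Type := (ellipticSurface t₁ t₂).toAffine.FunctionField

/-- The coordinate `u` of the base of the elliptic surface. -/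
def uFun (t₁ t₂ : ℂ) : EllipticSurfaceField t₁ t₂ :=
  algebraMap (ellipticSurface t₁ t₂).toAffine.CoordinateRing _
    (algebraMap ℂ[X] (ellipticSurface t₁ t₂).toAffine.CoordinateRing X)

/-- The two-form `du ∧ dX / Y` on the elliptic surface. -/
def ellipticSurfaceForm (t₁ t₂ : ℂ) : TwoForm (EllipticSurfaceField t₁ t₂) :=
  ratForm (yFun (ellipticSurface t₁ t₂)) (uFun t₁ t₂) (xFun (ellipticSurface t₁ t₂))

/-! ### Products of elliptic curves and Kummer surfaces -/

section Product

variable (E E' : WeierstrassCurve ℂ)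

/-- The comorphism `(x, y) ↦ (x, -y - a₁ x - a₃)` of the inversion on a Weierstrass curve. -/
def negHom : E.toAffine.CoordinateRing →ₐ[ℂ] E.toAffine.CoordinateRing :=
  AdjoinRoot.liftAlgHom E.toAffine.polynomial (Algebra.algHom ℂ ℂ[X] _)
    (WeierstrassCurve.Affine.CoordinateRing.mk E.toAffine E.toAffine.negPolynomial) (by
      have h : WeierstrassCurve.Affine.CoordinateRing.mk E.toAffine E.toAffine.polynomial = 0 :=
        AdjoinRoot.mk_self
      have hc (q : ℂ[X]) : Algebra.algHom ℂ ℂ[X] E.toAffine.CoordinateRing q =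
        WeierstrassCurve.Affine.CoordinateRing.mk E.toAffine (C q) := rfl
      simp only [WeierstrassCurve.Affine.polynomial, WeierstrassCurve.Affine.negPolynomial] at h ⊢
      simp only [eval₂_add, eval₂_sub, eval₂_mul, eval₂_pow, eval₂_X, eval₂_C, map_add, map_sub,
        map_mul, map_pow, map_neg, RingHom.coe_coe, hc] at h ⊢
      linear_combination h)

/-- The curve `E'` over the coordinate ring of the affine curve `E`. -/
abbrev overCurve : WeierstrassCurve E.toAffine.CoordinateRing :=
  E'.map (algebraMap ℂ E.toAffine.CoordinateRing)

/-- The coordinate ring of the affine surface `E × E'`: the coordinate ring of `E'` over the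
coordinate ring of `E`. -/
abbrev ProductRing : Type := (overCurve E E').toAffine.CoordinateRing

/-- The function field of the abelian surface `E × E'`. -/
abbrev ProductField : Type := FractionRing (ProductRing E E')

theorem negHom_mk_C (q : ℂ[X]) :
    negHom E (WeierstrassCurve.Affine.CoordinateRing.mk E.toAffine (C q)) =
      WeierstrassCurve.Affine.CoordinateRing.mk E.toAffine (C q) := by
  change AdjoinRoot.liftAlgHom _ _ _ _ (AdjoinRoot.of _ q) = _
  rw [AdjoinRoot.liftAlgHom_of]
  rfl

theorem negHom_mk_X :
    negHom E (WeierstrassCurve.Affine.CoordinateRing.mk E.toAffine X) =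
      WeierstrassCurve.Affine.CoordinateRing.mk E.toAffine E.toAffine.negPolynomial := by
  change AdjoinRoot.liftAlgHom _ _ _ _ (AdjoinRoot.root _) = _
  rw [AdjoinRoot.liftAlgHom_root]

theorem negHom_negHom (a : E.toAffine.CoordinateRing) : negHom E (negHom E a) = a := by
  obtain ⟨p, q, rfl⟩ := WeierstrassCurve.Affine.CoordinateRing.exists_smul_basis_eq a
  simp only [WeierstrassCurve.Affine.CoordinateRing.smul, map_add, map_mul, map_one,
    negHom_mk_C, negHom_mk_X, WeierstrassCurve.Affine.negPolynomial, map_sub, map_neg]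
  ring

/-- The comorphism of the inversion `(P, Q) ↦ (-P, -Q)` on `E × E'`. -/
def productNegHom : ProductRing E E' →ₐ[ℂ] ProductRing E E' :=
  AdjoinRoot.liftAlgHom (overCurve E E').toAffine.polynomial
    ((Algebra.algHom ℂ (E.toAffine.CoordinateRing)[X] (ProductRing E E')).comp
      (Polynomial.mapAlgHom (negHom E)))
    (WeierstrassCurve.Affine.CoordinateRing.mk (overCurve E E').toAffine
      (overCurve E E').toAffine.negPolynomial) (by
      have h : WeierstrassCurve.Affine.CoordinateRing.mk (overCurve E E').toAffine
        (overCurve E E').toAffine.polynomial = 0 := AdjoinRoot.mk_self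
      set f := (Algebra.algHom ℂ (E.toAffine.CoordinateRing)[X] (ProductRing E E')).comp
        (Polynomial.mapAlgHom (negHom E)) with hf
      have hc (r : ℂ) : f (C (algebraMap ℂ _ r)) =
          WeierstrassCurve.Affine.CoordinateRing.mk (overCurve E E').toAffine
            (C (C (algebraMap ℂ _ r))) := by
        change AdjoinRoot.of _ (Polynomial.map _ _) = _
        rw [Polynomial.map_C]
        change AdjoinRoot.of _ (C (negHom E (algebraMap ℂ _ r))) = _
        rw [(negHom E).commutes r]
        rfl
      have hX : f X =
          WeierstrassCurve.Affine.CoordinateRing.mk (overCurve E E').toAffine (C X) := by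
        change AdjoinRoot.of _ (Polynomial.map _ _) = _
        rw [Polynomial.map_X]
        rfl
      simp only [WeierstrassCurve.Affine.polynomial, WeierstrassCurve.Affine.negPolynomial] at h ⊢
      simp only [eval₂_add, eval₂_sub, eval₂_mul, eval₂_pow, eval₂_X, eval₂_C, map_add, map_sub,
        map_mul, map_pow, map_neg, RingHom.coe_coe, WeierstrassCurve.map_a₁,
        WeierstrassCurve.map_a₂, WeierstrassCurve.map_a₃, WeierstrassCurve.map_a₄,
        WeierstrassCurve.map_a₆, hc, hX] at h ⊢
      linear_combination h)

theorem productNegHom_mk_C (q : (E.toAffine.CoordinateRing)[X]) :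
    productNegHom E E' (WeierstrassCurve.Affine.CoordinateRing.mk (overCurve E E').toAffine (C q)) =
      WeierstrassCurve.Affine.CoordinateRing.mk (overCurve E E').toAffine
        (C (q.map (negHom E : E.toAffine.CoordinateRing →+* E.toAffine.CoordinateRing))) := by
  change AdjoinRoot.liftAlgHom _ _ _ _ (AdjoinRoot.of _ q) = _
  rw [AdjoinRoot.liftAlgHom_of]
  rfl

theorem productNegHom_mk_X :
    productNegHom E E' (WeierstrassCurve.Affine.CoordinateRing.mk (overCurve E E').toAffine X) =
      WeierstrassCurve.Affine.CoordinateRing.mk (overCurve E E').toAffine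
        (overCurve E E').toAffine.negPolynomial := by
  change AdjoinRoot.liftAlgHom _ _ _ _ (AdjoinRoot.root _) = _
  rw [AdjoinRoot.liftAlgHom_root]

theorem productNegHom_productNegHom (a : ProductRing E E') :
    productNegHom E E' (productNegHom E E' a) = a := by
  obtain ⟨p, q, rfl⟩ := WeierstrassCurve.Affine.CoordinateRing.exists_smul_basis_eq a
  have hn : (negHom E : E.toAffine.CoordinateRing →+* E.toAffine.CoordinateRing).comp
      (negHom E : E.toAffine.CoordinateRing →+* E.toAffine.CoordinateRing) = RingHom.id _ :=
    RingHom.ext (negHom_negHom E)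
  have hc (r : ℂ) : (negHom E : E.toAffine.CoordinateRing →+* E.toAffine.CoordinateRing)
      (algebraMap ℂ _ r) = algebraMap ℂ _ r := (negHom E).commutes r
  simp only [WeierstrassCurve.Affine.CoordinateRing.smul, map_add, map_mul, map_one,
    productNegHom_mk_C, productNegHom_mk_X, WeierstrassCurve.Affine.negPolynomial, map_sub,
    map_neg, Polynomial.map_map, hn, Polynomial.map_id,
    Polynomial.map_C, Polynomial.map_X, WeierstrassCurve.map_a₁, WeierstrassCurve.map_a₃, hc]
  ring

/-- The inversion `-1` of the abelian surface `E × E'`, acting on its function field. -/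
def productNeg : ProductField E E' ≃ₐ[ℂ] ProductField E E' :=
  IsFractionRing.algEquivOfAlgEquiv
    (AlgEquiv.ofAlgHom (productNegHom E E') (productNegHom E E')
      (AlgHom.ext (productNegHom_productNegHom E E'))
      (AlgHom.ext (productNegHom_productNegHom E E')))

/-- The function field of the Kummer surface `Kum(E × E')`, the minimal resolution of the quotient
of `E × E'` by the inversion. -/
abbrev KummerField : IntermediateField ℂ (ProductField E E') :=
  IntermediateField.fixedField (Subgroup.zpowers (productNeg E E'))

variable {E E'} in
theorem mem_kummerField {f : ProductField E E'} (h : productNeg E E' f = f) :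
    f ∈ KummerField E E' := by
  rw [IntermediateField.mem_fixedField_iff]
  intro g hg
  exact (Subgroup.zpowers_le.2 (show productNeg E E' ∈ MulAction.stabilizer _ f from h)) hg

theorem productNeg_algebraMap (a : ProductRing E E') :
    productNeg E E' (algebraMap _ _ a) = algebraMap _ _ (productNegHom E E' a) :=
  IsFractionRing.algEquivOfAlgEquiv_algebraMap _ a

/-- The function `x` of the first factor, on the Kummer surface. -/
def kummerX₁ : KummerField E E' :=
  ⟨algebraMap (ProductRing E E') _ (algebraMap E.toAffine.CoordinateRing _
    (WeierstrassCurve.Affine.CoordinateRing.mk E.toAffine (C X))), mem_kummerField (by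
      rw [productNeg_algebraMap]
      congr 1
      change productNegHom E E' (WeierstrassCurve.Affine.CoordinateRing.mk
        (overCurve E E').toAffine (C (C _))) = WeierstrassCurve.Affine.CoordinateRing.mk
        (overCurve E E').toAffine (C (C _))
      rw [productNegHom_mk_C, Polynomial.map_C, RingHom.coe_coe, negHom_mk_C])⟩

/-- The function `x` of the second factor, on the Kummer surface. -/
def kummerX₂ : KummerField E E' :=
  ⟨algebraMap (ProductRing E E') _
    (WeierstrassCurve.Affine.CoordinateRing.mk (overCurve E E').toAffine (C X)),
    mem_kummerField (by
      rw [productNeg_algebraMap, productNegHom_mk_C, Polynomial.map_X])⟩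

/-- The function `η₁ η₂` on the Kummer surface, where `η = 2 y + a₁ x + a₃` on each factor; it is
`4 y₁ y₂` for curves of the form `y² = f(x)`. -/
def kummerEta : KummerField E E' :=
  ⟨algebraMap (ProductRing E E') _
    (algebraMap E.toAffine.CoordinateRing _
      (WeierstrassCurve.Affine.CoordinateRing.mk E.toAffine (X - E.toAffine.negPolynomial)) *
    WeierstrassCurve.Affine.CoordinateRing.mk (overCurve E E').toAffine
      (X - (overCurve E E').toAffine.negPolynomial)),
    mem_kummerField (by
      rw [productNeg_algebraMap]
      congr 1
      have hc (r : ℂ) : (negHom E : E.toAffine.CoordinateRing →+* E.toAffine.CoordinateRing)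
        (algebraMap ℂ _ r) = algebraMap ℂ _ r := (negHom E).commutes r
      have ha (b : E.toAffine.CoordinateRing) :
        productNegHom E E' (algebraMap E.toAffine.CoordinateRing (ProductRing E E') b) =
          algebraMap E.toAffine.CoordinateRing (ProductRing E E') (negHom E b) := by
        change productNegHom E E' (WeierstrassCurve.Affine.CoordinateRing.mk
          (overCurve E E').toAffine (C (C b))) = WeierstrassCurve.Affine.CoordinateRing.mk
          (overCurve E E').toAffine (C (C (negHom E b)))
        rw [productNegHom_mk_C, Polynomial.map_C, RingHom.coe_coe]
      simp only [map_mul, map_add, map_sub, map_neg, ha, productNegHom_mk_X, productNegHom_mk_C,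
        negHom_mk_C, negHom_mk_X, WeierstrassCurve.Affine.negPolynomial,
        Polynomial.map_C, Polynomial.map_X, WeierstrassCurve.map_a₁,
        WeierstrassCurve.map_a₃, hc]
      ring)⟩

/-- The holomorphic two-form `(dx₁ / η₁) ∧ (dx₂ / η₂)` on the Kummer surface, unique up to a
constant factor. -/
def kummerForm : TwoForm (KummerField E E') :=
  ratForm (kummerEta E E') (kummerX₁ E E') (kummerX₂ E E')

/-- A Nikulin involution of `Kum(E × E')`: an involution that preserves the holomorphic two-form.
(On a K3 surface every birational self-map is biregular.) -/
def IsNikulinInvolution (σ : KummerField E E' ≃ₐ[ℂ] KummerField E E') : Prop :=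
  σ ≠ 1 ∧ σ * σ = 1 ∧
    pullback (σ : KummerField E E' →ₐ[ℂ] KummerField E E') (kummerForm E E') = kummerForm E E'

end Product

/-! ### The twisted Legendre pencil -/

/-- The polynomial `y² - 16 l x (x - 1) (x - w) (w - lam²) (w - 1 - lam²)` in the variables
`y, x, w` of index `0, 1, 2`. -/
def pencilPoly (lam : ℂ) (l : ℂˣ) : MvPolynomial (Fin 3) ℂ :=
  MvPolynomial.X 0 ^ 2 - MvPolynomial.C (16 * (l : ℂ)) * (MvPolynomial.X 1 *
    (MvPolynomial.X 1 - 1) * (MvPolynomial.X 1 - MvPolynomial.X 2) *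
    (MvPolynomial.X 2 - MvPolynomial.C (lam ^ 2)) *
    (MvPolynomial.X 2 - 1 - MvPolynomial.C (lam ^ 2)))

theorem pencilPoly_irreducible (lam : ℂ) (l : ℂˣ) : Irreducible (pencilPoly lam l) := by
  rw [← MulEquiv.irreducible_iff (MvPolynomial.finSuccEquiv ℂ 2)]
  have e1 : (1 : Fin 3) = Fin.succ 0 := rfl
  have e2 : (2 : Fin 3) = Fin.succ 1 := rfl
  have hC (r : ℂ) : MvPolynomial.finSuccEquiv ℂ 2 (MvPolynomial.C r) =
      Polynomial.C (MvPolynomial.C r) := by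
    simp [MvPolynomial.finSuccEquiv_apply]
  set h : MvPolynomial (Fin 2) ℂ := MvPolynomial.C (16 * (l : ℂ)) *
    ((MvPolynomial.X 0 - 1) * (MvPolynomial.X 0 - MvPolynomial.X 1) *
    (MvPolynomial.X 1 - MvPolynomial.C (lam ^ 2)) *
    (MvPolynomial.X 1 - 1 - MvPolynomial.C (lam ^ 2))) with hh
  have hp : MvPolynomial.finSuccEquiv ℂ 2 (pencilPoly lam l) =
      Polynomial.X ^ 2 - Polynomial.C (MvPolynomial.X 0 * h) := by
    simp only [pencilPoly, map_sub, map_one, map_mul, map_pow, e1, e2,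
      MvPolynomial.finSuccEquiv_X_zero, MvPolynomial.finSuccEquiv_X_succ, hC, hh]
    ring
  rw [hp]
  have hm : (Polynomial.X ^ 2 - Polynomial.C (MvPolynomial.X 0 * h)).Monic :=
    Polynomial.monic_X_pow_sub_C _ (by norm_num)
  have hd : (Polynomial.X ^ 2 - Polynomial.C (MvPolynomial.X 0 * h)).degree = 2 := by
    rw [Polynomial.degree_X_pow_sub_C (by norm_num)]
    rfl
  have hX : Prime (MvPolynomial.X 0 : MvPolynomial (Fin 2) ℂ) := MvPolynomial.X_prime
  have hP := Ideal.isPrime_span_singleton_of_prime hX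
  refine Polynomial.irreducible_of_eisenstein_criterion hP ?_ ?_ ?_ ?_ hm.isPrimitive
  · rw [hm.leadingCoeff]
    exact (Ideal.ne_top_iff_one _).1 hP.ne_top
  · intro n hn
    rw [hd] at hn
    have hn' : n < 2 := by exact_mod_cast hn
    have hcm : MvPolynomial.X 0 * h ∈
        Ideal.span {(MvPolynomial.X 0 : MvPolynomial (Fin 2) ℂ)} :=
      Ideal.mem_span_singleton.2 ⟨h, rfl⟩
    interval_cases n
    · rw [Polynomial.coeff_sub, Polynomial.coeff_C_zero, Polynomial.coeff_X_pow]
      simpa using hcm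
    · simp [Polynomial.coeff_X_pow]
  · rw [hd]
    norm_num
  · intro h0
    have h1 : (Polynomial.X ^ 2 - Polynomial.C (MvPolynomial.X 0 * h)).coeff 0 =
        -(MvPolynomial.X 0 * h) := by
      rw [Polynomial.coeff_sub, Polynomial.coeff_C_zero, Polynomial.coeff_X_pow]
      simp
    rw [h1, Ideal.span_singleton_pow, Ideal.mem_span_singleton, dvd_neg, pow_two] at h0
    have h2 := (mul_dvd_mul_iff_left hX.ne_zero).1 h0
    obtain ⟨w, hw⟩ := Infinite.exists_notMem_finset ({0, lam ^ 2, 1 + lam ^ 2} : Finset ℂ)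
    obtain ⟨q, hq⟩ := h2
    have h3 := congrArg (MvPolynomial.eval ![0, w]) hq
    simp only [Finset.mem_insert, Finset.mem_singleton, not_or] at hw
    simp only [hh, map_mul, map_sub, map_one, MvPolynomial.eval_C, MvPolynomial.eval_X,
      Matrix.cons_val_zero, Matrix.cons_val_one, zero_mul, mul_eq_zero, Units.ne_zero, false_or,
      zero_sub, neg_eq_zero, one_ne_zero, hw.1, sub_eq_zero, hw.2.1, OfNat.ofNat_ne_zero] at h3
    exact hw.2.2 (by linear_combination h3)

instance pencilPoly_isPrime (lam : ℂ) (l : ℂˣ) : (Ideal.span {pencilPoly lam l}).IsPrime :=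
  Ideal.isPrime_span_singleton_of_prime (pencilPoly_irreducible lam l).prime

/-- The function field of the twisted Legendre pencil. -/
abbrev PencilField (lam : ℂ) (l : ℂˣ) : Type := SurfaceField (pencilPoly lam l)

/-- The two-form `dw ∧ dx / y` on the twisted Legendre pencil. -/
def pencilForm (lam : ℂ) (l : ℂˣ) : TwoForm (PencilField lam l) :=
  ratForm (coord (pencilPoly lam l) 0)
    (coord (pencilPoly lam l) 2) (coord (pencilPoly lam l) 1)

/-! ### The moduli -/

/-- The Legendre parameters `t₁, t₂` of two-isogenous elliptic curves that belong to the parameter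
`lam` of the Dwork pencil and to the value `l`. -/
structure IsModuli (lam : ℂ) (l : ℂˣ) (t₁ t₂ : ℂ) : Prop where
  ne_zero₁ : t₁ ≠ 0
  ne_one₁ : t₁ ≠ 1
  ne_zero₂ : t₂ ≠ 0
  ne_one₂ : t₂ ≠ 1
  isogenous : t₁ ^ 2 * t₂ ^ 2 - 2 * t₁ * t₂ * (t₁ + t₂) + t₁ ^ 2 + t₂ ^ 2 - 12 * t₁ * t₂ -
    2 * (t₁ + t₂) + 1 = 0
  lam_sq : lam ^ 2 = -((t₁ + 1) * (t₂ + 1)) / (2 * ((t₁ - 1) * (t₂ - 1)))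
  branch : (t₁ - 1) * (t₂ - 1) = -4 * (l : ℂ)

end KummerSandwich

end

open KummerSandwich

open Polynomial

/-! A dominant rational map is an embedding of function fields, so the claim is about explicit
subfields and their automorphisms. Put c = u + u⁻¹ + 4λ², and let m = λ - √(λ²-1), so that m² = l.
In the coordinates ξ = X/(4m²u²), η = Y/(2muX) the elliptic surface reads η² = ξ + ξ⁻¹ - c. The
pivot of the proof is its double cover ξ = a², the model field M = ℂ(u, a, η) with η² = a² + a⁻² -
c, against which every other surface is compared.

Dwork quartic: put P = X₀X₁X₂X₃, A = X₀⁴ + X₂⁴, B = X₁⁴ + X₃⁴, so that A + B + 4λP = 0. Expanding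
AB/P² gives a² + a⁻² - u - u⁻¹ for a = X₀X₃/(X₁X₂), u = -(X₂X₃/(X₀X₁))², while AB = -A(A + 4λP);
hence η = i(A/P + 2λ) solves the model equation and M embeds in ℂ(𝒳). The subfield ℂ(u, a², η) is
invariant under the Greene-Plesser group and of index at most 16, and the group has at least 16
elements, so this subfield is the mirror field (`exists_mirror_equiv`).

Kummer surface: with t₁ = r², rescaled coordinates bring the Kummer surface to the form d² = -fg,
where f = x + x⁻¹ - α and g = z + z⁻¹ + κα. Put u = x/z and a = κd/g. Then a²g = -κ²f is quadratic
in z over ℂ(u, a), with discriminant (2κaη)² for a function η that satisfies the model equation. The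
quadratic formula inverts the substitution, so M is the Kummer field, with two-form proportional to
du∧da/(uaη) (`exists_kummer_equiv`).

Sandwich: the involutions a ↦ -a and (a, η) ↦ (a⁻¹, -η) fix u and preserve this two-form. The first
has quotient ℂ(u, a², η), the mirror. The joint quotient is generated by u, T = (ξ + ξ⁻¹)/2 and S =
η(ξ - ξ⁻¹)/2, with S² = (T² - 1)(2T - c); since M satisfies the same equation through t = a(a + η),
s = a(2t - c), this quotient is again M, which gives φ. A third involution, inverting u, fixing t
and negating s, has the twisted Legendre pencil as quotient, which gives χ.

Two general tools carry the field theory: `injective_of_trdeg_le`, by which a solution of the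
equations in a field of the right transcendence degree defines an embedding, and
`eq_fixedField_of_finrank_le`, which identifies fixed fields by comparing a degree bound with a
number of automorphisms. -/

noncomputable section

namespace KummerSandwich

/-! ### Relative algebraic closures and transcendence degree -/

section RelAlgClosure

variable {K : Type} [Field K] [Algebra ℂ K]

/-- The relative algebraic closure in `K` of the subfield generated by `S` over `ℂ`. -/
def relAlgClosure (S : Set K) : IntermediateField ℂ K :=
  (algebraicClosure (IntermediateField.adjoin ℂ S) K).restrictScalars ℂ

theorem mem_relAlgClosure {S : Set K} {z : K} :
    z ∈ relAlgClosure S ↔ IsAlgebraic (IntermediateField.adjoin ℂ S) z := by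
  rw [relAlgClosure, IntermediateField.mem_restrictScalars, mem_algebraicClosure_iff]

theorem subset_relAlgClosure (S : Set K) : S ⊆ relAlgClosure S := fun z hz =>
  mem_relAlgClosure.2 (isAlgebraic_algebraMap
    (⟨z, IntermediateField.subset_adjoin ℂ S hz⟩ : IntermediateField.adjoin ℂ S))

theorem mem_relAlgClosure_of_pow {S : Set K} {z : K} (n : ℕ) (hn : 0 < n)
    (h : z ^ n ∈ relAlgClosure S) : z ∈ relAlgClosure S :=
  mem_relAlgClosure.2 ((mem_relAlgClosure.1 h).of_pow hn)

theorem mem_relAlgClosure_of_quadratic {S : Set K} {z b c : K}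
    (hb : b ∈ relAlgClosure S) (hc : c ∈ relAlgClosure S) (h : z ^ 2 + b * z + c = 0) :
    z ∈ relAlgClosure S := by
  have : CharZero K := charZero_of_injective_algebraMap (algebraMap ℂ K).injective
  have h2 : (2 : K) ∈ relAlgClosure S := ofNat_mem _ 2
  have h1 : z + b / 2 ∈ relAlgClosure S := by
    refine mem_relAlgClosure_of_pow 2 two_pos ?_
    have : (z + b / 2) ^ 2 = (b / 2) ^ 2 - c := by linear_combination h
    rw [this]
    exact sub_mem (pow_mem (div_mem hb h2) 2) hc
  simpa using sub_mem h1 (div_mem hb h2)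

theorem relAlgClosure_eq_top {S T : Set K} (hT : IntermediateField.adjoin ℂ T = ⊤)
    (h : T ⊆ relAlgClosure S) : relAlgClosure S = ⊤ :=
  top_le_iff.1 (hT ▸ IntermediateField.adjoin_le_iff.2 h)

/-- Transitivity of algebraic dependence. It lets one pair of coordinates be traded for another
without recomputing minimal equations. -/
theorem relAlgClosure_le {S T : Set K} (h : S ⊆ relAlgClosure T) :
    relAlgClosure S ≤ relAlgClosure T := by
  intro z hz
  have h1 : IntermediateField.adjoin ℂ S ≤ relAlgClosure T := IntermediateField.adjoin_le_iff.2 h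
  obtain ⟨p, hp, hpz⟩ := mem_relAlgClosure.1 hz
  let j : IntermediateField.adjoin ℂ S →+* algebraicClosure (IntermediateField.adjoin ℂ T) K :=
    (IntermediateField.inclusion h1).toRingHom
  have hz' : IsAlgebraic (algebraicClosure (IntermediateField.adjoin ℂ T) K) z := by
    refine ⟨p.map j, (Polynomial.map_ne_zero_iff j.injective).2 hp, ?_⟩
    rw [aeval_def, eval₂_map]
    exact hpz
  exact mem_relAlgClosure.2 (IsAlgebraic.restrictScalars _ hz')

theorem isAlgebraic_adjoin_of_relAlgClosure {S : Set K} (h : relAlgClosure S = ⊤) :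
    Algebra.IsAlgebraic (Algebra.adjoin ℂ S) K := by
  open scoped IntermediateField.algebraAdjoinAdjoin in
  refine (IsFractionRing.comap_isAlgebraic_iff (A := Algebra.adjoin ℂ S)
    (K := IntermediateField.adjoin ℂ S) (C := K)).2 ⟨fun z => ?_⟩
  exact mem_relAlgClosure.1 (h ▸ IntermediateField.mem_top)

/-- Two elements over which a field of transcendence degree two is algebraic must form a
transcendence basis. This supplies most nonvanishing statements below; applied to a pair containing
0 it yields contradictions. -/
theorem transcendental_of_relAlgClosure {u x : K} (hK : Algebra.trdeg ℂ K = 2)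
    (h : relAlgClosure {u, x} = ⊤) : Transcendental ℂ u ∧ Transcendental ℂ x := by
  have hr : Set.range ![u, x] = {u, x} := by simp [Set.pair_comm]
  have := isAlgebraic_adjoin_of_relAlgClosure h
  rw [← hr] at this
  have hb := Algebra.IsAlgebraic.isTranscendenceBasis_of_lift_le_trdeg_of_finite ℂ ![u, x]
    (by simp [hK])
  exact ⟨hb.1.transcendental 0, hb.1.transcendental 1⟩

/-- A homomorphism from a domain to a field of the same finite transcendence degree is injective if
the field is algebraic over the image. -/
theorem injective_of_trdeg_le {A : Type} [CommRing A] [IsDomain A] [Algebra ℂ A] (f : A →ₐ[ℂ] K)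
    (fin : Algebra.trdeg ℂ A < Cardinal.aleph0) (h : Algebra.trdeg ℂ A ≤ Algebra.trdeg ℂ K)
    {S : Set K} (hS : relAlgClosure S = ⊤) (hf : S ⊆ Set.range f) :
    Function.Injective f := by
  have := isAlgebraic_adjoin_of_relAlgClosure hS
  -- A transcendence basis of `K` is chosen inside `S` and lifted to `A`. The lift is independent,
  -- hence a transcendence basis of `A` by the degree inequality.
  obtain ⟨t, hts, ht⟩ := exists_isTranscendenceBasis_subset (R := ℂ) S
  choose g hg using fun i : t => hf (hts i.2)
  have hfg : f ∘ g = ((↑) : t → K) := funext hg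
  have hgi : AlgebraicIndependent ℂ g := by
    refine AlgebraicIndependent.of_comp f ?_
    rw [hfg]
    exact ht.1
  have hgb : IsTranscendenceBasis ℂ g :=
    hgi.isTranscendenceBasis_of_trdeg_le fin (h.trans ht.cardinalMk_eq_trdeg.ge)
  have hga := hgb.isAlgebraic
  refine (injective_iff_map_eq_zero f).2 fun a ha => ?_
  by_contra ha0
  -- A nonzero kernel element divides a nonzero polynomial in the lifted basis. Its image would be
  -- an algebraic relation in the basis of `K`.
  obtain ⟨r, hr, b, hb⟩ := (hga.isAlgebraic a).exists_nonzero_dvd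
    (mem_nonZeroDivisors_of_ne_zero ha0)
  have hr0 : f r = 0 := by
    have : f (algebraMap _ A r) = 0 := by rw [hb, map_mul, ha, zero_mul]
    exact this
  obtain ⟨p, hp⟩ : ∃ p : MvPolynomial t ℂ, MvPolynomial.aeval g p = (r : A) := by
    have h := Algebra.adjoin_range_eq_range_aeval ℂ g
    exact (SetLike.ext_iff.1 h (r : A)).1 r.2
  rw [← hp, ← AlgHom.comp_apply, MvPolynomial.comp_aeval] at hr0
  have hp0 : p = 0 := ht.1 (by rw [map_zero, ← hr0]; congr 2; exact hfg.symm)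
  apply hr
  ext
  rw [← hp, hp0, map_zero]
  rfl

end RelAlgClosure

/-! ### Degrees of field extensions and fixed fields -/

section Degree

theorem finrank_le_of_adjoin_simple {L K : Type*} [Field L] [Field K] [Algebra L K] {z : K}
    (hz : IntermediateField.adjoin L {z} = ⊤) {p : L[X]} (hp : p.Monic) (hpz : aeval z p = 0) :
    FiniteDimensional L K ∧ Module.finrank L K ≤ p.natDegree := by
  have hi : IsIntegral L z := ⟨p, hp, hpz⟩
  have h1 := IntermediateField.adjoin.finrank hi
  have h2 := IntermediateField.adjoin.finiteDimensional hi
  rw [hz] at h1 h2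
  rw [IntermediateField.finrank_top'] at h1
  refine ⟨IntermediateField.topEquiv.toLinearEquiv.finiteDimensional, ?_⟩
  rw [h1]
  exact Polynomial.natDegree_le_of_dvd (minpoly.dvd L z hpz) hp.ne_zero

theorem finrank_le_of_adjoin_pair {L K : Type*} [Field L] [Field K] [Algebra L K] {z w : K}
    (hzw : IntermediateField.adjoin L {z, w} = ⊤) {p q : L[X]} (hp : p.Monic)
    (hpz : aeval z p = 0) (hq : q.Monic) (hqw : aeval w q = 0) :
    FiniteDimensional L K ∧ Module.finrank L K ≤ p.natDegree * q.natDegree := by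
  have hi : IsIntegral L z := ⟨p, hp, hpz⟩
  have hj : IsIntegral L w := ⟨q, hq, hqw⟩
  have := IntermediateField.adjoin.finiteDimensional hi
  have := IntermediateField.adjoin.finiteDimensional hj
  have h0 : IntermediateField.adjoin L {z} ⊔ IntermediateField.adjoin L {w} = ⊤ := by
    rw [← hzw, ← IntermediateField.adjoin_union]
    rfl
  have h1 := IntermediateField.finrank_sup_le (IntermediateField.adjoin L {z})
    (IntermediateField.adjoin L {w})
  have h2 := IntermediateField.finiteDimensional_sup (IntermediateField.adjoin L {z})
    (IntermediateField.adjoin L {w})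
  rw [h0] at h1 h2
  rw [IntermediateField.finrank_top', IntermediateField.adjoin.finrank hi,
    IntermediateField.adjoin.finrank hj] at h1
  refine ⟨IntermediateField.topEquiv.toLinearEquiv.finiteDimensional, h1.trans ?_⟩
  exact Nat.mul_le_mul (Polynomial.natDegree_le_of_dvd (minpoly.dvd L z hpz) hp.ne_zero)
    (Polynomial.natDegree_le_of_dvd (minpoly.dvd L w hqw) hq.ne_zero)

theorem adjoin_eq_top_of_subset {K : Type*} [Field K] [Algebra ℂ K] (L : IntermediateField ℂ K)
    {S T : Set K} (hS : IntermediateField.adjoin ℂ S = ⊤)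
    (hT : S ⊆ IntermediateField.adjoin L T) : IntermediateField.adjoin L T = ⊤ := by
  have h : IntermediateField.adjoin ℂ S ≤ (IntermediateField.adjoin L T).restrictScalars ℂ :=
    IntermediateField.adjoin_le_iff.2 hT
  rw [hS] at h
  exact top_le_iff.1 fun x _ => h IntermediateField.mem_top

theorem mem_adjoin_of_mem {K : Type*} [Field K] [Algebra ℂ K] {L : IntermediateField ℂ K}
    {T : Set K} {x : K} (hx : x ∈ L) : x ∈ IntermediateField.adjoin L T :=
  (IntermediateField.adjoin L T).algebraMap_mem ⟨x, hx⟩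

/-- Distinct automorphisms over the fixed field `M` bound [K : M] below by `n`, while [K : L] ≤ `n`
and `L ≤ M`; so the two fields coincide. Only a finite sample `s` of `H` is needed, not the order of
`H`. -/
theorem eq_fixedField_of_finrank_le {K : Type*} [Field K] [Algebra ℂ K]
    (H : Subgroup (K ≃ₐ[ℂ] K)) (L : IntermediateField ℂ K)
    (hL : L ≤ IntermediateField.fixedField H) (n : ℕ) [FiniteDimensional L K]
    (hn : Module.finrank L K ≤ n) (s : Finset (K ≃ₐ[ℂ] K)) (hs : ∀ σ ∈ s, σ ∈ H)
    (hc : n ≤ s.card) :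
    L = IntermediateField.fixedField H ∧ Module.finrank L K = n := by
  set M := IntermediateField.fixedField H with hM
  have hfin : FiniteDimensional M K := by
    let _ : Algebra L M := (IntermediateField.inclusion hL).toRingHom.toAlgebra
    have _ : IsScalarTower L M K := IsScalarTower.of_algebraMap_eq fun _ => rfl
    exact Module.Finite.of_restrictScalars_finite L M K
  let F : s → (K ≃ₐ[M] K) := fun σ => AlgEquiv.ofRingEquiv (f := (σ : K ≃ₐ[ℂ] K).toRingEquiv)
    fun x => by
      have := (IntermediateField.mem_fixedField_iff H (x : K)).1 x.2 σ (hs σ σ.2)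
      exact this
  have hF : Function.Injective F := fun σ τ h => by
    ext x
    exact congrArg (fun e : K ≃ₐ[M] K => e x) h
  have h1 : s.card ≤ Module.finrank M K := by
    refine le_trans ?_ (AlgEquiv.card_le (F := M) (K := K))
    rw [← Fintype.card_coe]
    exact Fintype.card_le_of_injective F hF
  have h2 : L = M := IntermediateField.eq_of_le_of_finrank_le' hL (hn.trans (hc.trans h1))
  refine ⟨h2, le_antisymm hn ?_⟩
  have := hc.trans h1
  rwa [← h2] at this

/-- If `K` is generated over `L` by a root `z` of a monic polynomial `p` and if there are at least
`deg p` automorphisms in `H`, all fixing `L`, then `L` is the fixed field of `H`. -/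
theorem eq_fixedField_of_simple {K : Type*} [Field K] [Algebra ℂ K]
    (H : Subgroup (K ≃ₐ[ℂ] K)) (L : IntermediateField ℂ K)
    (hL : L ≤ IntermediateField.fixedField H) {S : Set K}
    (hS : IntermediateField.adjoin ℂ S = ⊤) (z : K) (hz : S ⊆ IntermediateField.adjoin L {z})
    {p : L[X]} (hp : p.Monic) (hpz : aeval z p = 0) (s : Finset (K ≃ₐ[ℂ] K))
    (hs : ∀ σ ∈ s, σ ∈ H) (hc : p.natDegree ≤ s.card) :
    L = IntermediateField.fixedField H ∧ Module.finrank L K = p.natDegree := by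
  obtain ⟨h1, h2⟩ := finrank_le_of_adjoin_simple (adjoin_eq_top_of_subset L hS hz) hp hpz
  exact eq_fixedField_of_finrank_le H L hL _ h2 s hs hc

theorem mem_fixedField_closure {K : Type*} [Field K] [Algebra ℂ K] {T : Set (K ≃ₐ[ℂ] K)} {x : K}
    (h : ∀ σ ∈ T, σ x = x) : x ∈ IntermediateField.fixedField (Subgroup.closure T) := by
  rw [IntermediateField.mem_fixedField_iff]
  intro g hg
  exact (Subgroup.closure_le (MulAction.stabilizer _ x)).2 h hg

theorem fieldRange_le_fixedField_closure {A K : Type*} [Field A] [Field K] [Algebra ℂ A]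
    [Algebra ℂ K] (f : A →ₐ[ℂ] K) {T : Set (K ≃ₐ[ℂ] K)}
    (h : ∀ σ ∈ T, (σ : K →ₐ[ℂ] K).comp f = f) :
    f.fieldRange ≤ IntermediateField.fixedField (Subgroup.closure T) := by
  rintro _ ⟨x, rfl⟩
  exact mem_fixedField_closure fun σ hσ => DFunLike.congr_fun (h σ hσ) x

theorem mapDegree_eq_finrank {A B : Type*} [Field A] [Field B] [Algebra ℂ A] [Algebra ℂ B]
    (f : A →ₐ[ℂ] B) :
    mapDegree f = @Module.finrank A B _ _ (@Algebra.toModule _ _ _ _ f.toRingHom.toAlgebra) := by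
  let _ : Algebra A B := f.toRingHom.toAlgebra
  exact (Algebra.finrank_eq_of_equiv_equiv (AlgEquiv.ofInjectiveField f).toRingEquiv
    (RingEquiv.refl B) (by ext x; rfl)).symm

theorem mapDegree_comp {A B D : Type*} [Field A] [Field B] [Field D] [Algebra ℂ A] [Algebra ℂ B]
    [Algebra ℂ D] (g : B →ₐ[ℂ] D) (f : A →ₐ[ℂ] B) :
    mapDegree (g.comp f) = mapDegree f * mapDegree g := by
  simp only [mapDegree_eq_finrank]
  let _ : Algebra A B := f.toRingHom.toAlgebra
  let _ : Algebra B D := g.toRingHom.toAlgebra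
  let _ : Algebra A D := (g.comp f).toRingHom.toAlgebra
  have _ : IsScalarTower A B D := IsScalarTower.of_algebraMap_eq fun _ => rfl
  exact (Module.finrank_mul_finrank A B D).symm

theorem mapDegree_equiv {A B : Type*} [Field A] [Field B] [Algebra ℂ A] [Algebra ℂ B]
    (e : A ≃ₐ[ℂ] B) : mapDegree (e : A →ₐ[ℂ] B) = 1 := by
  have h : (e : A →ₐ[ℂ] B).fieldRange = ⊤ := AlgHom.fieldRange_eq_top.2 e.surjective
  rw [mapDegree, h, IntermediateField.finrank_top]

end Degree

/-! ### Function fields of Weierstrass curves -/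

section Weierstrass

theorem trdeg_fractionRing (A : Type) [CommRing A] [IsDomain A] [Algebra ℂ A] :
    Algebra.trdeg ℂ (FractionRing A) = Algebra.trdeg ℂ A := by
  have : Algebra.IsAlgebraic A (FractionRing A) :=
    IsLocalization.isAlgebraic _ (nonZeroDivisors A)
  have := trdeg_add_eq ℂ A (A := FractionRing A)
  rw [← this, trdeg_eq_zero (R := A), add_zero]

/-- The coordinate ring is finite over R[X], with basis 1, Y. -/
theorem trdeg_coordinateRing {R : Type} [CommRing R] [IsDomain R] (W : WeierstrassCurve R) :
    Algebra.trdeg R W.toAffine.CoordinateRing = 1 := by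
  have : Module.Finite R[X] W.toAffine.CoordinateRing :=
    .of_basis (WeierstrassCurve.Affine.CoordinateRing.basis W.toAffine)
  have := trdeg_add_eq R R[X] (A := W.toAffine.CoordinateRing)
  rw [← this, trdeg_eq_zero (R := R[X]), add_zero, Polynomial.trdeg_of_isDomain]

/-- A constant of the base ring, as a function on a Weierstrass curve. -/
def baseFun {R : Type} [CommRing R] (W : WeierstrassCurve R) (r : R) : W.toAffine.FunctionField :=
  algebraMap W.toAffine.CoordinateRing _ (algebraMap R W.toAffine.CoordinateRing r)

theorem functionField_equation {R : Type} [CommRing R] (W : WeierstrassCurve R) :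
    yFun W ^ 2 + baseFun W W.a₁ * xFun W * yFun W + baseFun W W.a₃ * yFun W =
      xFun W ^ 3 + baseFun W W.a₂ * xFun W ^ 2 + baseFun W W.a₄ * xFun W + baseFun W W.a₆ := by
  have h : WeierstrassCurve.Affine.CoordinateRing.mk W.toAffine W.toAffine.polynomial = 0 :=
    AdjoinRoot.mk_self
  have hb (r : R) : algebraMap R W.toAffine.CoordinateRing r =
    WeierstrassCurve.Affine.CoordinateRing.mk W.toAffine (C (C r)) := rfl
  have h2 := congrArg (algebraMap W.toAffine.CoordinateRing W.toAffine.FunctionField) h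
  simp only [WeierstrassCurve.Affine.polynomial, xFun, yFun, baseFun, hb, map_add, map_sub, map_mul,
    map_pow, map_zero] at h2 ⊢
  linear_combination h2

theorem adjoin_coordinateRing {R : Type} [CommRing R] [Algebra ℂ R] (W : WeierstrassCurve R)
    {T : Set R} (hT : Algebra.adjoin ℂ T = ⊤) :
    Algebra.adjoin ℂ (algebraMap R W.toAffine.CoordinateRing '' T ∪
      {WeierstrassCurve.Affine.CoordinateRing.mk W.toAffine (C X),
        WeierstrassCurve.Affine.CoordinateRing.mk W.toAffine X}) = ⊤ := by
  set M := Algebra.adjoin ℂ (algebraMap R W.toAffine.CoordinateRing '' T ∪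
      {WeierstrassCurve.Affine.CoordinateRing.mk W.toAffine (C X),
        WeierstrassCurve.Affine.CoordinateRing.mk W.toAffine X}) with hM
  have hb (r : R) : algebraMap R W.toAffine.CoordinateRing r ∈ M := by
    have h1 : (⊤ : Subalgebra ℂ R) ≤ M.comap (Algebra.algHom ℂ R W.toAffine.CoordinateRing) := by
      rw [← hT]
      exact Algebra.adjoin_le fun t ht => Algebra.subset_adjoin (Or.inl ⟨t, ht, rfl⟩)
    exact h1 (Algebra.mem_top (x := r))
  have hx : WeierstrassCurve.Affine.CoordinateRing.mk W.toAffine (C X) ∈ M :=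
    Algebra.subset_adjoin (Or.inr (Or.inl rfl))
  have hy : WeierstrassCurve.Affine.CoordinateRing.mk W.toAffine X ∈ M :=
    Algebra.subset_adjoin (Or.inr (Or.inr rfl))
  have hp (p : R[X]) : WeierstrassCurve.Affine.CoordinateRing.mk W.toAffine (C p) ∈ M := by
    induction p using Polynomial.induction_on' with
    | add p q hp hq => rw [C_add, map_add]; exact add_mem hp hq
    | monomial n r =>
      rw [← C_mul_X_pow_eq_monomial, C_mul, C_pow, map_mul, map_pow]
      exact mul_mem (hb r) (pow_mem hx n)
  refine top_le_iff.1 fun a _ => ?_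
  obtain ⟨p, q, rfl⟩ := WeierstrassCurve.Affine.CoordinateRing.exists_smul_basis_eq a
  rw [WeierstrassCurve.Affine.CoordinateRing.smul, WeierstrassCurve.Affine.CoordinateRing.smul,
    mul_one]
  exact add_mem (hp p) (mul_mem (hp q) hy)

variable {R : Type} [CommRing R] [IsDomain R] [Algebra ℂ R] (W : WeierstrassCurve R)

theorem trdeg_complex_coordinateRing :
    Algebra.trdeg ℂ W.toAffine.CoordinateRing = Algebra.trdeg ℂ R + 1 := by
  have : FaithfulSMul ℂ R := inferInstance
  rw [← trdeg_add_eq ℂ R (A := W.toAffine.CoordinateRing), trdeg_coordinateRing]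

theorem trdeg_functionField :
    Algebra.trdeg ℂ W.toAffine.FunctionField = Algebra.trdeg ℂ R + 1 := by
  rw [trdeg_fractionRing, trdeg_complex_coordinateRing]

theorem adjoin_functionField {T : Set R} (hT : Algebra.adjoin ℂ T = ⊤) :
    IntermediateField.adjoin ℂ (baseFun W '' T ∪ {xFun W, yFun W}) = ⊤ := by
  set M := IntermediateField.adjoin ℂ (baseFun W '' T ∪ {xFun W, yFun W}) with hM
  have hc (a : W.toAffine.CoordinateRing) :
      algebraMap W.toAffine.CoordinateRing W.toAffine.FunctionField a ∈ M := by
    have h1 : (⊤ : Subalgebra ℂ W.toAffine.CoordinateRing) ≤ M.toSubalgebra.comap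
        (Algebra.algHom ℂ W.toAffine.CoordinateRing W.toAffine.FunctionField) := by
      rw [← adjoin_coordinateRing W hT]
      refine Algebra.adjoin_le ?_
      rintro z (⟨t, ht, rfl⟩ | rfl | rfl)
      · exact IntermediateField.subset_adjoin ℂ _ (Or.inl ⟨t, ht, rfl⟩)
      · exact IntermediateField.subset_adjoin ℂ _ (Or.inr (Or.inl rfl))
      · exact IntermediateField.subset_adjoin ℂ _ (Or.inr (Or.inr rfl))
    exact h1 (Algebra.mem_top (x := a))
  refine top_le_iff.1 fun z _ => ?_
  obtain ⟨a, b, _, rfl⟩ := IsFractionRing.div_surjective (A := W.toAffine.CoordinateRing) z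
  exact div_mem (hc a) (hc b)

/-- A point of `W` with coordinates in `K` gives a map on the coordinate ring; equality of
transcendence degrees makes it injective, so it extends to fractions. -/
theorem exists_functionField_hom {K : Type} [Field K] [Algebra ℂ K] (f : R →ₐ[ℂ] K) {x y : K}
    (h : y ^ 2 + f W.a₁ * x * y + f W.a₃ * y = x ^ 3 + f W.a₂ * x ^ 2 + f W.a₄ * x + f W.a₆)
    (hK : Algebra.trdeg ℂ R + 1 = Algebra.trdeg ℂ K) (fin : Algebra.trdeg ℂ K < Cardinal.aleph0)
    {S : Set K} (hS : relAlgClosure S = ⊤) (hSf : S ⊆ Set.range f ∪ {x, y}) :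
    ∃ F : W.toAffine.FunctionField →ₐ[ℂ] K,
      (∀ r, F (baseFun W r) = f r) ∧ F (xFun W) = x ∧ F (yFun W) = y := by
  let g : W.toAffine.CoordinateRing →ₐ[ℂ] K :=
    AdjoinRoot.liftAlgHom W.toAffine.polynomial
      (Polynomial.eval₂AlgHom f x fun _ => Commute.all _ _) y (by
      simp only [WeierstrassCurve.Affine.polynomial]
      simp only [eval₂_add, eval₂_sub, eval₂_mul, eval₂_pow, eval₂_X, eval₂_C, map_add,
        map_mul, map_pow, RingHom.coe_coe, Polynomial.eval₂AlgHom_apply]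
      linear_combination h)
  have hgb (r : R) : g (algebraMap R _ r) = f r := by
    change AdjoinRoot.liftAlgHom _ _ _ _ (AdjoinRoot.of _ (C r)) = _
    rw [AdjoinRoot.liftAlgHom_of]
    simp [Polynomial.eval₂AlgHom_apply]
  have hgx : g (WeierstrassCurve.Affine.CoordinateRing.mk W.toAffine (C X)) = x := by
    change AdjoinRoot.liftAlgHom _ _ _ _ (AdjoinRoot.of _ X) = _
    rw [AdjoinRoot.liftAlgHom_of]
    simp [Polynomial.eval₂AlgHom_apply]
  have hgy : g (WeierstrassCurve.Affine.CoordinateRing.mk W.toAffine X) = y := by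
    change AdjoinRoot.liftAlgHom _ _ _ _ (AdjoinRoot.root _) = _
    rw [AdjoinRoot.liftAlgHom_root]
  have hg : Function.Injective g := by
    refine injective_of_trdeg_le g ?_ ?_ hS ?_
    · rwa [trdeg_complex_coordinateRing, hK]
    · rw [trdeg_complex_coordinateRing, hK]
    · refine hSf.trans ?_
      rintro z (⟨r, rfl⟩ | rfl | rfl)
      · exact ⟨_, hgb r⟩
      · exact ⟨_, hgx⟩
      · exact ⟨_, hgy⟩
  refine ⟨IsFractionRing.liftAlgHom hg, fun r => ?_, ?_, ?_⟩
  · exact (IsFractionRing.lift_algebraMap hg _).trans (hgb r)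
  · exact (IsFractionRing.lift_algebraMap hg _).trans hgx
  · exact (IsFractionRing.lift_algebraMap hg _).trans hgy

end Weierstrass

/-- Homomorphisms agreeing on generators agree. -/
theorem algHom_ext_of_adjoin {A K : Type*} [Field A] [Field K] [Algebra ℂ A] [Algebra ℂ K]
    {S : Set A} (hS : IntermediateField.adjoin ℂ S = ⊤) {f g : A →ₐ[ℂ] K}
    (h : ∀ z ∈ S, f z = g z) : f = g := by
  have h1 : IntermediateField.adjoin ℂ S ≤
      { Subalgebra.toSubsemiring (AlgHom.equalizer f g) with
        inv_mem' := fun x (hx : f x = g x) => (by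
          change f x⁻¹ = g x⁻¹
          rw [map_inv₀, map_inv₀, hx])
        algebraMap_mem' := fun r => (AlgHom.equalizer f g).algebraMap_mem r } :=
    IntermediateField.adjoin_le_iff.2 h
  ext z
  rw [hS] at h1
  exact h1 (IntermediateField.mem_top (x := z))

theorem fieldRange_le_of_adjoin {A K : Type*} [Field A] [Field K] [Algebra ℂ A] [Algebra ℂ K]
    {S : Set A} (hS : IntermediateField.adjoin ℂ S = ⊤) {f : A →ₐ[ℂ] K}
    {M : IntermediateField ℂ K} (h : ∀ z ∈ S, f z ∈ M) : f.fieldRange ≤ M := by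
  rw [AlgHom.fieldRange_eq_map, ← hS, IntermediateField.adjoin_map,
    IntermediateField.adjoin_le_iff]
  rintro _ ⟨z, hz, rfl⟩
  exact h z hz

theorem relAlgClosure_eq_top_of_subset {K : Type} [Field K] [Algebra ℂ K] {S T : Set K}
    (hT : relAlgClosure T = ⊤) (h : T ⊆ relAlgClosure S) : relAlgClosure S = ⊤ :=
  top_le_iff.1 (hT ▸ relAlgClosure_le h)

theorem charZero_of_complex (K : Type*) [Field K] [Algebra ℂ K] : CharZero K :=
  charZero_of_injective_algebraMap (algebraMap ℂ K).injective

/-! ### Weierstrass curves over ℂ[u] as surfaces. -/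

theorem trdeg_functionField_polynomial (W : WeierstrassCurve ℂ[X]) :
    Algebra.trdeg ℂ W.toAffine.FunctionField = 2 := by
  rw [trdeg_functionField, Polynomial.trdeg_of_isDomain, one_add_one_eq_two]

theorem adjoin_functionField_polynomial (W : WeierstrassCurve ℂ[X]) :
    IntermediateField.adjoin ℂ {baseFun W X, xFun W, yFun W} = ⊤ := by
  have h := adjoin_functionField W (T := {X}) Polynomial.adjoin_X
  rwa [Set.image_singleton, Set.singleton_union] at h

theorem baseFun_eq_aeval (W : WeierstrassCurve ℂ[X]) (p : ℂ[X]) :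
    baseFun W p = aeval (baseFun W X) p := by
  induction p using Polynomial.induction_on' with
  | add p q hp hq => rw [map_add, ← hp, ← hq, baseFun, baseFun, baseFun, map_add, map_add]
  | monomial n r =>
    rw [← C_mul_X_pow_eq_monomial, map_mul, map_pow, aeval_X, aeval_C]
    simp only [baseFun, map_mul, map_pow]
    congr 1

theorem relAlgClosure_functionField_polynomial (W : WeierstrassCurve ℂ[X]) (h₁ : W.a₁ = 0)
    (h₃ : W.a₃ = 0) : relAlgClosure {baseFun W X, xFun W} = ⊤ := by
  refine relAlgClosure_eq_top (adjoin_functionField_polynomial W) ?_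
  have hu := subset_relAlgClosure {baseFun W X, xFun W} (Or.inl rfl)
  have hx := subset_relAlgClosure {baseFun W X, xFun W} (Or.inr rfl)
  have hb (p : ℂ[X]) : baseFun W p ∈ relAlgClosure {baseFun W X, xFun W} := by
    rw [baseFun_eq_aeval W p, aeval_eq_sum_range (p := p)]
    exact sum_mem fun i _ => IntermediateField.smul_mem _ (pow_mem hu i)
  rintro z (rfl | rfl | rfl)
  · exact hu
  · exact hx
  · refine mem_relAlgClosure_of_pow 2 two_pos ?_
    have h := functionField_equation W
    have h0 : baseFun W 0 = 0 := by simp [baseFun]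
    rw [h₁, h₃, h0, zero_mul, zero_mul, add_zero, add_zero] at h
    rw [h]
    exact add_mem (add_mem (add_mem (pow_mem hx 3) (mul_mem (hb _) (pow_mem hx 2)))
      (mul_mem (hb _) hx)) (hb _)

theorem functionField_equation_polynomial (W : WeierstrassCurve ℂ[X]) {p₂ p₄ p₆ : ℂ[X]}
    (h₁ : W.a₁ = 0) (h₂ : W.a₂ = p₂) (h₃ : W.a₃ = 0) (h₄ : W.a₄ = p₄) (h₆ : W.a₆ = p₆) :
    yFun W ^ 2 = xFun W ^ 3 + aeval (baseFun W X) p₂ * xFun W ^ 2 +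
      aeval (baseFun W X) p₄ * xFun W + aeval (baseFun W X) p₆ := by
  have h := functionField_equation W
  have h0 : baseFun W 0 = 0 := by simp [baseFun]
  rw [h₁, h₂, h₃, h₄, h₆, h0, baseFun_eq_aeval W p₂, baseFun_eq_aeval W p₄,
    baseFun_eq_aeval W p₆] at h
  linear_combination h

/-! ### The fields `ℂ(u, ξ, η)` and `ℂ(u, a, η)` -/

/-- The expression `u + u⁻¹ + 4 lam²`. -/
def middle {K : Type*} [Field K] [Algebra ℂ K] (lam : ℂ) (u : K) : K :=
  u + u⁻¹ + algebraMap ℂ K (4 * lam ^ 2)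

theorem map_middle {A K : Type*} [Field A] [Field K] [Algebra ℂ A] [Algebra ℂ K] (f : A →ₐ[ℂ] K)
    (lam : ℂ) (u : A) : f (middle lam u) = middle lam (f u) := by
  simp only [middle, map_add, map_inv₀, AlgHom.commutes]

theorem middle_inv {K : Type*} [Field K] [Algebra ℂ K] (lam : ℂ) (u : K) :
    middle lam u⁻¹ = middle lam u := by
  rw [middle, middle, inv_inv, add_comm u⁻¹]

theorem middle_mem {K : Type*} [Field K] [Algebra ℂ K] (lam : ℂ) {u : K}
    {L : IntermediateField ℂ K} (hu : u ∈ L) : middle lam u ∈ L :=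
  add_mem (add_mem hu (inv_mem hu)) (L.algebraMap_mem _)

theorem _root_.Transcendental.ne_zero_of_complex {K : Type*} [Field K] [Algebra ℂ K] {u : K}
    (hu : Transcendental ℂ u) : u ≠ 0 := by
  rintro rfl
  exact hu isAlgebraic_zero

/-- The values c = ±2 are where c/2 meets one of the branch points t = ±1. The polynomial u²(c² - 4)
has value 1 at u = 0, so it is nonzero and cannot vanish at a transcendental u. -/
theorem middle_sq_ne_four {K : Type*} [Field K] [Algebra ℂ K] (lam : ℂ) {u : K}
    (hu : Transcendental ℂ u) : middle lam u ^ 2 ≠ 4 := by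
  intro h
  have h0 := hu.ne_zero_of_complex
  refine hu ⟨(X ^ 2 + 1 + C (4 * lam ^ 2) * X) ^ 2 - C 4 * X ^ 2, fun hp => ?_, ?_⟩
  · have := congrArg (eval 0) hp
    simp at this
  · simp only [middle, map_sub, map_mul, map_pow, map_add, aeval_X, aeval_C, map_one, map_ofNat]
      at h ⊢
    field_simp at h
    linear_combination h

/-- Relations between the parameters `lam`, `t₁`, `t₂`, with `m` a square root of `l`. -/
structure IsParam (lam m t₁ t₂ : ℂ) : Prop where
  ne_zero : m ≠ 0
  sub_mul_sub : (t₁ - 1) * (t₂ - 1) = -4 * m ^ 2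
  add_mul_add : (t₁ + 1) * (t₂ + 1) = 8 * m ^ 2 * lam ^ 2
  mul : t₁ * t₂ = m ^ 4

section EllipticSurface

variable {lam m t₁ t₂ : ℂ}

/-- The function `ξ = X / (4 m² u²)` on the elliptic surface. -/
def xiFun (m t₁ t₂ : ℂ) : EllipticSurfaceField t₁ t₂ :=
  xFun (ellipticSurface t₁ t₂) / (algebraMap ℂ _ (4 * m ^ 2) * uFun t₁ t₂ ^ 2)

/-- The function `η = Y / (2 m u X)` on the elliptic surface. -/
def etaFun (m t₁ t₂ : ℂ) : EllipticSurfaceField t₁ t₂ :=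
  yFun (ellipticSurface t₁ t₂) /
    (algebraMap ℂ _ (2 * m) * uFun t₁ t₂ * xFun (ellipticSurface t₁ t₂))

theorem ellipticSurface_transcendental : Transcendental ℂ (uFun t₁ t₂) ∧
    Transcendental ℂ (xFun (ellipticSurface t₁ t₂)) :=
  transcendental_of_relAlgClosure (trdeg_functionField_polynomial _)
    (relAlgClosure_functionField_polynomial _ rfl rfl)

theorem uFun_ne_zero : uFun t₁ t₂ ≠ 0 := ellipticSurface_transcendental.1.ne_zero_of_complex

theorem xFun_ellipticSurface_ne_zero : xFun (ellipticSurface t₁ t₂) ≠ 0 :=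
  ellipticSurface_transcendental.2.ne_zero_of_complex

theorem xFun_eq_xiFun (hm : m ≠ 0) : xFun (ellipticSurface t₁ t₂) =
    algebraMap ℂ _ (4 * m ^ 2) * uFun t₁ t₂ ^ 2 * xiFun m t₁ t₂ := by
  have h1 : algebraMap ℂ (EllipticSurfaceField t₁ t₂) (4 * m ^ 2) ≠ 0 := by
    rw [Ne, FaithfulSMul.algebraMap_eq_zero_iff]
    simp [hm]
  have h2 := uFun_ne_zero (t₁ := t₁) (t₂ := t₂)
  rw [xiFun]
  field_simp

theorem yFun_eq_etaFun (hm : m ≠ 0) : yFun (ellipticSurface t₁ t₂) =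
    algebraMap ℂ _ (8 * m ^ 3) * uFun t₁ t₂ ^ 3 * xiFun m t₁ t₂ * etaFun m t₁ t₂ := by
  have h1 : algebraMap ℂ (EllipticSurfaceField t₁ t₂) m ≠ 0 := by
    rwa [Ne, FaithfulSMul.algebraMap_eq_zero_iff]
  have := charZero_of_complex (EllipticSurfaceField t₁ t₂)
  have h2 := uFun_ne_zero (t₁ := t₁) (t₂ := t₂)
  have h3 := xFun_ellipticSurface_ne_zero (t₁ := t₁) (t₂ := t₂)
  rw [xiFun, etaFun]
  simp only [map_mul, map_pow, map_ofNat]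
  field_simp
  ring

theorem xiFun_ne_zero (hm : m ≠ 0) : xiFun m t₁ t₂ ≠ 0 := by
  intro h
  have := xFun_eq_xiFun (t₁ := t₁) (t₂ := t₂) hm
  rw [h, mul_zero] at this
  exact xFun_ellipticSurface_ne_zero this

/-- Divide the Weierstrass equation by 4m²u²X². The parameter relations turn the coefficient of X²
into -4m²u²c and that of X into 16m⁴u⁴, so l drops out. -/
theorem etaFun_sq (h : IsParam lam m t₁ t₂) : etaFun m t₁ t₂ ^ 2 =
    xiFun m t₁ t₂ + (xiFun m t₁ t₂)⁻¹ - middle lam (uFun t₁ t₂) := by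
  have h1 : algebraMap ℂ (EllipticSurfaceField t₁ t₂) m ≠ 0 := by
    rw [Ne, FaithfulSMul.algebraMap_eq_zero_iff]
    exact h.ne_zero
  have := charZero_of_complex (EllipticSurfaceField t₁ t₂)
  have h2 := uFun_ne_zero (t₁ := t₁) (t₂ := t₂)
  have h3 := xiFun_ne_zero (t₁ := t₁) (t₂ := t₂) h.ne_zero
  have e := functionField_equation_polynomial (ellipticSurface t₁ t₂)
    (p₂ := C ((t₁ - 1) * (t₂ - 1)) * (X ^ 3 + X) - C (2 * ((t₁ + 1) * (t₂ + 1))) * X ^ 2)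
    (p₄ := C (16 * (t₁ * t₂)) * X ^ 4) (p₆ := 0) rfl rfl rfl rfl rfl
  rw [show baseFun (ellipticSurface t₁ t₂) X = uFun t₁ t₂ from rfl, xFun_eq_xiFun h.ne_zero,
    yFun_eq_etaFun h.ne_zero, h.sub_mul_sub, h.add_mul_add, h.mul] at e
  simp only [middle]
  simp only [map_sub, map_mul, map_add, map_pow, aeval_X, aeval_C, map_zero, add_zero,
    map_ofNat, map_neg] at e ⊢
  generalize xiFun m t₁ t₂ = ξ at *
  generalize etaFun m t₁ t₂ = η at *
  generalize uFun t₁ t₂ = u at *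
  generalize algebraMap ℂ (EllipticSurfaceField t₁ t₂) m = M at *
  generalize algebraMap ℂ (EllipticSurfaceField t₁ t₂) lam = Λ at *
  field_simp
  -- This is the monomial factor between the cleared goal and the Weierstrass equation, where Y² =
  -- 64m⁶u⁶ξ²η².
  have h6 : (64 * M ^ 6 * u ^ 5 * ξ : EllipticSurfaceField t₁ t₂) ≠ 0 := by
    simp [h1, h2, h3]
  apply mul_left_cancel₀ h6
  linear_combination e

theorem adjoin_ellipticSurface (hm : m ≠ 0) :
    IntermediateField.adjoin ℂ {uFun t₁ t₂, xiFun m t₁ t₂, etaFun m t₁ t₂} = ⊤ := by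
  set M := IntermediateField.adjoin ℂ {uFun t₁ t₂, xiFun m t₁ t₂, etaFun m t₁ t₂}
  have hu : uFun t₁ t₂ ∈ M := IntermediateField.subset_adjoin _ _ (Or.inl rfl)
  have hξ : xiFun m t₁ t₂ ∈ M := IntermediateField.subset_adjoin _ _ (Or.inr (Or.inl rfl))
  have hη : etaFun m t₁ t₂ ∈ M := IntermediateField.subset_adjoin _ _ (Or.inr (Or.inr rfl))
  rw [← top_le_iff, ← adjoin_functionField_polynomial (ellipticSurface t₁ t₂),
    IntermediateField.adjoin_le_iff]
  rintro z (rfl | rfl | rfl)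
  · exact hu
  · rw [xFun_eq_xiFun hm]
    exact mul_mem (mul_mem (M.algebraMap_mem _) (pow_mem hu 2)) hξ
  · rw [yFun_eq_etaFun hm]
    exact mul_mem (mul_mem (mul_mem (M.algebraMap_mem _) (pow_mem hu 3)) hξ) hη

theorem relAlgClosure_ellipticSurface (hm : m ≠ 0) :
    relAlgClosure {uFun t₁ t₂, xiFun m t₁ t₂} = ⊤ := by
  refine relAlgClosure_eq_top_of_subset
    (relAlgClosure_functionField_polynomial (ellipticSurface t₁ t₂) rfl rfl) ?_
  have hu := subset_relAlgClosure {uFun t₁ t₂, xiFun m t₁ t₂} (Or.inl rfl)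
  have hξ := subset_relAlgClosure {uFun t₁ t₂, xiFun m t₁ t₂} (Or.inr rfl)
  rintro z (rfl | rfl)
  · exact hu
  · rw [xFun_eq_xiFun hm]
    exact mul_mem (mul_mem (IntermediateField.algebraMap_mem _ _) (pow_mem hu 2)) hξ

/-- This is the mapping property of ℂ(u, ξ, η): the embedding is found by rebuilding X and Y from a
solution (u, ξ, η). -/
theorem exists_ellipticSurface_hom (h : IsParam lam m t₁ t₂) {K : Type} [Field K] [Algebra ℂ K]
    (hK : Algebra.trdeg ℂ K = 2) {u ξ η : K} (hS : relAlgClosure {u, ξ} = ⊤)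
    (hη : η ^ 2 = ξ + ξ⁻¹ - middle lam u) :
    ∃ F : EllipticSurfaceField t₁ t₂ →ₐ[ℂ] K,
      F (uFun t₁ t₂) = u ∧ F (xiFun m t₁ t₂) = ξ ∧ F (etaFun m t₁ t₂) = η := by
  obtain ⟨htu, htξ⟩ := transcendental_of_relAlgClosure hK hS
  have hu := htu.ne_zero_of_complex
  have hξ := htξ.ne_zero_of_complex
  have hm : algebraMap ℂ K m ≠ 0 := by
    rw [Ne, FaithfulSMul.algebraMap_eq_zero_iff]
    exact h.ne_zero
  have := charZero_of_complex K
  set x : K := algebraMap ℂ K (4 * m ^ 2) * u ^ 2 * ξ with hx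
  set y : K := algebraMap ℂ K (8 * m ^ 3) * u ^ 3 * ξ * η with hy
  obtain ⟨F, hb, hFx, hFy⟩ := exists_functionField_hom (ellipticSurface t₁ t₂) (aeval u)
    (x := x) (y := y) (by
      simp only [ellipticSurface, h.sub_mul_sub, h.add_mul_add, h.mul, map_sub, map_mul, map_add,
        map_pow, aeval_X, aeval_C, map_zero, zero_mul, add_zero, hx, hy, middle, map_neg,
        map_ofNat, mul_pow] at hη ⊢
      rw [hη]
      field_simp
      ring)
    (by rw [hK, Polynomial.trdeg_of_isDomain, one_add_one_eq_two])
    (by rw [hK]; exact Cardinal.ofNat_lt_aleph0) (S := {u, x})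
    (relAlgClosure_eq_top_of_subset hS (by
      have h1 := subset_relAlgClosure {u, x} (Or.inl rfl)
      have h2 := subset_relAlgClosure {u, x} (Or.inr rfl)
      rintro z (rfl | rfl)
      · exact h1
      · have hz : z = x / (algebraMap ℂ K (4 * m ^ 2) * u ^ 2) := by
          rw [hx]
          simp only [map_mul, map_pow, map_ofNat]
          field_simp
        rw [hz]
        exact div_mem h2 (mul_mem (IntermediateField.algebraMap_mem _ _) (pow_mem h1 2))))
    (by
      rintro z (rfl | rfl)
      · exact Or.inl ⟨X, aeval_X _⟩
      · exact Or.inr (Or.inl rfl))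
  have hFu : F (uFun t₁ t₂) = u := (hb X).trans (aeval_X _)
  refine ⟨F, hFu, ?_, ?_⟩
  · rw [xiFun, map_div₀, map_mul, map_pow, AlgHom.commutes, hFu, hFx, hx]
    simp only [map_mul, map_pow, map_ofNat]
    field_simp
  · rw [etaFun, map_div₀, map_mul, map_mul, AlgHom.commutes, hFu, hFx, hFy, hx, hy]
    simp only [map_mul, map_pow, map_ofNat]
    field_simp
    ring

end EllipticSurface

/-! ### The model field, as a cubic and as a quartic. -/

section ModelSurface

variable {lam : ℂ}

/-- The elliptic surface `Y² = X³ - u² c X² - 4 u⁴ X + 4 u⁶ c` with `c = u + u⁻¹ + 4 lam²`, which is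
birational to the surface `η² = a² + a⁻² - c`. -/
def modelSurface (lam : ℂ) : WeierstrassCurve ℂ[X] where
  a₁ := 0
  a₂ := -(X ^ 3 + X + C (4 * lam ^ 2) * X ^ 2)
  a₃ := 0
  a₄ := -(4 * X ^ 4)
  a₆ := 4 * (X ^ 7 + X ^ 5 + C (4 * lam ^ 2) * X ^ 6)

/-- The function field `ℂ(u, a, η)` of the surface `η² = a² + a⁻² - (u + u⁻¹ + 4 lam²)`. -/
abbrev ModelField (lam : ℂ) : Type := (modelSurface lam).toAffine.FunctionField

/-- The function `u` on the model surface. -/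
def modelU (lam : ℂ) : ModelField lam := baseFun (modelSurface lam) X

/-- The function `t = X / (2 u²)` on the model surface. -/
def modelT (lam : ℂ) : ModelField lam := xFun (modelSurface lam) / (2 * modelU lam ^ 2)

/-- The function `s = Y / (2 u³)` on the model surface. -/
def modelS (lam : ℂ) : ModelField lam := yFun (modelSurface lam) / (2 * modelU lam ^ 3)

/-- The function `a` on the model surface. -/
def modelA (lam : ℂ) : ModelField lam := modelS lam / (2 * modelT lam - middle lam (modelU lam))

/-- The function `η` on the model surface. -/
def modelEta (lam : ℂ) : ModelField lam := modelT lam / modelA lam - modelA lam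

theorem relAlgClosure_modelU_modelT : relAlgClosure {modelU lam, modelT lam} = ⊤ := by
  refine relAlgClosure_eq_top_of_subset
    (relAlgClosure_functionField_polynomial (modelSurface lam) rfl rfl) ?_
  have hu := subset_relAlgClosure {modelU lam, modelT lam} (Or.inl rfl)
  have ht := subset_relAlgClosure {modelU lam, modelT lam} (Or.inr rfl)
  have hu0 : modelU lam ≠ 0 := (transcendental_of_relAlgClosure (trdeg_functionField_polynomial _)
    (relAlgClosure_functionField_polynomial (modelSurface lam) rfl rfl)).1.ne_zero_of_complex
  have := charZero_of_complex (ModelField lam)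
  rintro z (rfl | rfl)
  · exact hu
  · have h : xFun (modelSurface lam) = 2 * modelU lam ^ 2 * modelT lam := by
      rw [modelT]
      field_simp
    rw [h]
    exact mul_mem (mul_mem (ofNat_mem _ 2) (pow_mem hu 2)) ht

theorem modelT_transcendental : Transcendental ℂ (modelT lam) :=
  (transcendental_of_relAlgClosure (trdeg_functionField_polynomial _)
    relAlgClosure_modelU_modelT).2

theorem modelU_transcendental : Transcendental ℂ (modelU lam) :=
  (transcendental_of_relAlgClosure (trdeg_functionField_polynomial _)
    relAlgClosure_modelU_modelT).1

theorem modelU_ne_zero : modelU lam ≠ 0 := modelU_transcendental.ne_zero_of_complex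

/-- The scaling X = 2u²t, Y = 2u³s removes the powers of u and shows full two-torsion, at t = 1, -1
and c/2. -/
theorem modelS_sq : modelS lam ^ 2 =
    (modelT lam ^ 2 - 1) * (2 * modelT lam - middle lam (modelU lam)) := by
  have e := functionField_equation_polynomial (modelSurface lam)
    (p₂ := -(X ^ 3 + X + C (4 * lam ^ 2) * X ^ 2)) (p₄ := -(4 * X ^ 4))
    (p₆ := 4 * (X ^ 7 + X ^ 5 + C (4 * lam ^ 2) * X ^ 6)) rfl rfl rfl rfl rfl
  have hu := modelU_ne_zero (lam := lam)
  have := charZero_of_complex (ModelField lam)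
  have hx : xFun (modelSurface lam) = 2 * modelU lam ^ 2 * modelT lam := by
    rw [modelT]
    field_simp
  have hy : yFun (modelSurface lam) = 2 * modelU lam ^ 3 * modelS lam := by
    rw [modelS]
    field_simp
  rw [hx, hy, show baseFun (modelSurface lam) X = modelU lam from rfl] at e
  simp only [map_neg, map_mul, map_add, map_pow, aeval_X, aeval_C, map_ofNat, middle] at e ⊢
  generalize modelU lam = u at *
  field_simp
  have h6 : (4 * u ^ 5 : ModelField lam) ≠ 0 := by simp [hu]
  apply mul_left_cancel₀ h6
  linear_combination e

theorem modelT_sq_ne_one : modelT lam ^ 2 - 1 ≠ 0 := by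
  intro h
  refine modelT_transcendental (lam := lam) ⟨X ^ 2 - 1, fun hp => ?_, by simpa using h⟩
  simpa using congrArg (eval 0) hp

theorem two_modelT_ne : 2 * modelT lam - middle lam (modelU lam) ≠ 0 := by
  intro h
  have h1 := modelS_sq (lam := lam)
  have := charZero_of_complex (ModelField lam)
  rw [h, mul_zero, sq_eq_zero_iff, modelS, div_eq_zero_iff, yFun,
    FaithfulSMul.algebraMap_eq_zero_iff] at h1
  rcases h1 with h1 | h1
  · refine WeierstrassCurve.Affine.CoordinateRing.YClass_ne_zero
      (W' := (modelSurface lam).toAffine) 0 ?_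
    simpa [WeierstrassCurve.Affine.CoordinateRing.YClass] using h1
  · simp [modelU_ne_zero] at h1

/-- This is the passage from the cubic to the quartic (aη)² = a⁴ - ca² + 1: setting t = a² + aη
cancels a⁴ and leaves a²(2t - c) = t² - 1. -/
theorem modelA_sq : modelA lam ^ 2 * (2 * modelT lam - middle lam (modelU lam)) =
    modelT lam ^ 2 - 1 := by
  have h := two_modelT_ne (lam := lam)
  rw [modelA, div_pow, modelS_sq]
  generalize 2 * modelT lam - middle lam (modelU lam) = D at *
  field_simp

theorem modelA_ne_zero : modelA lam ≠ 0 := by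
  intro h
  have := modelA_sq (lam := lam)
  rw [h] at this
  exact modelT_sq_ne_one (by linear_combination -this)

theorem modelEta_sq : modelEta lam ^ 2 =
    modelA lam ^ 2 + (modelA lam ^ 2)⁻¹ - middle lam (modelU lam) := by
  have h := modelA_ne_zero (lam := lam)
  have := modelA_sq (lam := lam)
  rw [modelEta]
  field_simp
  linear_combination -this

theorem modelT_eq : modelT lam = modelA lam * (modelA lam + modelEta lam) := by
  have h := modelA_ne_zero (lam := lam)
  rw [modelEta]
  field_simp
  ring

theorem modelS_eq : modelS lam =
    modelA lam * (2 * modelT lam - middle lam (modelU lam)) := by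
  have h := two_modelT_ne (lam := lam)
  rw [modelA]
  field_simp

theorem adjoin_model : IntermediateField.adjoin ℂ {modelU lam, modelA lam, modelEta lam} = ⊤ := by
  set M := IntermediateField.adjoin ℂ {modelU lam, modelA lam, modelEta lam}
  have hu : modelU lam ∈ M := IntermediateField.subset_adjoin _ _ (Or.inl rfl)
  have ha : modelA lam ∈ M := IntermediateField.subset_adjoin _ _ (Or.inr (Or.inl rfl))
  have hη : modelEta lam ∈ M := IntermediateField.subset_adjoin _ _ (Or.inr (Or.inr rfl))
  have ht : modelT lam ∈ M := by
    rw [modelT_eq]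
    exact mul_mem ha (add_mem ha hη)
  have hs : modelS lam ∈ M := by
    rw [modelS_eq]
    exact mul_mem ha (sub_mem (mul_mem (ofNat_mem _ 2) ht) (middle_mem lam hu))
  have hu0 := modelU_ne_zero (lam := lam)
  have := charZero_of_complex (ModelField lam)
  rw [← top_le_iff, ← adjoin_functionField_polynomial (modelSurface lam),
    IntermediateField.adjoin_le_iff]
  rintro z (rfl | rfl | rfl)
  · exact hu
  · have h : xFun (modelSurface lam) = 2 * modelU lam ^ 2 * modelT lam := by
      rw [modelT]
      field_simp
    rw [h]
    exact mul_mem (mul_mem (ofNat_mem _ 2) (pow_mem hu 2)) ht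
  · have h : yFun (modelSurface lam) = 2 * modelU lam ^ 3 * modelS lam := by
      rw [modelS]
      field_simp
    rw [h]
    exact mul_mem (mul_mem (ofNat_mem _ 2) (pow_mem hu 3)) hs

/-- The function `η` is algebraic over `ℂ(u, a)`. -/
theorem eta_mem_relAlgClosure {K : Type} [Field K] [Algebra ℂ K] {S : Set K} {u a η : K}
    (hη : η ^ 2 = a ^ 2 + (a ^ 2)⁻¹ - middle lam u) (hu : u ∈ relAlgClosure S)
    (ha : a ∈ relAlgClosure S) : η ∈ relAlgClosure S := by
  refine mem_relAlgClosure_of_pow 2 two_pos ?_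
  rw [hη]
  exact sub_mem (add_mem (pow_mem ha 2) (inv_mem (pow_mem ha 2))) (middle_mem lam hu)

theorem relAlgClosure_model : relAlgClosure {modelU lam, modelA lam} = ⊤ := by
  refine relAlgClosure_eq_top adjoin_model ?_
  have hu := subset_relAlgClosure {modelU lam, modelA lam} (Or.inl rfl)
  have ha := subset_relAlgClosure {modelU lam, modelA lam} (Or.inr rfl)
  rintro z (rfl | rfl | rfl)
  · exact hu
  · exact ha
  · exact eta_mem_relAlgClosure modelEta_sq hu ha

/-- This is the mapping property of ℂ(u, a, η). The point on the cubic is forced to be t = a(a + η),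
s = a(2t - c). -/
theorem exists_model_hom {K : Type} [Field K] [Algebra ℂ K] (hK : Algebra.trdeg ℂ K = 2)
    {u a η : K} (hS : relAlgClosure {u, a} = ⊤)
    (hη : η ^ 2 = a ^ 2 + (a ^ 2)⁻¹ - middle lam u) :
    ∃ F : ModelField lam →ₐ[ℂ] K,
      F (modelU lam) = u ∧ F (modelA lam) = a ∧ F (modelEta lam) = η := by
  obtain ⟨htu, hta⟩ := transcendental_of_relAlgClosure hK hS
  have hu := htu.ne_zero_of_complex
  have ha := hta.ne_zero_of_complex
  have := charZero_of_complex K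
  set t : K := a * (a + η) with ht
  set c : K := middle lam u with hc
  have h1 : a ^ 2 * (2 * t - c) = t ^ 2 - 1 := by
    rw [ht]
    field_simp at hη
    linear_combination -hη
  -- If 2t = c, then `h1` gives t² = 1 and hence c² = 4, impossible for transcendental u.
  have h2 : 2 * t - c ≠ 0 := by
    intro h
    rw [h, mul_zero] at h1
    apply middle_sq_ne_four lam htu
    rw [← hc]
    linear_combination (-2 * t - c) * h - 4 * h1
  set x : K := 2 * u ^ 2 * t with hx
  set y : K := 2 * u ^ 3 * (a * (2 * t - c)) with hy
  have hxt : t = x / (2 * u ^ 2) := by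
    rw [hx]
    field_simp
  obtain ⟨F, hb, hFx, hFy⟩ := exists_functionField_hom (modelSurface lam) (aeval u)
    (x := x) (y := y) (by
      have h3 : (a * (2 * t - c)) ^ 2 = (t ^ 2 - 1) * (2 * t - c) := by
        linear_combination (2 * t - c) * h1
      simp only [modelSurface, map_mul, map_add, map_neg,
        map_pow, aeval_X, aeval_C, map_zero, zero_mul, add_zero, hx, hy, map_ofNat]
      rw [mul_pow, h3, hc, middle]
      simp only [map_mul, map_pow, map_ofNat]
      field_simp
      ring)
    (by rw [hK, Polynomial.trdeg_of_isDomain, one_add_one_eq_two])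
    (by rw [hK]; exact Cardinal.ofNat_lt_aleph0) (S := {u, x})
    (relAlgClosure_eq_top_of_subset hS (by
      have h1' := subset_relAlgClosure {u, x} (Or.inl rfl)
      have h2' := subset_relAlgClosure {u, x} (Or.inr rfl)
      have ht' : t ∈ relAlgClosure {u, x} := by
        rw [hxt]
        exact div_mem h2' (mul_mem (ofNat_mem _ 2) (pow_mem h1' 2))
      rintro z (rfl | rfl)
      · exact h1'
      · refine mem_relAlgClosure_of_pow 2 two_pos ?_
        rw [eq_div_of_mul_eq h2 h1]
        exact div_mem (sub_mem (pow_mem ht' 2) (one_mem _))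
          (sub_mem (mul_mem (ofNat_mem _ 2) ht') (middle_mem lam h1'))))
    (by
      rintro z (rfl | rfl)
      · exact Or.inl ⟨X, aeval_X _⟩
      · exact Or.inr (Or.inl rfl))
  have hFu : F (modelU lam) = u := (hb X).trans (aeval_X _)
  have hFt : F (modelT lam) = t := by
    rw [modelT, map_div₀, map_mul, map_pow, map_ofNat, hFu, hFx, hxt]
  have hFa : F (modelA lam) = a := by
    rw [modelA, modelS, map_div₀, map_div₀, map_sub, map_mul, map_mul, map_pow, map_ofNat, hFu, hFy,
      hFt, map_middle, hFu, ← hc, hy]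
    field_simp
  refine ⟨F, hFu, hFa, ?_⟩
  rw [modelEta, map_sub, map_div₀, hFt, hFa, ht]
  field_simp
  ring

end ModelSurface

/-! ### Function fields of affine surfaces -/

section Surface

variable (p : MvPolynomial (Fin 3) ℂ)

/-- A polynomial monic in the first variable makes the surface ring finite over a polynomial ring in
the other two variables. -/
theorem trdeg_surfaceRing [(Ideal.span {p}).IsPrime]
    (hm : (MvPolynomial.finSuccEquiv ℂ 2 p).Monic)
    (hd : (MvPolynomial.finSuccEquiv ℂ 2 p).degree ≠ 0) :
    Algebra.trdeg ℂ (SurfaceRing p) = 2 := by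
  set q := MvPolynomial.finSuccEquiv ℂ 2 p with hq
  let e : SurfaceRing p ≃ₐ[ℂ] AdjoinRoot q :=
    Ideal.quotientEquivAlg (Ideal.span {p}) (Ideal.span {q}) (MvPolynomial.finSuccEquiv ℂ 2) (by
      rw [Ideal.map_span, Set.image_singleton]
      rfl)
  have : IsDomain (AdjoinRoot q) := e.symm.toMulEquiv.isDomain
  have : Module.Finite (MvPolynomial (Fin 2) ℂ) (AdjoinRoot q) :=
    (AdjoinRoot.powerBasis' hm).finite
  have : FaithfulSMul (MvPolynomial (Fin 2) ℂ) (AdjoinRoot q) :=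
    (faithfulSMul_iff_algebraMap_injective _ _).2
      (AdjoinRoot.of.injective_of_degree_ne_zero hd)
  have h := trdeg_add_eq ℂ (MvPolynomial (Fin 2) ℂ) (A := AdjoinRoot q)
  rw [trdeg_eq_zero (R := MvPolynomial (Fin 2) ℂ), add_zero, MvPolynomial.trdeg_of_isDomain] at h
  rw [e.trdeg_eq, ← h]
  simp

theorem algebraMap_mk_eq_aeval [(Ideal.span {p}).IsPrime] (g : MvPolynomial (Fin 3) ℂ) :
    algebraMap (SurfaceRing p) (SurfaceField p) (Ideal.Quotient.mk _ g) =
      MvPolynomial.aeval (coord p) g := by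
  have h : (IsScalarTower.toAlgHom ℂ (SurfaceRing p) (SurfaceField p)).comp
      (Ideal.Quotient.mkₐ ℂ (Ideal.span {p})) = MvPolynomial.aeval (coord p) := by
    ext i
    simp [coord]
  exact DFunLike.congr_fun h g

theorem aeval_coord_self [(Ideal.span {p}).IsPrime] : MvPolynomial.aeval (coord p) p = 0 := by
  rw [← algebraMap_mk_eq_aeval, Ideal.Quotient.eq_zero_iff_mem.2 (Ideal.mem_span_singleton_self p),
    map_zero]

-- Multiples of `p` vanish at every zero of `p`, so a single point of the surface certifies that a
-- function is nonzero.
variable {p} in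
theorem aeval_coord_ne_zero [(Ideal.span {p}).IsPrime] {g : MvPolynomial (Fin 3) ℂ}
    (P : Fin 3 → ℂ) (h0 : MvPolynomial.eval P p = 0) (hg : MvPolynomial.eval P g ≠ 0) :
    MvPolynomial.aeval (coord p) g ≠ 0 := by
  intro h
  rw [← algebraMap_mk_eq_aeval, FaithfulSMul.algebraMap_eq_zero_iff,
    Ideal.Quotient.eq_zero_iff_mem, Ideal.mem_span_singleton] at h
  obtain ⟨q, rfl⟩ := h
  rw [map_mul, h0, zero_mul] at hg
  exact hg rfl

theorem adjoin_coord [(Ideal.span {p}).IsPrime] :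
    IntermediateField.adjoin ℂ {coord p 0, coord p 1, coord p 2} = ⊤ := by
  have hr : ({coord p 0, coord p 1, coord p 2} : Set (SurfaceField p)) = Set.range (coord p) := by
    ext z
    simp [Fin.exists_fin_succ, eq_comm]
  rw [hr]
  refine top_le_iff.1 fun z _ => ?_
  have hc (a : SurfaceRing p) : algebraMap (SurfaceRing p) (SurfaceField p) a ∈
      IntermediateField.adjoin ℂ (Set.range (coord p)) := by
    obtain ⟨g, rfl⟩ := Ideal.Quotient.mk_surjective a
    rw [algebraMap_mk_eq_aeval]
    refine IntermediateField.algebra_adjoin_le_adjoin ℂ _ ?_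
    rw [Algebra.adjoin_range_eq_range_aeval]
    exact ⟨g, rfl⟩
  obtain ⟨a, b, _, rfl⟩ := IsFractionRing.div_surjective (A := SurfaceRing p) z
  exact div_mem (hc a) (hc b)

theorem exists_surfaceField_hom [(Ideal.span {p}).IsPrime] {K : Type} [Field K] [Algebra ℂ K]
    (hA : Algebra.trdeg ℂ (SurfaceRing p) = 2) (hK : Algebra.trdeg ℂ K = 2) (v : Fin 3 → K)
    (hv : MvPolynomial.aeval v p = 0) (hS : relAlgClosure (Set.range v) = ⊤) :
    ∃ F : SurfaceField p →ₐ[ℂ] K, ∀ i, F (coord p i) = v i := by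
  let g : SurfaceRing p →ₐ[ℂ] K := Ideal.Quotient.liftₐ (Ideal.span {p}) (MvPolynomial.aeval v) (by
    intro a ha
    obtain ⟨b, rfl⟩ := Ideal.mem_span_singleton.1 ha
    rw [map_mul, hv, zero_mul])
  have hgv (i : Fin 3) : g (Ideal.Quotient.mk _ (MvPolynomial.X i)) = v i :=
    (Ideal.Quotient.liftₐ_apply _ _ _ _).trans (MvPolynomial.aeval_X v i)
  have hg : Function.Injective g := by
    refine injective_of_trdeg_le g ?_ ?_ hS ?_
    · rw [hA]
      exact Cardinal.ofNat_lt_aleph0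
    · rw [hA, hK]
    · rintro _ ⟨i, rfl⟩
      exact ⟨_, hgv i⟩
  refine ⟨IsFractionRing.liftAlgHom hg, fun i => ?_⟩
  exact (IsFractionRing.lift_algebraMap hg _).trans (hgv i)

end Surface

theorem trdeg_dworkRing (lam : ℂ) : Algebra.trdeg ℂ (SurfaceRing (dworkPoly lam)) = 2 := by
  have e1 : (1 : Fin 3) = Fin.succ 0 := rfl
  have e2 : (2 : Fin 3) = Fin.succ 1 := rfl
  have hC (r : ℂ) : MvPolynomial.finSuccEquiv ℂ 2 (MvPolynomial.C r) =
      Polynomial.C (MvPolynomial.C r) := by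
    simp [MvPolynomial.finSuccEquiv_apply]
  have hp : MvPolynomial.finSuccEquiv ℂ 2 (dworkPoly lam) = X ^ 4 +
      (C (MvPolynomial.C (4 * lam) * (MvPolynomial.X 0 * MvPolynomial.X 1)) * X +
        C (1 + MvPolynomial.X 0 ^ 4 + MvPolynomial.X 1 ^ 4)) := by
    simp only [dworkPoly, map_add, map_one, map_mul, map_pow, e1, e2,
      MvPolynomial.finSuccEquiv_X_zero, MvPolynomial.finSuccEquiv_X_succ, hC]
    ring
  have hq (b c : MvPolynomial (Fin 2) ℂ) : (C b * X + C c).degree < ((4 : ℕ) : WithBot ℕ) :=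
    lt_of_le_of_lt Polynomial.degree_linear_le (by norm_num)
  refine trdeg_surfaceRing _ ?_ ?_
  · rw [hp]
    exact Polynomial.monic_X_pow_add (hq _ _)
  · rw [hp, Polynomial.degree_add_eq_left_of_degree_lt (by rw [degree_X_pow]; exact hq _ _),
      degree_X_pow]
    norm_num

theorem trdeg_pencilRing (lam : ℂ) (l : ℂˣ) :
    Algebra.trdeg ℂ (SurfaceRing (pencilPoly lam l)) = 2 := by
  have e1 : (1 : Fin 3) = Fin.succ 0 := rfl
  have e2 : (2 : Fin 3) = Fin.succ 1 := rfl
  have hC (r : ℂ) : MvPolynomial.finSuccEquiv ℂ 2 (MvPolynomial.C r) =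
      Polynomial.C (MvPolynomial.C r) := by
    simp [MvPolynomial.finSuccEquiv_apply]
  obtain ⟨h, hp⟩ : ∃ h, MvPolynomial.finSuccEquiv ℂ 2 (pencilPoly lam l) = X ^ 2 - C h := by
    refine ⟨MvPolynomial.C (16 * (l : ℂ)) * (MvPolynomial.X 0 * (MvPolynomial.X 0 - 1) *
      (MvPolynomial.X 0 - MvPolynomial.X 1) * (MvPolynomial.X 1 - MvPolynomial.C (lam ^ 2)) *
      (MvPolynomial.X 1 - 1 - MvPolynomial.C (lam ^ 2))), ?_⟩
    simp only [pencilPoly, map_sub, map_one, map_mul, map_pow, e1, e2,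
      MvPolynomial.finSuccEquiv_X_zero, MvPolynomial.finSuccEquiv_X_succ, hC]
  refine trdeg_surfaceRing _ ?_ ?_
  · rw [hp]
    exact Polynomial.monic_X_pow_sub_C _ (by norm_num)
  · rw [hp, Polynomial.degree_X_pow_sub_C (by norm_num)]
    norm_num

/-! ### Maps between the models -/

section ModelMaps

variable {lam : ℂ}

theorem yFun_ne_zero {R : Type} [CommRing R] [IsDomain R] (W : WeierstrassCurve R) :
    yFun W ≠ 0 := by
  intro h
  rw [yFun, FaithfulSMul.algebraMap_eq_zero_iff] at h
  refine WeierstrassCurve.Affine.CoordinateRing.YClass_ne_zero (W' := W.toAffine) 0 ?_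
  simpa [WeierstrassCurve.Affine.CoordinateRing.YClass] using h

theorem trdeg_modelField : Algebra.trdeg ℂ (ModelField lam) = 2 :=
  trdeg_functionField_polynomial _

theorem modelA_transcendental : Transcendental ℂ (modelA lam) :=
  (transcendental_of_relAlgClosure trdeg_modelField relAlgClosure_model).2

/-- An endomorphism of the model field that squares to the identity on generators is an
involution. -/
theorem exists_model_involution {u a η : ModelField lam} (hS : relAlgClosure {u, a} = ⊤)
    (hη : η ^ 2 = a ^ 2 + (a ^ 2)⁻¹ - middle lam u)
    (h : ∀ F : ModelField lam →ₐ[ℂ] ModelField lam, F (modelU lam) = u → F (modelA lam) = a →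
      F (modelEta lam) = η → F u = modelU lam ∧ F a = modelA lam ∧ F η = modelEta lam) :
    ∃ σ : ModelField lam ≃ₐ[ℂ] ModelField lam, σ (modelU lam) = u ∧ σ (modelA lam) = a ∧
      σ (modelEta lam) = η := by
  obtain ⟨F, h1, h2, h3⟩ := exists_model_hom trdeg_modelField hS hη
  obtain ⟨h4, h5, h6⟩ := h F h1 h2 h3
  have hF : F.comp F = AlgHom.id ℂ _ := by
    refine algHom_ext_of_adjoin adjoin_model ?_
    rintro z (rfl | rfl | rfl) <;>
      simp only [AlgHom.comp_apply, AlgHom.id_apply, h1, h2, h3, h4, h5, h6]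
  exact ⟨AlgEquiv.ofAlgHom F F hF hF, h1, h2, h3⟩

/-- This is the deck transformation of the double cover ξ = a². -/
theorem exists_modelI : ∃ σ : ModelField lam ≃ₐ[ℂ] ModelField lam, σ (modelU lam) = modelU lam ∧
    σ (modelA lam) = -modelA lam ∧ σ (modelEta lam) = modelEta lam := by
  refine exists_model_involution (relAlgClosure_eq_top_of_subset relAlgClosure_model ?_) ?_ ?_
  · have hu := subset_relAlgClosure {modelU lam, -modelA lam} (Or.inl rfl)
    have ha := subset_relAlgClosure {modelU lam, -modelA lam} (Or.inr rfl)
    rintro z (rfl | rfl)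
    · exact hu
    · simpa using neg_mem ha
  · rw [modelEta_sq, neg_sq]
  · intro F h1 h2 h3
    simp [h1, h2, h3]

/-- This lifts (ξ, η) ↦ (ξ⁻¹, -η), the involution of the elliptic surface whose quotient is φ. -/
theorem exists_modelJ : ∃ σ : ModelField lam ≃ₐ[ℂ] ModelField lam, σ (modelU lam) = modelU lam ∧
    σ (modelA lam) = (modelA lam)⁻¹ ∧ σ (modelEta lam) = -modelEta lam := by
  refine exists_model_involution (relAlgClosure_eq_top_of_subset relAlgClosure_model ?_) ?_ ?_
  · have hu := subset_relAlgClosure {modelU lam, (modelA lam)⁻¹} (Or.inl rfl)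
    have ha := subset_relAlgClosure {modelU lam, (modelA lam)⁻¹} (Or.inr rfl)
    rintro z (rfl | rfl)
    · exact hu
    · simpa using inv_mem ha
  · rw [neg_sq, modelEta_sq, inv_pow, inv_inv]
    ring
  · intro F h1 h2 h3
    simp [h1, h2, h3]

/-- Here t = a(a + η) is fixed and s = a(2t - c) changes sign, while u is inverted; this is the deck
transformation of χ. -/
theorem exists_modelK : ∃ σ : ModelField lam ≃ₐ[ℂ] ModelField lam,
    σ (modelU lam) = (modelU lam)⁻¹ ∧ σ (modelA lam) = -modelA lam ∧
      σ (modelEta lam) = -modelEta lam := by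
  refine exists_model_involution (relAlgClosure_eq_top_of_subset relAlgClosure_model ?_) ?_ ?_
  · have hu := subset_relAlgClosure {(modelU lam)⁻¹, -modelA lam} (Or.inl rfl)
    have ha := subset_relAlgClosure {(modelU lam)⁻¹, -modelA lam} (Or.inr rfl)
    rintro z (rfl | rfl)
    · simpa using inv_mem hu
    · simpa using neg_mem ha
  · rw [neg_sq, modelEta_sq, middle_inv, neg_sq]
  · intro F h1 h2 h3
    simp [h1, h2, h3]

variable {m t₁ t₂ : ℂ}

theorem exists_modelPsi (h : IsParam lam m t₁ t₂) :
    ∃ ψ : EllipticSurfaceField t₁ t₂ →ₐ[ℂ] ModelField lam, ψ (uFun t₁ t₂) = modelU lam ∧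
      ψ (xiFun m t₁ t₂) = modelA lam ^ 2 ∧ ψ (etaFun m t₁ t₂) = modelEta lam := by
  refine exists_ellipticSurface_hom h trdeg_modelField
    (relAlgClosure_eq_top_of_subset relAlgClosure_model ?_) modelEta_sq
  have hu := subset_relAlgClosure {modelU lam, modelA lam ^ 2} (Or.inl rfl)
  have ha := subset_relAlgClosure {modelU lam, modelA lam ^ 2} (Or.inr rfl)
  rintro z (rfl | rfl)
  · exact hu
  · exact mem_relAlgClosure_of_pow 2 two_pos ha

theorem trdeg_ellipticSurface : Algebra.trdeg ℂ (EllipticSurfaceField t₁ t₂) = 2 :=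
  trdeg_functionField_polynomial _

theorem xiFun_transcendental (hm : m ≠ 0) : Transcendental ℂ (xiFun m t₁ t₂) :=
  (transcendental_of_relAlgClosure trdeg_ellipticSurface (relAlgClosure_ellipticSurface hm)).2

theorem etaFun_ne_zero (hm : m ≠ 0) : etaFun m t₁ t₂ ≠ 0 := by
  intro h
  have := yFun_eq_etaFun (t₁ := t₁) (t₂ := t₂) hm
  rw [h, mul_zero] at this
  exact yFun_ne_zero _ this

theorem _root_.Transcendental.sub_inv_ne_zero {K : Type*} [Field K] [Algebra ℂ K] {z : K}
    (hz : Transcendental ℂ z) : z - z⁻¹ ≠ 0 := by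
  intro h
  have h0 := hz.ne_zero_of_complex
  refine hz ⟨X ^ 2 - 1, fun hp => ?_, ?_⟩
  · simpa using congrArg (eval 0) hp
  · field_simp at h
    simpa using h

/-- The functions T = (ξ + ξ⁻¹)/2 and S = η(ξ - ξ⁻¹)/2 are invariant under (ξ, η) ↦ (ξ⁻¹, -η), and
2T - c = η², T² - 1 = (ξ - ξ⁻¹)²/4. Hence S² = (T² - 1)(2T - c), which is the equation of the model
field itself. -/
theorem exists_modelPhi (h : IsParam lam m t₁ t₂) :
    ∃ φ : ModelField lam →ₐ[ℂ] EllipticSurfaceField t₁ t₂, φ (modelU lam) = uFun t₁ t₂ ∧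
      φ (modelT lam) = (xiFun m t₁ t₂ + (xiFun m t₁ t₂)⁻¹) / 2 ∧
      φ (modelS lam) = etaFun m t₁ t₂ * (xiFun m t₁ t₂ - (xiFun m t₁ t₂)⁻¹) / 2 := by
  have := charZero_of_complex (EllipticSurfaceField t₁ t₂)
  have hξ := xiFun_ne_zero (t₁ := t₁) (t₂ := t₂) h.ne_zero
  have hη := etaFun_ne_zero (t₁ := t₁) (t₂ := t₂) h.ne_zero
  have hD := (xiFun_transcendental (t₁ := t₁) (t₂ := t₂) h.ne_zero).sub_inv_ne_zero
  have hr := etaFun_sq h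
  have hA := relAlgClosure_ellipticSurface (t₁ := t₁) (t₂ := t₂) h.ne_zero
  set u := uFun t₁ t₂
  set ξ := xiFun m t₁ t₂
  set η := etaFun m t₁ t₂
  set D := ξ - ξ⁻¹ with hDdef
  set c := middle lam u with hc
  have hD2 : D ^ 2 = (ξ + ξ⁻¹) ^ 2 - 4 := by
    rw [hDdef]
    field_simp
    ring
  set a := D / (2 * η) with ha
  set η' := (ξ + ξ⁻¹) * η / D - D / (2 * η) with hη'
  have ha0 : a ≠ 0 := div_ne_zero hD (mul_ne_zero two_ne_zero hη)
  have ht : a * (a + η') = (ξ + ξ⁻¹) / 2 := by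
    rw [ha, hη']
    field_simp
    ring
  have hη2 : η' ^ 2 = a ^ 2 + (a ^ 2)⁻¹ - c := by
    have hc' : c = ξ + ξ⁻¹ - η ^ 2 := by rw [hr]; ring
    rw [hη', ha, hc']
    generalize ξ + ξ⁻¹ = T at *
    field_simp
    linear_combination (-4 * η ^ 4) * hD2
  have hS : relAlgClosure {u, a} = ⊤ := by
    refine relAlgClosure_eq_top_of_subset hA ?_
    have hu' := subset_relAlgClosure {u, a} (Or.inl rfl)
    have ha' := subset_relAlgClosure {u, a} (Or.inr rfl)
    have hη'' := eta_mem_relAlgClosure hη2 hu' ha'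
    have ht' : ξ + ξ⁻¹ ∈ relAlgClosure {u, a} := by
      have h2 : ξ + ξ⁻¹ = 2 * (a * (a + η')) := by
        rw [ht]
        field_simp
      rw [h2]
      exact mul_mem (ofNat_mem _ 2) (mul_mem ha' (add_mem ha' hη''))
    rintro z (rfl | rfl)
    · exact hu'
    · refine mem_relAlgClosure_of_quadratic (neg_mem ht') (one_mem _) ?_
      field_simp
      ring
  obtain ⟨φ, h1, h2, h3⟩ := exists_model_hom trdeg_ellipticSurface hS hη2
  have hT : φ (modelT lam) = (ξ + ξ⁻¹) / 2 := by
    rw [modelT_eq, map_mul, map_add, h2, h3, ht]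
  refine ⟨φ, h1, hT, ?_⟩
  rw [modelS_eq, map_mul, map_sub, map_mul, map_ofNat, hT, map_middle, h1, h2, ← hc, ha]
  have hc' : c = ξ + ξ⁻¹ - η ^ 2 := by rw [hr]; ring
  rw [hc']
  field_simp
  ring

/-- Comparison of `2 x - 1`, `4 w - 2` with `t` and `u + u⁻¹ + 4 lam²`. -/
theorem exists_modelChi (h : IsParam lam m t₁ t₂) (l : ℂˣ) (hl : (l : ℂ) = m ^ 2) :
    ∃ χ : PencilField lam l →ₐ[ℂ] ModelField lam,
      χ (coord (pencilPoly lam l) 0) =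
        algebraMap ℂ _ m * modelS lam * (modelU lam - (modelU lam)⁻¹) / 4 ∧
      χ (coord (pencilPoly lam l) 1) = (modelT lam + 1) / 2 ∧
      χ (coord (pencilPoly lam l) 2) = (middle lam (modelU lam) + 2) / 4 := by
  have := charZero_of_complex (ModelField lam)
  have hu := modelU_ne_zero (lam := lam)
  have hm : algebraMap ℂ (ModelField lam) m ≠ 0 := by
    rw [Ne, FaithfulSMul.algebraMap_eq_zero_iff]
    exact h.ne_zero
  set y := algebraMap ℂ _ m * modelS lam * (modelU lam - (modelU lam)⁻¹) / 4 with hy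
  set x := (modelT lam + 1) / 2 with hx
  set w := (middle lam (modelU lam) + 2) / 4 with hw
  obtain ⟨F, hF⟩ := exists_surfaceField_hom (pencilPoly lam l) (trdeg_pencilRing lam l)
    (trdeg_modelField (lam := lam)) ![y, x, w] (by
      simp only [pencilPoly, map_sub, map_mul, map_pow, MvPolynomial.aeval_X, map_one,
        MvPolynomial.aeval_C, Matrix.cons_val_zero, Matrix.cons_val_one, Matrix.cons_val]
      -- The pencil factors match: x(x - 1) = (t² - 1)/4, x - w = (2t - c)/4, and (w - λ²)(w - 1 -
      -- λ²) = (u - u⁻¹)²/16 because (u + u⁻¹)² - 4 = (u - u⁻¹)².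
      have hs : y ^ 2 = algebraMap ℂ _ m ^ 2 * (modelU lam - (modelU lam)⁻¹) ^ 2 / 16 *
          ((modelT lam ^ 2 - 1) * (2 * modelT lam - middle lam (modelU lam))) := by
        rw [← modelS_sq, hy]
        ring
      rw [hs, hl, hx, hw, middle]
      simp only [map_mul, map_pow, map_ofNat]
      generalize modelU lam = u at *
      generalize modelT lam = t at *
      field_simp
      ring) (by
      refine relAlgClosure_eq_top_of_subset relAlgClosure_modelU_modelT ?_
      have hx' : x ∈ relAlgClosure (Set.range ![y, x, w]) := subset_relAlgClosure _ ⟨1, rfl⟩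
      have hw' : w ∈ relAlgClosure (Set.range ![y, x, w]) := subset_relAlgClosure _ ⟨2, rfl⟩
      rintro z (rfl | rfl)
      -- The quadratic expresses u + u⁻¹ = 4w - 2 - 4λ².
      · refine mem_relAlgClosure_of_quadratic
          (b := algebraMap ℂ _ (4 * lam ^ 2 + 2) - 4 * w) (c := 1)
          (sub_mem (IntermediateField.algebraMap_mem _ _) (mul_mem (ofNat_mem _ 4) hw'))
          (one_mem _) ?_
        rw [hw, middle]
        simp only [map_mul, map_pow, map_ofNat, map_add]
        field_simp
        ring
      · have ht : modelT lam = 2 * x - 1 := by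
          rw [hx]
          field_simp
          ring
        rw [ht]
        exact sub_mem (mul_mem (ofNat_mem _ 2) hx') (one_mem _))
  exact ⟨F, hF 0, hF 1, hF 2⟩

end ModelMaps

/-! ### Two-forms -/

section Forms

variable {K : Type*} [Field K] [Algebra ℂ K]

/-- Bilinearity and alternation leave only the Jacobian determinant. All computations with two-forms
below reduce to this. -/
theorem dWedge_eq_of_D_eq {g h x y p q r s : K}
    (hg : KaehlerDifferential.D ℂ K g =
      p • KaehlerDifferential.D ℂ K x + q • KaehlerDifferential.D ℂ K y)
    (hh : KaehlerDifferential.D ℂ K h =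
      r • KaehlerDifferential.D ℂ K x + s • KaehlerDifferential.D ℂ K y) :
    dWedge g h = (p * s - q * r) • dWedge x y := by
  set a := KaehlerDifferential.D ℂ K x
  set b := KaehlerDifferential.D ℂ K y
  let f := exteriorPower.ιMulti K 2 (M := Ω[K⁄ℂ])
  have hu0 (v w z : Ω[K⁄ℂ]) : Function.update ![v, z] 0 w = ![w, z] := by
    ext i
    fin_cases i <;> rfl
  have hu1 (v w z : Ω[K⁄ℂ]) : Function.update ![z, v] 1 w = ![z, w] := by
    ext i
    fin_cases i <;> rfl
  have haa (v : Ω[K⁄ℂ]) : f ![v, v] = 0 :=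
    f.map_eq_zero_of_eq ![v, v] (i := 0) (j := 1) rfl (by decide)
  have hadd0 (v w z : Ω[K⁄ℂ]) : f ![v + w, z] = f ![v, z] + f ![w, z] := by
    have := f.map_update_add ![v, z] 0 v w
    rwa [hu0, hu0, hu0] at this
  have hadd1 (v w z : Ω[K⁄ℂ]) : f ![z, v + w] = f ![z, v] + f ![z, w] := by
    have := f.map_update_add ![z, v] 1 v w
    rwa [hu1, hu1, hu1] at this
  have hsmul0 (c : K) (v z : Ω[K⁄ℂ]) : f ![c • v, z] = c • f ![v, z] := by
    have := f.map_update_smul ![v, z] 0 c v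
    rwa [hu0, hu0] at this
  have hsmul1 (c : K) (v z : Ω[K⁄ℂ]) : f ![z, c • v] = c • f ![z, v] := by
    have := f.map_update_smul ![z, v] 1 c v
    rwa [hu1, hu1] at this
  have hswap : f ![b, a] = -f ![a, b] := by
    have h1 := haa (a + b)
    rw [hadd0, hadd1, hadd1, haa, haa, zero_add, add_zero] at h1
    exact eq_neg_of_add_eq_zero_right h1
  change f ![_, _] = _ • f ![a, b]
  rw [hg, hh, hadd0, hadd1, hadd1, hsmul0, hsmul0, hsmul0, hsmul0, hsmul1, hsmul1, hsmul1, hsmul1,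
    haa, haa, hswap]
  simp only [smul_neg, smul_smul, smul_zero, zero_add, add_zero]
  module

theorem D_inv (x : K) : KaehlerDifferential.D ℂ K x⁻¹ =
    (-(x ^ 2)⁻¹) • KaehlerDifferential.D ℂ K x := by
  rw [Derivation.leibniz_inv, inv_pow]

theorem D_middle (lam : ℂ) (u : K) : KaehlerDifferential.D ℂ K (middle lam u) =
    (1 - (u ^ 2)⁻¹) • KaehlerDifferential.D ℂ K u := by
  rw [middle, map_add, map_add, Derivation.map_algebraMap, D_inv, add_zero, sub_smul, one_smul,
    neg_smul, sub_eq_add_neg]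

theorem ratForm_eq {a b g h x y c : K} (hw : dWedge g h = c • dWedge x y)
    (hc : a⁻¹ * c = b⁻¹) : ratForm a g h = ratForm b x y := by
  rw [ratForm, hw, smul_smul, hc, ratForm]

theorem ratForm_neg (b u a : K) : ratForm (-b) u (-a) = ratForm b u a := by
  refine ratForm_eq (c := -1) (g := u) ?_ ?_
  · refine (dWedge_eq_of_D_eq (p := 1) (q := 0) (r := 0) (s := -1) (x := u) (y := a)
      ?_ ?_).trans ?_
    · simp
    · simp
    · simp
  · rw [inv_neg, neg_mul_neg, mul_one]

/-- The logarithmic form da/a changes sign under inversion, and the sign is absorbed by η ↦ -η. -/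
theorem ratForm_inv {a : K} (ha : a ≠ 0) (u η : K) :
    ratForm (u * a⁻¹ * -η) u a⁻¹ = ratForm (u * a * η) u a := by
  refine ratForm_eq (c := -(a ^ 2)⁻¹) ?_ ?_
  · refine (dWedge_eq_of_D_eq (p := 1) (q := 0) (r := 0) (s := -(a ^ 2)⁻¹) (x := u) (y := a)
      ?_ ?_).trans ?_
    · simp
    · rw [D_inv, zero_smul, zero_add]
    · simp
  · simp only [mul_inv, inv_inv, inv_neg]
    field_simp

theorem D_const_mul (c : ℂ) (x : K) : KaehlerDifferential.D ℂ K (algebraMap ℂ K c * x) =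
    algebraMap ℂ K c • KaehlerDifferential.D ℂ K x := by
  rw [Derivation.leibniz, Derivation.map_algebraMap, smul_zero, add_zero]

/-- The two-form of the elliptic surface in the coordinates of the twisted Legendre pencil. -/
theorem ratForm_ellipticSurface_eq {lam m : ℂ} (hm : m ≠ 0) {u ξ η : K} (hu : u ≠ 0) (hξ : ξ ≠ 0)
    (hu' : u - u⁻¹ ≠ 0) (hξ' : ξ - ξ⁻¹ ≠ 0) :
    ratForm (algebraMap ℂ K (8 * m ^ 3) * u ^ 3 * ξ * η) u
      (algebraMap ℂ K (4 * m ^ 2) * u ^ 2 * ξ) =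
    ratForm (algebraMap ℂ K m * (η * (ξ - ξ⁻¹) / 2) * (u - u⁻¹) / 4) ((middle lam u + 2) / 4)
      (((ξ + ξ⁻¹) / 2 + 1) / 2) := by
  have := charZero_of_complex K
  have hm' : algebraMap ℂ K m ≠ 0 := by rwa [Ne, FaithfulSMul.algebraMap_eq_zero_iff]
  have h1 : dWedge u (algebraMap ℂ K (4 * m ^ 2) * u ^ 2 * ξ) =
      (algebraMap ℂ K (4 * m ^ 2) * u ^ 2) • dWedge u ξ := by
    refine (dWedge_eq_of_D_eq (p := 1) (q := 0) (r := algebraMap ℂ K (4 * m ^ 2) * (2 * u * ξ))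
      (s := algebraMap ℂ K (4 * m ^ 2) * u ^ 2) (x := u) (y := ξ) ?_ ?_).trans ?_
    · simp
    · rw [mul_assoc, D_const_mul, Derivation.leibniz, Derivation.leibniz_pow]
      module
    · simp
  have h2 : dWedge ((middle lam u + 2) / 4) (((ξ + ξ⁻¹) / 2 + 1) / 2) =
      ((1 - (u ^ 2)⁻¹) * (1 - (ξ ^ 2)⁻¹) / 16) • dWedge u ξ := by
    have e1 : (middle lam u + 2) / 4 = algebraMap ℂ K (1 / 4) * middle lam u +
        algebraMap ℂ K (1 / 2) := by
      simp only [map_div₀, map_one, map_ofNat]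
      field_simp
      ring
    have e2 : ((ξ + ξ⁻¹) / 2 + 1) / 2 = algebraMap ℂ K (1 / 4) * (ξ + ξ⁻¹) +
        algebraMap ℂ K (1 / 2) := by
      simp only [map_div₀, map_one, map_ofNat]
      ring
    rw [e1, e2]
    refine (dWedge_eq_of_D_eq (p := algebraMap ℂ K (1 / 4) * (1 - (u ^ 2)⁻¹)) (q := 0) (r := 0)
      (s := algebraMap ℂ K (1 / 4) * (1 - (ξ ^ 2)⁻¹)) (x := u) (y := ξ) ?_ ?_).trans ?_
    · rw [map_add, Derivation.map_algebraMap, D_const_mul, D_middle]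
      module
    · rw [map_add, Derivation.map_algebraMap, D_const_mul, map_add, D_inv]
      module
    · congr 1
      simp only [map_div₀, map_one, map_ofNat]
      ring
  rw [ratForm, ratForm, h1, h2, smul_smul, smul_smul]
  congr 1
  -- For η = 0 both denominators are zero, and both sides vanish by the convention 0⁻¹ = 0.
  rcases eq_or_ne η 0 with rfl | hη
  · simp
  simp only [map_mul, map_pow, map_ofNat]
  have hu2 : u ^ 2 - 1 ≠ 0 := fun h => hu' (by field_simp; rw [h, mul_zero])
  have hξ2 : ξ ^ 2 - 1 ≠ 0 := fun h => hξ' (by field_simp; rw [h, mul_zero])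
  field_simp
  norm_num

end Forms

/-! ### The quotient maps of the sandwich -/

theorem natDegree_X_pow_add_of_degree_lt {R : Type*} [CommRing R] [Nontrivial R] {n : ℕ} {q : R[X]}
    (h : q.degree < n) : (X ^ n + q).natDegree = n := by
  refine natDegree_eq_of_degree_eq_some ?_
  rw [degree_add_eq_left_of_degree_lt (by rwa [degree_X_pow]), degree_X_pow]

section Quotients

variable {A B : Type*} [Field A] [Field B] [Algebra ℂ A] [Algebra ℂ B]

/-- Over the image, the whole field is generated by a, a root of X² - a²; the automorphisms 1 and i
match this bound. -/
theorem fieldRange_eq_fixedField_zpowers {u a η : B}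
    (hgen : IntermediateField.adjoin ℂ {u, a, η} = ⊤) (i : B ≃ₐ[ℂ] B) (hi : i ≠ 1) (f : A →ₐ[ℂ] B)
    (hf : (i : B →ₐ[ℂ] B).comp f = f) (hu : u ∈ f.fieldRange) (ha : a ^ 2 ∈ f.fieldRange)
    (hη : η ∈ f.fieldRange) :
    f.fieldRange = IntermediateField.fixedField (Subgroup.zpowers i) ∧ mapDegree f = 2 := by
  classical
  have hp : (X ^ 2 - C (⟨a ^ 2, ha⟩ : f.fieldRange)).natDegree = 2 := natDegree_X_pow_sub_C
  rw [Subgroup.zpowers_eq_closure]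
  have h := eq_fixedField_of_simple (Subgroup.closure {i}) f.fieldRange
    (fieldRange_le_fixedField_closure f (by simpa using hf)) hgen a (by
      rintro z (rfl | rfl | rfl)
      · exact mem_adjoin_of_mem hu
      · exact IntermediateField.mem_adjoin_simple_self _ _
      · exact mem_adjoin_of_mem hη)
    (p := X ^ 2 - C (⟨a ^ 2, ha⟩ : f.fieldRange)) (monic_X_pow_sub_C _ two_ne_zero) (by
      rw [map_sub, map_pow, aeval_X, aeval_C]
      exact sub_self _) {1, i} (by
      intro σ hσ
      rcases Finset.mem_insert.1 hσ with rfl | hσ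
      · exact one_mem _
      · rw [Finset.mem_singleton.1 hσ]
        exact Subgroup.subset_closure rfl) (by
      rw [hp, Finset.card_pair hi.symm])
  rw [hp] at h
  exact h

/-- Over the image, a is a root of X⁴ - (a² + a⁻²)X² + 1, and η is recovered on division by a² -
a⁻². The four distinct roots ±a, ±a⁻¹ are the images of a under 1, i, j, ij, so the degree is
exactly four. -/
theorem fieldRange_eq_fixedField_closure_pair {u a η : B}
    (hgen : IntermediateField.adjoin ℂ {u, a, η} = ⊤) (ha : Transcendental ℂ a)
    (i j : B ≃ₐ[ℂ] B) (hia : i a = -a) (hja : j a = a⁻¹) (f : A →ₐ[ℂ] B)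
    (hif : (i : B →ₐ[ℂ] B).comp f = f) (hjf : (j : B →ₐ[ℂ] B).comp f = f) (hu : u ∈ f.fieldRange)
    (ht : a ^ 2 + (a ^ 2)⁻¹ ∈ f.fieldRange) (hη : η * (a ^ 2 - (a ^ 2)⁻¹) ∈ f.fieldRange) :
    f.fieldRange = IntermediateField.fixedField (Subgroup.closure {i, j}) ∧ mapDegree f = 4 := by
  classical
  have := charZero_of_complex B
  have ha0 := ha.ne_zero_of_complex
  have ha2 : Transcendental ℂ (a ^ 2) := fun h => ha (h.of_pow two_pos)
  have ha4 := ha2.sub_inv_ne_zero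
  have hne1 : a ≠ a⁻¹ := fun h => ha.sub_inv_ne_zero (sub_eq_zero.2 h)
  have hne2 : a ≠ -a⁻¹ := by
    intro h
    apply ha4
    have h2 : a ^ 2 = (a ^ 2)⁻¹ := by
      conv_lhs => rw [h]
      rw [neg_sq, inv_pow]
    rw [← h2, sub_self]
  have hne3 : a ≠ -a := self_ne_neg.2 ha0
  set T : f.fieldRange := ⟨a ^ 2 + (a ^ 2)⁻¹, ht⟩ with hT
  set p : (f.fieldRange)[X] := X ^ 4 - C T * X ^ 2 + 1 with hpdef
  have hpm : p.natDegree = 4 ∧ p.Monic := by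
    have h1 : p = X ^ 4 + (-(C T * X ^ 2) + 1) := by rw [hpdef]; ring
    have h2 : (-(C T * X ^ 2) + 1).degree < ((4 : ℕ) : WithBot ℕ) := by
      refine (degree_add_le _ _).trans_lt (max_lt ?_ ?_)
      · rw [degree_neg]
        exact (degree_C_mul_X_pow_le _ _).trans_lt (by norm_num)
      · exact degree_one_le.trans_lt (by norm_num)
    refine ⟨?_, h1 ▸ monic_X_pow_add h2⟩
    rw [h1]
    exact natDegree_X_pow_add_of_degree_lt h2
  have hij : (i * j) a = -a⁻¹ := by
    rw [AlgEquiv.mul_apply, hja, map_inv₀, hia, inv_neg]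
  have hnei {σ τ : B ≃ₐ[ℂ] B} (h : σ a ≠ τ a) : σ ≠ τ := fun h' => h (by rw [h'])
  have hcard : ({1, i, j, i * j} : Finset (B ≃ₐ[ℂ] B)).card = 4 := by
    rw [Finset.card_insert_of_notMem, Finset.card_insert_of_notMem, Finset.card_pair]
    · refine hnei ?_
      rw [hij, hja]
      exact self_ne_neg.2 (inv_ne_zero ha0)
    · rw [Finset.mem_insert, Finset.mem_singleton]
      refine not_or.2 ⟨hnei ?_, hnei ?_⟩
      · rw [hia, hja]
        exact fun h => hne2 (by rw [← h, neg_neg])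
      · rw [hia, hij]
        exact fun h => hne1 (neg_injective h)
    · simp only [Finset.mem_insert, Finset.mem_singleton]
      refine not_or.2 ⟨hnei ?_, not_or.2 ⟨hnei ?_, hnei ?_⟩⟩
      · rw [hia, AlgEquiv.one_apply]
        exact hne3
      · rw [hja, AlgEquiv.one_apply]
        exact hne1
      · rw [hij, AlgEquiv.one_apply]
        exact hne2
  have haM : a ∈ IntermediateField.adjoin f.fieldRange {a} :=
    IntermediateField.mem_adjoin_simple_self _ _
  have h := eq_fixedField_of_simple (Subgroup.closure {i, j}) f.fieldRange
    (fieldRange_le_fixedField_closure f (by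
      rintro σ (rfl | rfl)
      exacts [hif, hjf])) hgen a (by
      rintro z (rfl | rfl | rfl)
      · exact mem_adjoin_of_mem hu
      · exact haM
      · rw [eq_div_of_mul_eq ha4 (rfl : z * _ = _)]
        exact div_mem (mem_adjoin_of_mem hη) (sub_mem (pow_mem haM 2) (inv_mem (pow_mem haM 2))))
    hpm.2 (by
      rw [hpdef]
      simp only [map_add, map_sub, map_mul, map_pow, aeval_X, aeval_C, map_one]
      change a ^ 4 - (a ^ 2 + (a ^ 2)⁻¹) * a ^ 2 + 1 = 0
      field_simp
      ring) {1, i, j, i * j} (by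
      have h1 : i ∈ Subgroup.closure {i, j} := Subgroup.subset_closure (Or.inl rfl)
      have h2 : j ∈ Subgroup.closure {i, j} := Subgroup.subset_closure (Or.inr rfl)
      intro σ hσ
      simp only [Finset.mem_insert, Finset.mem_singleton] at hσ
      rcases hσ with rfl | rfl | rfl | rfl
      exacts [one_mem _, h1, h2, mul_mem h1 h2]) (by
      rw [hpm.1, hcard])
  rw [hpm.1] at h
  exact h

/-- The image contains t, u + u⁻¹ and s(u - u⁻¹). Adjoining u, a root of X² - (u + u⁻¹)X + 1,
therefore recovers s, a and η; the third involution exchanges the two roots. -/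
theorem mapDegree_modelChi {lam m : ℂ} (hm : m ≠ 0) (l : ℂˣ)
    (χ : PencilField lam l →ₐ[ℂ] ModelField lam)
    (h0 : χ (coord (pencilPoly lam l) 0) =
      algebraMap ℂ _ m * modelS lam * (modelU lam - (modelU lam)⁻¹) / 4)
    (h1 : χ (coord (pencilPoly lam l) 1) = (modelT lam + 1) / 2)
    (h2 : χ (coord (pencilPoly lam l) 2) = (middle lam (modelU lam) + 2) / 4) :
    mapDegree χ = 2 := by
  classical
  have := charZero_of_complex (ModelField lam)
  have hm' : algebraMap ℂ (ModelField lam) m ≠ 0 := by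
    rwa [Ne, FaithfulSMul.algebraMap_eq_zero_iff]
  have hu0 := modelU_ne_zero (lam := lam)
  have ha0 := modelA_ne_zero (lam := lam)
  have hu1 := (modelU_transcendental (lam := lam)).sub_inv_ne_zero
  obtain ⟨k, hku, hka, hkη⟩ := exists_modelK (lam := lam)
  have hkt : k (modelT lam) = modelT lam := by
    rw [modelT_eq, map_mul, map_add, hka, hkη]
    ring
  have hkc : k (middle lam (modelU lam)) = middle lam (modelU lam) := by
    rw [← middle_inv, ← hku]
    exact (map_middle (k : ModelField lam →ₐ[ℂ] ModelField lam) lam _).trans (by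
      rw [← middle_inv]
      congr 1
      change (k (k (modelU lam)))⁻¹ = _
      rw [hku, map_inv₀, hku, inv_inv])
  have hks : k (modelS lam) = -modelS lam := by
    rw [modelS_eq, map_mul, map_sub, map_mul, map_ofNat, hkt, hkc, hka]
    ring
  have hT : modelT lam ∈ χ.fieldRange := by
    have : modelT lam = χ (2 * coord (pencilPoly lam l) 1 - 1) := by
      rw [map_sub, map_mul, map_ofNat, map_one, h1]
      field_simp
      ring
    exact ⟨_, this.symm⟩
  have hc : modelU lam + (modelU lam)⁻¹ ∈ χ.fieldRange := by
    have : modelU lam + (modelU lam)⁻¹ =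
        χ (4 * coord (pencilPoly lam l) 2 - algebraMap ℂ _ (4 * lam ^ 2 + 2)) := by
      rw [map_sub, map_mul, map_ofNat, h2, AlgHom.commutes, middle, map_add _ (4 * lam ^ 2),
        map_ofNat]
      field_simp
      ring
    exact ⟨_, this.symm⟩
  have hS : modelS lam * (modelU lam - (modelU lam)⁻¹) ∈ χ.fieldRange := by
    have : modelS lam * (modelU lam - (modelU lam)⁻¹) =
        χ (algebraMap ℂ _ (4 / m) * coord (pencilPoly lam l) 0) := by
      rw [map_mul, AlgHom.commutes, h0, map_div₀, map_ofNat]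
      generalize modelU lam - (modelU lam)⁻¹ = d at *
      field_simp
    exact ⟨_, this.symm⟩
  set U : χ.fieldRange := ⟨modelU lam + (modelU lam)⁻¹, hc⟩ with hU
  set p : (χ.fieldRange)[X] := X ^ 2 + (-(C U) * X + 1) with hpdef
  have hp2 : (-(C U) * X + 1).degree < ((2 : ℕ) : WithBot ℕ) := by
    refine (degree_add_le _ _).trans_lt (max_lt ?_ ?_)
    · rw [neg_mul, degree_neg]
      exact (degree_C_mul_X_le _).trans_lt (by norm_num)
    · exact degree_one_le.trans_lt (by norm_num)
  have hpd : p.natDegree = 2 := natDegree_X_pow_add_of_degree_lt hp2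
  have huM : modelU lam ∈ IntermediateField.adjoin χ.fieldRange {modelU lam} :=
    IntermediateField.mem_adjoin_simple_self _ _
  have hTM : modelT lam ∈ IntermediateField.adjoin χ.fieldRange {modelU lam} :=
    mem_adjoin_of_mem hT
  have hcM : middle lam (modelU lam) ∈ IntermediateField.adjoin χ.fieldRange {modelU lam} :=
    add_mem (mem_adjoin_of_mem hc) (mem_adjoin_of_mem (χ.fieldRange.algebraMap_mem _))
  have hSM : modelS lam ∈ IntermediateField.adjoin χ.fieldRange {modelU lam} := by
    rw [eq_div_of_mul_eq hu1 (rfl : modelS lam * _ = _)]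
    exact div_mem (mem_adjoin_of_mem hS) (sub_mem huM (inv_mem huM))
  have haM : modelA lam ∈ IntermediateField.adjoin χ.fieldRange {modelU lam} :=
    div_mem hSM (sub_mem (mul_mem (ofNat_mem _ 2) hTM) hcM)
  have h := eq_fixedField_of_simple (Subgroup.closure {k}) χ.fieldRange
    (fieldRange_le_fixedField_closure χ (by
      rintro σ rfl
      have hσ (z : ModelField lam) : (σ : ModelField lam →ₐ[ℂ] ModelField lam) z = σ z := rfl
      refine algHom_ext_of_adjoin (adjoin_coord _) ?_
      rintro z (rfl | rfl | rfl)
      · simp only [AlgHom.comp_apply, hσ, h0, map_div₀, map_mul, map_sub,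
          map_inv₀, hks, hku, inv_inv, map_ofNat, AlgEquiv.commutes]
        ring
      · simp only [AlgHom.comp_apply, hσ, h1, map_div₀, map_add, map_one, hkt,
          map_ofNat]
      · simp only [AlgHom.comp_apply, hσ, h2, map_div₀, map_add, hkc,
          map_ofNat])) adjoin_model (modelU lam) (by
      rintro z (rfl | rfl | rfl)
      · exact huM
      · exact haM
      · exact sub_mem (div_mem hTM haM) haM)
    (monic_X_pow_add hp2) (by
      simp only [map_add, map_mul, map_pow, map_neg, aeval_X, aeval_C, map_one]
      change modelU lam ^ 2 + (-(modelU lam + (modelU lam)⁻¹) * modelU lam + 1) = 0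
      field_simp
      ring) {1, k} (by
      intro σ hσ
      rcases Finset.mem_insert.1 hσ with rfl | hσ
      · exact one_mem _
      · rw [Finset.mem_singleton.1 hσ]
        exact Subgroup.subset_closure rfl) (by
      rw [hpd, Finset.card_pair]
      intro hk
      rw [← hk, AlgEquiv.one_apply] at hku
      exact hu1 (sub_eq_zero.2 hku))
  exact h.2.trans hpd

end Quotients

/-! ### The Dwork pencil and the mirror -/

section Dwork

variable (lam : ℂ)

theorem trdeg_dworkField : Algebra.trdeg ℂ (DworkField lam) = 2 := by
  rw [trdeg_fractionRing, trdeg_dworkRing]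

theorem dwork_equation : 1 + coord (dworkPoly lam) 0 ^ 4 + coord (dworkPoly lam) 1 ^ 4 +
    coord (dworkPoly lam) 2 ^ 4 + algebraMap ℂ _ (4 * lam) * (coord (dworkPoly lam) 0 *
      coord (dworkPoly lam) 1 * coord (dworkPoly lam) 2) = 0 := by
  have h := aeval_coord_self (dworkPoly lam)
  conv at h => lhs; arg 2; rw [dworkPoly]
  simpa only [map_add, map_one, map_mul, map_pow, MvPolynomial.aeval_X, MvPolynomial.aeval_C]
    using h

/-- Points on the coordinate axes, at a fourth root of -1, serve as witnesses that coordinate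
functions do not vanish on the quartic. -/
theorem exists_dwork_point (i : Fin 3) : ∃ P : Fin 3 → ℂ,
    MvPolynomial.eval P (dworkPoly lam) = 0 ∧ P i ≠ 0 ∧ ∀ j, j ≠ i → P j = 0 := by
  obtain ⟨z, hz⟩ := IsAlgClosed.exists_pow_nat_eq (-1 : ℂ) (n := 4) (by norm_num)
  have hz0 : z ≠ 0 := by
    rintro rfl
    norm_num at hz
  refine ⟨Pi.single i z, ?_, by simpa using hz0, fun j hj => by simp [hj]⟩
  simp only [dworkPoly, map_add, map_one, map_mul, map_pow, MvPolynomial.eval_X,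
    MvPolynomial.eval_C]
  fin_cases i <;> simp [hz]

theorem coord_dwork_ne_zero (i : Fin 3) : coord (dworkPoly lam) i ≠ 0 := by
  obtain ⟨P, h1, h2, -⟩ := exists_dwork_point lam i
  have := aeval_coord_ne_zero (g := MvPolynomial.X i) P h1 (by simpa using h2)
  simpa using this

theorem coord_dwork_pow_add_one_ne_zero : coord (dworkPoly lam) 1 ^ 4 + 1 ≠ 0 := by
  obtain ⟨P, h1, -, h3⟩ := exists_dwork_point lam 0
  have := aeval_coord_ne_zero (g := MvPolynomial.X 1 ^ 4 + 1) P h1 (by simp [h3 1 (by decide)])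
  simpa using this

/-- The function `u = -(X₂X₃ / X₀X₁)²`. -/
def dworkU : DworkField lam :=
  -(coord (dworkPoly lam) 1 * coord (dworkPoly lam) 2 / coord (dworkPoly lam) 0) ^ 2

/-- The function `X₀X₃ / X₁X₂`. -/
def dworkA : DworkField lam :=
  coord (dworkPoly lam) 2 / (coord (dworkPoly lam) 0 * coord (dworkPoly lam) 1)

/-- The function `i ((X₀⁴ + X₂⁴) / X₀X₁X₂X₃ + 2 lam)`. -/
def dworkEta : DworkField lam :=
  algebraMap ℂ _ Complex.I * ((coord (dworkPoly lam) 1 ^ 4 + 1) / (coord (dworkPoly lam) 0 *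
    coord (dworkPoly lam) 1 * coord (dworkPoly lam) 2) + algebraMap ℂ _ (2 * lam))

/-- In affine coordinates x, y, z the quartic splits as (1 + y⁴) + (x⁴ + z⁴) + 4λxyz = 0. Completing
the square in 1 + y⁴ turns η² + 4λ² into (1 + y⁴)(x⁴ + z⁴)/(xyz)², whose four terms are a², a⁻², -u,
-u⁻¹. -/
theorem dworkEta_sq : dworkEta lam ^ 2 = dworkA lam ^ 2 + (dworkA lam ^ 2)⁻¹ -
    middle lam (dworkU lam) := by
  have h := dwork_equation lam
  have hx := coord_dwork_ne_zero lam 0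
  have hy := coord_dwork_ne_zero lam 1
  have hz := coord_dwork_ne_zero lam 2
  have hI : algebraMap ℂ (DworkField lam) Complex.I ^ 2 = -1 := by
    rw [← map_pow, Complex.I_sq, map_neg, map_one]
  rw [dworkEta, dworkA, dworkU, middle, mul_pow, hI]
  simp only [map_mul, map_pow, map_ofNat] at h ⊢
  generalize coord (dworkPoly lam) 0 = x at *
  generalize coord (dworkPoly lam) 1 = y at *
  generalize coord (dworkPoly lam) 2 = z at *
  field_simp
  linear_combination (-(y ^ 4 + 1)) * h

-- The coordinates are algebraic over u and a: y⁴ = -u/a², the product xyz is rational in y⁴ and η,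
-- and x⁴ = -(xyz)²/u.
variable {lam} in
theorem relAlgClosure_dwork {S : Set (DworkField lam)} (hu : dworkU lam ∈ relAlgClosure S)
    (ha : dworkA lam ∈ relAlgClosure S) : relAlgClosure S = ⊤ := by
  have hη := eta_mem_relAlgClosure (dworkEta_sq lam) hu ha
  have hx := coord_dwork_ne_zero lam 0
  have hy := coord_dwork_ne_zero lam 1
  have hz := coord_dwork_ne_zero lam 2
  have hI : algebraMap ℂ (DworkField lam) Complex.I ≠ 0 := by
    rw [Ne, FaithfulSMul.algebraMap_eq_zero_iff]
    exact Complex.I_ne_zero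
  have h1 := coord_dwork_pow_add_one_ne_zero lam
  have hyM : coord (dworkPoly lam) 1 ∈ relAlgClosure S := by
    refine mem_relAlgClosure_of_pow 4 (by norm_num) ?_
    have : coord (dworkPoly lam) 1 ^ 4 = -dworkU lam / dworkA lam ^ 2 := by
      rw [dworkU, dworkA]
      field_simp
    rw [this]
    exact div_mem (neg_mem hu) (pow_mem ha 2)
  have hP : coord (dworkPoly lam) 0 * coord (dworkPoly lam) 1 * coord (dworkPoly lam) 2 =
      (coord (dworkPoly lam) 1 ^ 4 + 1) / (dworkEta lam / algebraMap ℂ _ Complex.I -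
        algebraMap ℂ _ (2 * lam)) := by
    rw [dworkEta, mul_div_cancel_left₀ _ hI, add_sub_cancel_right, div_div_cancel₀ h1]
  have hPM : coord (dworkPoly lam) 0 * coord (dworkPoly lam) 1 * coord (dworkPoly lam) 2 ∈
      relAlgClosure S := by
    rw [hP]
    exact div_mem (add_mem (pow_mem hyM 4) (one_mem _)) (sub_mem (div_mem hη
      (IntermediateField.algebraMap_mem _ _)) (IntermediateField.algebraMap_mem _ _))
  have hxM : coord (dworkPoly lam) 0 ∈ relAlgClosure S := by
    refine mem_relAlgClosure_of_pow 4 (by norm_num) ?_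
    have : coord (dworkPoly lam) 0 ^ 4 = -(coord (dworkPoly lam) 0 * coord (dworkPoly lam) 1 *
        coord (dworkPoly lam) 2) ^ 2 / dworkU lam := by
      rw [dworkU]
      field_simp
    rw [this]
    exact div_mem (neg_mem (pow_mem hPM 2)) hu
  refine relAlgClosure_eq_top (adjoin_coord _) ?_
  rintro w (rfl | rfl | rfl)
  · exact hxM
  · exact hyM
  · have : coord (dworkPoly lam) 2 = coord (dworkPoly lam) 0 * coord (dworkPoly lam) 1 *
        coord (dworkPoly lam) 2 / (coord (dworkPoly lam) 0 * coord (dworkPoly lam) 1) := by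
      field_simp
    rw [this]
    exact div_mem hPM (mul_mem hxM hyM)

variable {lam} in
theorem exists_model_dwork : ∃ F : ModelField lam →ₐ[ℂ] DworkField lam,
    F (modelU lam) = dworkU lam ∧ F (modelA lam) = dworkA lam ∧ F (modelEta lam) = dworkEta lam :=
  exists_model_hom (trdeg_dworkField lam) (relAlgClosure_dwork
    (subset_relAlgClosure _ (Or.inl rfl)) (subset_relAlgClosure _ (Or.inr rfl))) (dworkEta_sq lam)

variable {lam} in
theorem exists_ellipticSurface_dwork {m t₁ t₂ : ℂ} (h : IsParam lam m t₁ t₂) :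
    ∃ F : EllipticSurfaceField t₁ t₂ →ₐ[ℂ] DworkField lam, F (uFun t₁ t₂) = dworkU lam ∧
      F (xiFun m t₁ t₂) = dworkA lam ^ 2 ∧ F (etaFun m t₁ t₂) = dworkEta lam :=
  exists_ellipticSurface_hom h (trdeg_dworkField lam) (relAlgClosure_dwork
    (subset_relAlgClosure _ (Or.inl rfl)) (mem_relAlgClosure_of_pow 2 two_pos
      (subset_relAlgClosure _ (Or.inr rfl)))) (dworkEta_sq lam)

theorem scale_X (c : Fin 3 → ℂˣ) (i : Fin 3) :
    scale c (MvPolynomial.X i) = MvPolynomial.C (c i : ℂ) * MvPolynomial.X i :=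
  MvPolynomial.aeval_X _ i

theorem scaleAut_coord (p : MvPolynomial (Fin 3) ℂ) [(Ideal.span {p}).IsPrime] (c : Fin 3 → ℂˣ)
    (h : scale c p = p) (i : Fin 3) :
    scaleAut p c h (coord p i) = algebraMap ℂ _ (c i : ℂ) * coord p i := by
  refine (IsFractionRing.algEquivOfAlgEquiv_algebraMap _ _).trans ?_
  refine (congrArg (fun g => algebraMap (SurfaceRing p) (SurfaceField p)
    (Ideal.Quotient.mk _ g)) (scale_X c i)).trans ?_
  rw [map_mul, map_mul]
  rfl

theorem algEquiv_pow_apply_eq {K : Type*} [Field K] [Algebra ℂ K] (σ : K ≃ₐ[ℂ] K) {x : K} {c : ℂ}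
    (h : σ x = algebraMap ℂ K c * x) (n : ℕ) : (σ ^ n) x = algebraMap ℂ K (c ^ n) * x := by
  induction n with
  | zero => simp
  | succ n ih =>
    rw [pow_succ', AlgEquiv.mul_apply, ih, map_mul, AlgEquiv.commutes, h, pow_succ, map_mul]
    ring

theorem I_pow_eq_iff (n k : ℕ) : Complex.I ^ n = Complex.I ^ k ↔ n % 4 = k % 4 := by
  rw [Complex.I_pow_eq_pow_mod n, Complex.I_pow_eq_pow_mod k]
  refine ⟨fun h => ?_, fun h => by rw [h]⟩
  have h1 : n % 4 < 4 := Nat.mod_lt _ (by norm_num)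
  have h2 : k % 4 < 4 := Nat.mod_lt _ (by norm_num)
  generalize n % 4 = a at *
  generalize k % 4 = b at *
  interval_cases a <;> interval_cases b <;> simp [Complex.ext_iff, pow_succ] at h ⊢ <;>
    norm_num at h

theorem greenePlesser_coord (j i : Fin 3) :
    scaleAut (dworkPoly lam) (dworkScale j) (scale_dworkPoly lam j) (coord (dworkPoly lam) i) =
      algebraMap ℂ _ (Complex.I ^ (if i = j then 2 else 1)) * coord (dworkPoly lam) i := by
  rw [scaleAut_coord, dworkScale]
  congr 2
  split_ifs <;> simp

/-- The functions `u`, `ξ` and `η` are invariant under the Greene-Plesser group. -/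
theorem dwork_mem_mirrorField : dworkU lam ∈ MirrorField lam ∧ dworkA lam ^ 2 ∈ MirrorField lam ∧
    dworkEta lam ∈ MirrorField lam := by
  -- Each generator scales the coordinates by constants; only these four monomials in the constants
  -- enter u, a² and η.
  have key (j : Fin 3) : ∃ c : Fin 3 → DworkField lam, (∀ i, scaleAut (dworkPoly lam) (dworkScale j)
      (scale_dworkPoly lam j) (coord (dworkPoly lam) i) = c i * coord (dworkPoly lam) i) ∧
      (c 1 * c 2 / c 0) ^ 2 = 1 ∧ (c 2 / (c 0 * c 1)) ^ 2 = 1 ∧ c 0 * c 1 * c 2 = 1 ∧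
      c 1 ^ 4 = 1 := by
    refine ⟨fun i => algebraMap ℂ _ (Complex.I ^ (if i = j then 2 else 1)),
      fun i => greenePlesser_coord lam j i, ?_⟩
    simp only [← map_mul, ← map_div₀, ← map_pow, ← map_one (algebraMap ℂ (DworkField lam)),
      (algebraMap ℂ (DworkField lam)).injective.eq_iff]
    have h01 : (0 : Fin 3) ≠ 1 := by decide
    have h02 : (0 : Fin 3) ≠ 2 := by decide
    have h12 : (1 : Fin 3) ≠ 2 := by decide
    have hj : j = 0 ∨ j = 1 ∨ j = 2 := by fin_cases j <;> simp
    rcases hj with rfl | rfl | rfl <;> simp only [h01, h02, h12, h01.symm, h02.symm, h12.symm,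
      if_true, if_false] <;> refine ⟨?_, ?_, ?_, ?_⟩ <;>
      norm_num [Complex.I_sq, Complex.I_pow_four, mul_pow, div_pow, ← pow_mul]
  refine ⟨mem_fixedField_closure ?_, mem_fixedField_closure ?_, mem_fixedField_closure ?_⟩
  all_goals
    rintro _ ⟨j, rfl⟩
    obtain ⟨c, hc, h1, h2, h3, h4⟩ := key j
  · simp only [dworkU, map_neg, map_pow, map_mul, map_div₀, hc]
    rw [mul_mul_mul_comm, mul_div_mul_comm, mul_pow, h1, one_mul]
  · simp only [dworkA, map_pow, map_mul, map_div₀, hc]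
    rw [mul_mul_mul_comm, mul_div_mul_comm, mul_pow, h2, one_mul]
  · simp only [dworkEta, map_add, map_one, map_pow, map_mul, map_div₀, hc, AlgEquiv.commutes]
    rw [mul_pow, h4, one_mul, mul_mul_mul_comm (c 0), mul_mul_mul_comm (c 0 * c 1), h3, one_mul]

/-- The Greene-Plesser group has at least sixteen elements. -/
theorem exists_finset_greenePlesserGroup : ∃ s : Finset (DworkField lam ≃ₐ[ℂ] DworkField lam),
    (∀ σ ∈ s, σ ∈ greenePlesserGroup lam) ∧ 16 ≤ s.card := by
  classical
  let g (j : Fin 3) := scaleAut (dworkPoly lam) (dworkScale j) (scale_dworkPoly lam j)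
  let F : Fin 4 × Fin 4 → (DworkField lam ≃ₐ[ℂ] DworkField lam) :=
    fun q => g 0 ^ (q.1 : ℕ) * g 1 ^ (q.2 : ℕ)
  have hF0 (q : Fin 4 × Fin 4) : F q (coord (dworkPoly lam) 0) = algebraMap ℂ _
      (Complex.I ^ (2 * (q.1 : ℕ) + q.2)) * coord (dworkPoly lam) 0 := by
    rw [AlgEquiv.mul_apply, algEquiv_pow_apply_eq _ (greenePlesser_coord lam 1 0), map_mul,
      AlgEquiv.commutes, algEquiv_pow_apply_eq _ (greenePlesser_coord lam 0 0), ← mul_assoc,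
      ← map_mul, ← pow_mul, ← pow_mul, ← pow_add]
    congr 3
    simp
    ring
  have hF1 (q : Fin 4 × Fin 4) : F q (coord (dworkPoly lam) 1) = algebraMap ℂ _
      (Complex.I ^ ((q.1 : ℕ) + 2 * q.2)) * coord (dworkPoly lam) 1 := by
    rw [AlgEquiv.mul_apply, algEquiv_pow_apply_eq _ (greenePlesser_coord lam 1 1), map_mul,
      AlgEquiv.commutes, algEquiv_pow_apply_eq _ (greenePlesser_coord lam 0 1), ← mul_assoc,
      ← map_mul, ← pow_mul, ← pow_mul, ← pow_add]
    congr 3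
    simp
    ring
  have hinj : Function.Injective F := by
    intro q r hqr
    have h0 : F q (coord (dworkPoly lam) 0) = F r (coord (dworkPoly lam) 0) := by rw [hqr]
    have h1 : F q (coord (dworkPoly lam) 1) = F r (coord (dworkPoly lam) 1) := by rw [hqr]
    rw [hF0, hF0] at h0
    rw [hF1, hF1] at h1
    have h0' := (I_pow_eq_iff _ _).1 ((algebraMap ℂ (DworkField lam)).injective
      (mul_right_cancel₀ (coord_dwork_ne_zero lam 0) h0))
    have h1' := (I_pow_eq_iff _ _).1 ((algebraMap ℂ (DworkField lam)).injective
      (mul_right_cancel₀ (coord_dwork_ne_zero lam 1) h1))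
    have b1 := q.1.2
    have b2 := q.2.2
    have b3 := r.1.2
    have b4 := r.2.2
    -- The exponents 2p + q and p + 2q modulo 4 determine p and q modulo 4, since the determinant 3
    -- is a unit.
    refine Prod.ext (Fin.ext ?_) (Fin.ext ?_) <;> omega
  refine ⟨Finset.univ.image F, ?_, ?_⟩
  · intro σ hσ
    obtain ⟨q, -, rfl⟩ := Finset.mem_image.1 hσ
    have hg (j : Fin 3) : g j ∈ greenePlesserGroup lam := Subgroup.subset_closure ⟨j, rfl⟩
    exact mul_mem (pow_mem (hg 0) _) (pow_mem (hg 1) _)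
  · rw [Finset.card_image_of_injective _ hinj]
    simp

/-- From u, a² and η one obtains x⁴, y⁴ and xyz in `L`. So x and y generate everything over `L` with
degree at most 4 · 4, and sixteen group elements match that bound. -/
theorem eq_mirrorField_of_mem (L : IntermediateField ℂ (DworkField lam)) (hL : L ≤ MirrorField lam)
    (hu : dworkU lam ∈ L) (hξ : dworkA lam ^ 2 ∈ L) (hη : dworkEta lam ∈ L) :
    L = MirrorField lam := by
  have hx := coord_dwork_ne_zero lam 0
  have hy := coord_dwork_ne_zero lam 1
  have hz := coord_dwork_ne_zero lam 2
  have hI : algebraMap ℂ (DworkField lam) Complex.I ≠ 0 := by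
    rw [Ne, FaithfulSMul.algebraMap_eq_zero_iff]
    exact Complex.I_ne_zero
  have h1 := coord_dwork_pow_add_one_ne_zero lam
  have hyM : coord (dworkPoly lam) 1 ^ 4 ∈ L := by
    have : coord (dworkPoly lam) 1 ^ 4 = -dworkU lam / dworkA lam ^ 2 := by
      rw [dworkU, dworkA]
      field_simp
    rw [this]
    exact div_mem (neg_mem hu) hξ
  have hP : coord (dworkPoly lam) 0 * coord (dworkPoly lam) 1 * coord (dworkPoly lam) 2 =
      (coord (dworkPoly lam) 1 ^ 4 + 1) / (dworkEta lam / algebraMap ℂ _ Complex.I -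
        algebraMap ℂ _ (2 * lam)) := by
    rw [dworkEta, mul_div_cancel_left₀ _ hI, add_sub_cancel_right, div_div_cancel₀ h1]
  have hPM : coord (dworkPoly lam) 0 * coord (dworkPoly lam) 1 * coord (dworkPoly lam) 2 ∈ L := by
    rw [hP]
    exact div_mem (add_mem hyM (one_mem _)) (sub_mem (div_mem hη
      (IntermediateField.algebraMap_mem _ _)) (IntermediateField.algebraMap_mem _ _))
  have hxM : coord (dworkPoly lam) 0 ^ 4 ∈ L := by
    have : coord (dworkPoly lam) 0 ^ 4 = -(coord (dworkPoly lam) 0 * coord (dworkPoly lam) 1 *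
        coord (dworkPoly lam) 2) ^ 2 / dworkU lam := by
      rw [dworkU]
      field_simp
    rw [this]
    exact div_mem (neg_mem (pow_mem hPM 2)) hu
  obtain ⟨s, hs, hcard⟩ := exists_finset_greenePlesserGroup lam
  have hroot {w : DworkField lam} (hw : w ^ 4 ∈ L) : aeval w (X ^ 4 - C (⟨w ^ 4, hw⟩ : L)) = 0 := by
    rw [map_sub, map_pow, aeval_X, aeval_C]
    exact sub_self _
  have hx1 : coord (dworkPoly lam) 0 ∈ IntermediateField.adjoin L
      {coord (dworkPoly lam) 0, coord (dworkPoly lam) 1} :=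
    IntermediateField.subset_adjoin _ _ (Or.inl rfl)
  have hy1 : coord (dworkPoly lam) 1 ∈ IntermediateField.adjoin L
      {coord (dworkPoly lam) 0, coord (dworkPoly lam) 1} :=
    IntermediateField.subset_adjoin _ _ (Or.inr rfl)
  obtain ⟨hfin, hrank⟩ := finrank_le_of_adjoin_pair (adjoin_eq_top_of_subset L
    (T := {coord (dworkPoly lam) 0, coord (dworkPoly lam) 1}) (adjoin_coord _) (by
      rintro w (rfl | rfl | rfl)
      · exact hx1
      · exact hy1
      · have : coord (dworkPoly lam) 2 = coord (dworkPoly lam) 0 * coord (dworkPoly lam) 1 *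
            coord (dworkPoly lam) 2 / (coord (dworkPoly lam) 0 * coord (dworkPoly lam) 1) := by
          field_simp
        rw [this]
        exact div_mem (mem_adjoin_of_mem hPM) (mul_mem hx1 hy1)))
    (monic_X_pow_sub_C _ (by norm_num)) (hroot hxM) (monic_X_pow_sub_C _ (by norm_num)) (hroot hyM)
  rw [natDegree_X_pow_sub_C, natDegree_X_pow_sub_C] at hrank
  exact (eq_fixedField_of_finrank_le (greenePlesserGroup lam) L hL 16 hrank s hs hcard).1

variable {lam} in
/-- The birational identification of the mirror quartic with the elliptic surface. -/
theorem exists_mirror_equiv {m t₁ t₂ : ℂ} (h : IsParam lam m t₁ t₂) :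
    ∃ e : EllipticSurfaceField t₁ t₂ ≃ₐ[ℂ] MirrorField lam,
      (e (uFun t₁ t₂) : DworkField lam) = dworkU lam ∧
      (e (xiFun m t₁ t₂) : DworkField lam) = dworkA lam ^ 2 ∧
      (e (etaFun m t₁ t₂) : DworkField lam) = dworkEta lam := by
  obtain ⟨F, h1, h2, h3⟩ := exists_ellipticSurface_dwork h
  obtain ⟨m1, m2, m3⟩ := dwork_mem_mirrorField lam
  have hF : F.fieldRange = MirrorField lam := by
    refine eq_mirrorField_of_mem lam _ (fieldRange_le_of_adjoin
      (adjoin_ellipticSurface h.ne_zero) ?_) ⟨_, h1⟩ ⟨_, h2⟩ ⟨_, h3⟩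
    rintro z (rfl | rfl | rfl)
    · rwa [h1]
    · rwa [h2]
    · rwa [h3]
  exact ⟨(AlgEquiv.ofInjectiveField F).trans (IntermediateField.equivOfEq hF), h1, h2, h3⟩

end Dwork

/-! ### Kummer coordinates -/

section KummerCoord

variable {K : Type*} [Field K] [Algebra ℂ K]

/-- The function `x + x⁻¹ + c`. -/
def sym (c : ℂ) (x : K) : K := x + x⁻¹ + algebraMap ℂ K c

/-- Coordinates on a Kummer surface of a product of elliptic curves, normalized such that
`d² = -(x + x⁻¹ - α) (z + z⁻¹ + κ α)`. -/
structure IsKummerCoord (κ α : ℂ) (x z d : K) : Prop where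
  ne_zero : κ ≠ 0
  rel : κ ^ 2 * (α ^ 2 - 4) = 4
  ne_zero₁ : x ≠ 0
  ne_zero₂ : z ≠ 0
  sym_ne_zero₁ : sym (-α) x ≠ 0
  sym_ne_zero₂ : sym (κ * α) z ≠ 0
  sq : d ^ 2 = -(sym (-α) x * sym (κ * α) z)

/-- The coordinate `a` of the model field, on the Kummer surface. -/
def kummerA (κ α : ℂ) (z d : K) : K := algebraMap ℂ K κ * d / sym (κ * α) z

/-- The coordinate `η` of the model field, on the Kummer surface. -/
def kummerH (κ α : ℂ) (x z d : K) : K :=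
  d / 2 * ((x - x⁻¹) / sym (-α) x - (z - z⁻¹) / sym (κ * α) z)

variable {κ α : ℂ} {x z d : K}

theorem IsKummerCoord.algebraMap_ne_zero (h : IsKummerCoord κ α x z d) :
    algebraMap ℂ K κ ≠ 0 := by
  rw [Ne, FaithfulSMul.algebraMap_eq_zero_iff]
  exact h.ne_zero

theorem IsKummerCoord.algebraMap_rel (h : IsKummerCoord κ α x z d) :
    algebraMap ℂ K κ ^ 2 * (algebraMap ℂ K α ^ 2 - 4) = 4 := by
  have := congrArg (algebraMap ℂ K) h.rel
  simpa only [map_mul, map_sub, map_pow, map_ofNat] using this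

theorem IsKummerCoord.d_ne_zero (h : IsKummerCoord κ α x z d) : d ≠ 0 := by
  have h1 := h.sq
  rintro rfl
  refine mul_ne_zero h.sym_ne_zero₁ h.sym_ne_zero₂ ?_
  linear_combination h1

theorem IsKummerCoord.kummerA_sq (h : IsKummerCoord κ α x z d) :
    kummerA κ α z d ^ 2 = -algebraMap ℂ K κ ^ 2 * sym (-α) x / sym (κ * α) z := by
  have h1 := h.sym_ne_zero₂
  rw [kummerA, div_pow, mul_pow, h.sq]
  field_simp

/-- With u = x/z, the relation a²g = -κ²f becomes (a² + κ²u)z² + κα(a² - κ)z + (a² + κ²u⁻¹) = 0. Its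
discriminant is 4κ²(a⁴ - ca² + 1): the normalization κ²(α² - 4) = 4 equalizes the outer
coefficients, and 8λ² = κα² fixes the middle one. The function `kummerH` is this square root divided
by 2κa; the proof squares it directly. -/
theorem IsKummerCoord.kummerH_sq (h : IsKummerCoord κ α x z d) {lam : ℂ}
    (hlam : 8 * lam ^ 2 = κ * α ^ 2) :
    kummerH κ α x z d ^ 2 = kummerA κ α z d ^ 2 + (kummerA κ α z d ^ 2)⁻¹ -
      middle lam (x / z) := by
  have hκ := h.algebraMap_ne_zero
  have hrel := h.algebraMap_rel
  have hx := h.ne_zero₁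
  have hz := h.ne_zero₂
  have hf := h.sym_ne_zero₁
  have hg := h.sym_ne_zero₂
  have := charZero_of_complex K
  have h4 : algebraMap ℂ K (4 * lam ^ 2) = algebraMap ℂ K κ * algebraMap ℂ K α ^ 2 / 2 := by
    rw [show 4 * lam ^ 2 = κ * α ^ 2 / 2 by linear_combination hlam / 2]
    simp only [map_mul, map_pow, map_div₀, map_ofNat]
  have e1 : (x - x⁻¹) ^ 2 = (sym (-α) x + algebraMap ℂ K α) ^ 2 - 4 := by
    rw [sym, map_neg]
    field_simp
    ring
  have e2 : (z - z⁻¹) ^ 2 = (sym (κ * α) z - algebraMap ℂ K κ * algebraMap ℂ K α) ^ 2 - 4 := by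
    rw [sym, map_mul]
    field_simp
    ring
  -- The cross term is the only source of u + u⁻¹.
  have e3 : (x - x⁻¹) * (z - z⁻¹) = (sym (-α) x + algebraMap ℂ K α) *
      (sym (κ * α) z - algebraMap ℂ K κ * algebraMap ℂ K α) - 2 * (x / z + (x / z)⁻¹) := by
    rw [sym, sym, map_mul, map_neg]
    field_simp
    ring
  rw [h.kummerA_sq, kummerH, middle, h4, mul_pow, div_pow, h.sq]
  generalize sym (-α) x = f at *
  generalize sym (κ * α) z = g at *
  generalize algebraMap ℂ K κ = k at *
  generalize algebraMap ℂ K α = b at *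
  generalize x / z + (x / z)⁻¹ = v at *
  generalize x - x⁻¹ = p at *
  generalize z - z⁻¹ = q at *
  have e4 : -(f * g) / 2 ^ 2 * (p / f - q / g) ^ 2 = -(g * p ^ 2 / f + f * q ^ 2 / g) / 4 +
      p * q / 2 := by
    field_simp
    ring
  -- The two sides differ by a multiple of the normalization k²(b² - 4) - 4, which vanishes.
  have e5 : -(g * ((f + b) ^ 2 - 4) / f + f * ((g - k * b) ^ 2 - 4) / g) / 4 +
      ((f + b) * (g - k * b) - 2 * v) / 2 - (-k ^ 2 * f / g + (-k ^ 2 * f / g)⁻¹ -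
      (v + k * b ^ 2 / 2)) = -(g / (4 * k ^ 2 * f) + f / (4 * g)) *
      (k ^ 2 * (b ^ 2 - 4) - 4) := by
    field_simp
    ring
  rw [e4, e1, e2, e3, ← sub_eq_zero, e5, hrel, sub_self, mul_zero]

/-- This is the quadratic formula for z, with -2κaη as the chosen root of the discriminant. It makes
z rational in u, a and η. -/
theorem IsKummerCoord.two_mul_eq (h : IsKummerCoord κ α x z d) :
    2 * (kummerA κ α z d ^ 2 + algebraMap ℂ K κ ^ 2 * (x / z)) * z =
      -(algebraMap ℂ K κ * algebraMap ℂ K α * (kummerA κ α z d ^ 2 - algebraMap ℂ K κ)) -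
        2 * algebraMap ℂ K κ * (kummerA κ α z d * kummerH κ α x z d) := by
  have hκ := h.algebraMap_ne_zero
  have hx := h.ne_zero₁
  have hz := h.ne_zero₂
  have hf := h.sym_ne_zero₁
  have hg := h.sym_ne_zero₂
  have := charZero_of_complex K
  have e : kummerA κ α z d * kummerH κ α x z d = algebraMap ℂ K κ / 2 *
      (-(x - x⁻¹) + sym (-α) x / sym (κ * α) z * (z - z⁻¹)) := by
    rw [kummerA, kummerH]
    field_simp
    rw [h.sq]
    field_simp
    ring
  have e1 : sym (-α) x = x + x⁻¹ - algebraMap ℂ K α := by rw [sym, map_neg, sub_eq_add_neg]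
  have e2 : sym (κ * α) z = z + z⁻¹ + algebraMap ℂ K κ * algebraMap ℂ K α := by rw [sym, map_mul]
  have e3 : sym (-α) x / sym (κ * α) z * sym (κ * α) z = sym (-α) x := div_mul_cancel₀ _ hg
  have e4 : x / z * z = x := div_mul_cancel₀ _ hz
  rw [e, h.kummerA_sq, mul_div_assoc]
  generalize sym (-α) x / sym (κ * α) z = w at *
  rw [e1, e2] at e3
  linear_combination (2 * algebraMap ℂ K κ ^ 2) * e4 - algebraMap ℂ K κ ^ 2 * e3

/-- The two-form of the Kummer surface in the coordinates of the model field. -/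
theorem IsKummerCoord.ratForm_eq (h : IsKummerCoord κ α x z d) (hH : kummerH κ α x z d ≠ 0) :
    ratForm (x / z * kummerA κ α z d * kummerH κ α x z d) (x / z) (kummerA κ α z d) =
      ratForm (x * z * d) x z := by
  have hκ := h.algebraMap_ne_zero
  have hx := h.ne_zero₁
  have hz := h.ne_zero₂
  have hf := h.sym_ne_zero₁
  have hg := h.sym_ne_zero₂
  have hd := h.d_ne_zero
  have := charZero_of_complex K
  have ha : kummerA κ α z d ≠ 0 := div_ne_zero (mul_ne_zero hκ hd) hg
  have hsq := h.kummerA_sq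
  have hDs (c : ℂ) (y : K) : KaehlerDifferential.D ℂ K (sym c y) =
      (1 - (y ^ 2)⁻¹) • KaehlerDifferential.D ℂ K y := by
    rw [sym, map_add, map_add, Derivation.map_algebraMap, D_inv]
    module
  -- The formula comes from differentiating a² = -κ²f/g and dividing by 2a.
  have hDa : KaehlerDifferential.D ℂ K (kummerA κ α z d) =
      (-algebraMap ℂ K κ ^ 2 * (1 - (x ^ 2)⁻¹) / sym (κ * α) z / (2 * kummerA κ α z d)) •
        KaehlerDifferential.D ℂ K x +
      (algebraMap ℂ K κ ^ 2 * sym (-α) x * (1 - (z ^ 2)⁻¹) / sym (κ * α) z ^ 2 /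
        (2 * kummerA κ α z d)) • KaehlerDifferential.D ℂ K z := by
    have h1 := congrArg (KaehlerDifferential.D ℂ K) hsq
    rw [Derivation.leibniz_pow, ← map_pow, ← map_neg, div_eq_mul_inv, mul_assoc, D_const_mul,
      Derivation.leibniz, D_inv, hDs, hDs] at h1
    have h2 : (2 * kummerA κ α z d) • KaehlerDifferential.D ℂ K (kummerA κ α z d) =
      (-algebraMap ℂ K κ ^ 2 * (1 - (x ^ 2)⁻¹) / sym (κ * α) z) •
        KaehlerDifferential.D ℂ K x +
      (algebraMap ℂ K κ ^ 2 * sym (-α) x * (1 - (z ^ 2)⁻¹) / sym (κ * α) z ^ 2) •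
        KaehlerDifferential.D ℂ K z := by
      rw [mul_smul, ofNat_smul_eq_nsmul]
      refine (Eq.trans ?_ h1).trans ?_
      · simp
      · rw [map_neg, map_pow]
        module
    rw [← inv_smul_smul₀ (mul_ne_zero two_ne_zero ha) (KaehlerDifferential.D ℂ K (kummerA κ α z d)),
      h2]
    module
  have hDu : KaehlerDifferential.D ℂ K (x / z) = z⁻¹ • KaehlerDifferential.D ℂ K x +
      (-(x * (z ^ 2)⁻¹)) • KaehlerDifferential.D ℂ K z := by
    rw [div_eq_mul_inv, Derivation.leibniz, D_inv]
    module
  refine KummerSandwich.ratForm_eq (dWedge_eq_of_D_eq hDu hDa) ?_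
  -- The Jacobian of (u, a) in (x, z) is aη/(z²d); division by uaη leaves 1/(xzd).
  have e : z⁻¹ * (algebraMap ℂ K κ ^ 2 * sym (-α) x * (1 - (z ^ 2)⁻¹) / sym (κ * α) z ^ 2 /
        (2 * kummerA κ α z d)) - -(x * (z ^ 2)⁻¹) *
      (-algebraMap ℂ K κ ^ 2 * (1 - (x ^ 2)⁻¹) / sym (κ * α) z / (2 * kummerA κ α z d)) =
      kummerA κ α z d ^ 2 * kummerH κ α x z d / (kummerA κ α z d * z ^ 2 * d) := by
    rw [hsq]
    generalize kummerA κ α z d = a at *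
    rw [kummerH]
    generalize sym (κ * α) z = g at *
    field_simp
    ring
  rw [e]
  field_simp

end KummerCoord

/-! ### The function field of a product of two elliptic curves -/

section ProductField

variable (E E' : WeierstrassCurve ℂ)

theorem trdeg_productField : Algebra.trdeg ℂ (ProductField E E') = 2 := by
  rw [trdeg_fractionRing, trdeg_complex_coordinateRing, trdeg_coordinateRing, one_add_one_eq_two]

/-- The function `x` of the first factor. -/
def prodX₁ : ProductField E E' := baseFun (overCurve E E')
  (WeierstrassCurve.Affine.CoordinateRing.mk E.toAffine (C X))

/-- The function `y` of the first factor. -/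
def prodY₁ : ProductField E E' := baseFun (overCurve E E')
  (WeierstrassCurve.Affine.CoordinateRing.mk E.toAffine X)

/-- The function `x` of the second factor. -/
def prodX₂ : ProductField E E' := xFun (overCurve E E')

/-- The function `y` of the second factor. -/
def prodY₂ : ProductField E E' := yFun (overCurve E E')

theorem adjoin_productField :
    IntermediateField.adjoin ℂ {prodX₁ E E', prodY₁ E E', prodX₂ E E', prodY₂ E E'} = ⊤ := by
  have h := adjoin_functionField (overCurve E E')
    (T := {WeierstrassCurve.Affine.CoordinateRing.mk E.toAffine (C X),
        WeierstrassCurve.Affine.CoordinateRing.mk E.toAffine X}) (by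
      have := adjoin_coordinateRing E (T := ∅) (by
        rw [Algebra.adjoin_empty]
        exact Subsingleton.elim _ _)
      simpa using this)
  rw [Set.image_pair, Set.insert_union, Set.singleton_union] at h
  exact h

theorem baseFun_algebraMap (c : ℂ) :
    baseFun (overCurve E E') (algebraMap ℂ _ c) = algebraMap ℂ (ProductField E E') c := by
  rw [baseFun, ← IsScalarTower.algebraMap_apply ℂ, ← IsScalarTower.algebraMap_apply ℂ]

theorem prodY₁_ne_zero : prodY₁ E E' ≠ 0 := by
  rw [prodY₁, baseFun, Ne, FaithfulSMul.algebraMap_eq_zero_iff, FaithfulSMul.algebraMap_eq_zero_iff]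
  intro h
  refine yFun_ne_zero E ?_
  rw [yFun, h, map_zero]

theorem prodY₂_ne_zero : prodY₂ E E' ≠ 0 := yFun_ne_zero _

theorem prod_equation₁ : prodY₁ E E' ^ 2 + algebraMap ℂ _ E.a₁ * prodX₁ E E' * prodY₁ E E' +
    algebraMap ℂ _ E.a₃ * prodY₁ E E' = prodX₁ E E' ^ 3 + algebraMap ℂ _ E.a₂ * prodX₁ E E' ^ 2 +
      algebraMap ℂ _ E.a₄ * prodX₁ E E' + algebraMap ℂ _ E.a₆ := by
  have h : WeierstrassCurve.Affine.CoordinateRing.mk E.toAffine E.toAffine.polynomial = 0 :=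
    AdjoinRoot.mk_self
  have hb (r : ℂ) : WeierstrassCurve.Affine.CoordinateRing.mk E.toAffine (C (C r)) =
    algebraMap ℂ E.toAffine.CoordinateRing r := rfl
  have h2 := congrArg (fun z => algebraMap (ProductRing E E') (ProductField E E')
    (algebraMap _ (ProductRing E E') z)) h
  simp only [WeierstrassCurve.Affine.polynomial, map_add, map_sub, map_mul,
    map_pow, map_zero, hb] at h2
  simp only [← baseFun_algebraMap, prodX₁, prodY₁, baseFun]
  linear_combination h2

theorem prod_equation₂ : prodY₂ E E' ^ 2 + algebraMap ℂ _ E'.a₁ * prodX₂ E E' * prodY₂ E E' +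
    algebraMap ℂ _ E'.a₃ * prodY₂ E E' = prodX₂ E E' ^ 3 + algebraMap ℂ _ E'.a₂ * prodX₂ E E' ^ 2 +
      algebraMap ℂ _ E'.a₄ * prodX₂ E E' + algebraMap ℂ _ E'.a₆ := by
  simp only [← baseFun_algebraMap]
  exact functionField_equation (overCurve E E')

variable {E E'}

theorem productNeg_prodY₁ (h₁ : E.a₁ = 0) (h₃ : E.a₃ = 0) :
    productNeg E E' (prodY₁ E E') = -prodY₁ E E' := by
  have hneg : E.toAffine.negPolynomial = -X := by
    simp [WeierstrassCurve.Affine.negPolynomial, h₁, h₃]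
  rw [prodY₁, baseFun, productNeg_algebraMap, ← map_neg, ← map_neg]
  congr 1
  change productNegHom E E' (WeierstrassCurve.Affine.CoordinateRing.mk
    (overCurve E E').toAffine (C (C _))) = WeierstrassCurve.Affine.CoordinateRing.mk
    (overCurve E E').toAffine (C (C _))
  rw [productNegHom_mk_C, Polynomial.map_C, RingHom.coe_coe, negHom_mk_X, hneg, map_neg]

theorem coe_kummerEta (h₁ : E.a₁ = 0) (h₃ : E.a₃ = 0) (h₁' : E'.a₁ = 0) (h₃' : E'.a₃ = 0) :
    (kummerEta E E' : ProductField E E') = 4 * prodY₁ E E' * prodY₂ E E' := by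
  have hneg : E.toAffine.negPolynomial = -X := by
    simp [WeierstrassCurve.Affine.negPolynomial, h₁, h₃]
  have hneg' : (overCurve E E').toAffine.negPolynomial = -X := by
    simp [WeierstrassCurve.Affine.negPolynomial, h₁', h₃']
  simp only [kummerEta, hneg, hneg', sub_neg_eq_add, map_mul, map_add]
  rw [prodY₁, prodY₂, yFun, baseFun]
  ring

theorem relAlgClosure_productField {S : Set (ProductField E E')} (h₁ : E.a₁ = 0) (h₃ : E.a₃ = 0)
    (h₁' : E'.a₁ = 0) (h₃' : E'.a₃ = 0) (h : prodX₁ E E' ∈ relAlgClosure S)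
    (h' : prodX₂ E E' ∈ relAlgClosure S) : relAlgClosure S = ⊤ := by
  have e₁ := prod_equation₁ E E'
  have e₂ := prod_equation₂ E E'
  rw [h₁, h₃, map_zero, zero_mul, zero_mul, add_zero, add_zero] at e₁
  rw [h₁', h₃', map_zero, zero_mul, zero_mul, add_zero, add_zero] at e₂
  have hc (c : ℂ) : algebraMap ℂ (ProductField E E') c ∈ relAlgClosure S :=
    IntermediateField.algebraMap_mem _ _
  refine relAlgClosure_eq_top (adjoin_productField E E') ?_
  rintro z (rfl | rfl | rfl | rfl)
  · exact h
  · refine mem_relAlgClosure_of_pow 2 two_pos ?_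
    rw [e₁]
    exact add_mem (add_mem (add_mem (pow_mem h 3) (mul_mem (hc _) (pow_mem h 2)))
      (mul_mem (hc _) h)) (hc _)
  · exact h'
  · refine mem_relAlgClosure_of_pow 2 two_pos ?_
    rw [e₂]
    exact add_mem (add_mem (add_mem (pow_mem h' 3) (mul_mem (hc _) (pow_mem h' 2)))
      (mul_mem (hc _) h')) (hc _)

/-- The field of a Kummer surface is generated by `x₁`, `x₂` and `y₁y₂`. -/
theorem eq_kummerField_of_mem (h₁ : E.a₁ = 0) (h₃ : E.a₃ = 0)
    (L : IntermediateField ℂ (ProductField E E')) (hL : L ≤ KummerField E E')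
    (hx : prodX₁ E E' ∈ L) (hx' : prodX₂ E E' ∈ L) (hy : prodY₁ E E' * prodY₂ E E' ∈ L) :
    L = KummerField E E' := by
  classical
  have := charZero_of_complex (ProductField E E')
  have e₁ := prod_equation₁ E E'
  rw [h₁, h₃, map_zero, zero_mul, zero_mul, add_zero, add_zero] at e₁
  have hc (c : ℂ) : algebraMap ℂ (ProductField E E') c ∈ L := L.algebraMap_mem _
  have hy2 : prodY₁ E E' ^ 2 ∈ L := by
    rw [e₁]
    exact add_mem (add_mem (add_mem (pow_mem hx 3) (mul_mem (hc _) (pow_mem hx 2)))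
      (mul_mem (hc _) hx)) (hc _)
  have hy0 := prodY₁_ne_zero E E'
  have hp : (X ^ 2 - C (⟨_, hy2⟩ : L)).natDegree = 2 := natDegree_X_pow_sub_C
  have hyM : prodY₁ E E' ∈ IntermediateField.adjoin L {prodY₁ E E'} :=
    IntermediateField.mem_adjoin_simple_self _ _
  refine (eq_fixedField_of_simple _ L hL (adjoin_productField E E') (prodY₁ E E') ?_
    (p := X ^ 2 - C (⟨_, hy2⟩ : L)) (monic_X_pow_sub_C _ two_ne_zero) ?_ {1, productNeg E E'}
    ?_ ?_).1
  · rintro z (rfl | rfl | rfl | rfl)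
    · exact mem_adjoin_of_mem hx
    · exact hyM
    · exact mem_adjoin_of_mem hx'
    · rw [eq_div_of_mul_eq hy0 (mul_comm (prodY₂ E E') _)]
      exact div_mem (mem_adjoin_of_mem hy) hyM
  · rw [map_sub, map_pow, aeval_X, aeval_C]
    exact sub_self _
  · intro σ hσ
    rcases Finset.mem_insert.1 hσ with rfl | hσ
    · exact one_mem _
    · rw [Finset.mem_singleton.1 hσ]
      exact Subgroup.mem_zpowers _
  · rw [hp, Finset.card_pair]
    intro h
    have hn := productNeg_prodY₁ (E' := E') h₁ h₃
    rw [← h, AlgEquiv.one_apply] at hn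
    exact self_ne_neg.2 hy0 hn

end ProductField

/-! ### The Kummer surface and the model field -/

section KummerCoordField

variable {κ α : ℂ}

theorem map_sym {F K : Type*} [Field F] [Field K] [Algebra ℂ F] [Algebra ℂ K] (f : F →ₐ[ℂ] K)
    (c : ℂ) (x : F) : f (sym c x) = sym c (f x) := by
  simp only [sym, map_add, map_inv₀, AlgHom.commutes]

theorem map_kummerA {F K : Type*} [Field F] [Field K] [Algebra ℂ F] [Algebra ℂ K] (f : F →ₐ[ℂ] K)
    (z d : F) : f (kummerA κ α z d) = kummerA κ α (f z) (f d) := by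
  simp only [kummerA, map_div₀, map_mul, AlgHom.commutes, map_sym]

theorem map_kummerH {F K : Type*} [Field F] [Field K] [Algebra ℂ F] [Algebra ℂ K] (f : F →ₐ[ℂ] K)
    (x z d : F) : f (kummerH κ α x z d) = kummerH κ α (f x) (f z) (f d) := by
  simp only [kummerH, map_div₀, map_mul, map_sub, map_inv₀, map_ofNat, map_sym]

/-- The relations are verified in ℂ(E × E') and descend to the Kummer field by injectivity. -/
theorem IsKummerCoord.of_map {F K : Type*} [Field F] [Field K] [Algebra ℂ F] [Algebra ℂ K]
    (f : F →ₐ[ℂ] K) {x z d : F} (h : IsKummerCoord κ α (f x) (f z) (f d)) :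
    IsKummerCoord κ α x z d where
  ne_zero := h.ne_zero
  rel := h.rel
  ne_zero₁ := (map_ne_zero f).1 h.ne_zero₁
  ne_zero₂ := (map_ne_zero f).1 h.ne_zero₂
  sym_ne_zero₁ := (map_ne_zero f).1 (map_sym f _ x ▸ h.sym_ne_zero₁)
  sym_ne_zero₂ := (map_ne_zero f).1 (map_sym f _ z ▸ h.sym_ne_zero₂)
  sq := f.injective (by
    change f (d ^ 2) = f _
    rw [map_pow, map_neg, map_mul, map_sym, map_sym, h.sq])

variable {K : Type} [Field K] [Algebra ℂ K] {x z d : K}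

/-- Vanishing of the leading coefficient means zf = xg. There the terms xz cancel, and (1 - αx)z² =
καx²z + x² makes z algebraic over ℂ(x), against transcendence degree two. -/
theorem IsKummerCoord.add_ne_zero (h : IsKummerCoord κ α x z d) (hK : Algebra.trdeg ℂ K = 2)
    (hS : ∀ S : Set K, x ∈ relAlgClosure S → z ∈ relAlgClosure S → relAlgClosure S = ⊤) :
    kummerA κ α z d ^ 2 + algebraMap ℂ K κ ^ 2 * (x / z) ≠ 0 := by
  intro h0
  have hκ := h.algebraMap_ne_zero
  have hx := h.ne_zero₁
  have hz := h.ne_zero₂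
  have hg := h.sym_ne_zero₂
  have hx' : Transcendental ℂ x := (transcendental_of_relAlgClosure hK (hS {x, z}
    (subset_relAlgClosure _ (Or.inl rfl)) (subset_relAlgClosure _ (Or.inr rfl)))).1
  have h1 : 1 - algebraMap ℂ K α * x ≠ 0 := by
    intro h1
    refine hx' ?_
    have : x = algebraMap ℂ K α⁻¹ := by
      rw [map_inv₀]
      exact eq_inv_of_mul_eq_one_right (sub_eq_zero.1 h1).symm
    rw [this]
    exact isAlgebraic_algebraMap _
  have h2 : z * sym (-α) x = x * sym (κ * α) z := by
    rw [h.kummerA_sq] at h0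
    generalize sym (κ * α) z = g at *
    have h3 : algebraMap ℂ K κ ^ 2 * (z * sym (-α) x - x * g) = 0 := by
      field_simp at h0
      linear_combination -h0
    exact sub_eq_zero.1 ((mul_eq_zero.1 h3).resolve_left (pow_ne_zero 2 hκ))
  have h3 : z ^ 2 + -(algebraMap ℂ K κ * algebraMap ℂ K α * x ^ 2 / (1 - algebraMap ℂ K α * x)) *
      z + -(x ^ 2 / (1 - algebraMap ℂ K α * x)) = 0 := by
    rw [sym, sym, map_neg, map_mul] at h2
    have h4 : z ^ 2 * (1 - algebraMap ℂ K α * x) =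
        algebraMap ℂ K κ * algebraMap ℂ K α * x ^ 2 * z + x ^ 2 := by
      field_simp at h2
      linear_combination h2
    rw [eq_div_of_mul_eq h1 h4]
    ring
  have hxM : x ∈ relAlgClosure {0, x} := subset_relAlgClosure _ (Or.inr rfl)
  have hc (c : ℂ) : algebraMap ℂ K c ∈ relAlgClosure {0, x} := IntermediateField.algebraMap_mem _ _
  have hd := sub_mem (one_mem (relAlgClosure {0, x})) (mul_mem (hc α) hxM)
  have h4 := mem_relAlgClosure_of_quadratic (neg_mem (div_mem (mul_mem (mul_mem (hc κ) (hc α))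
    (pow_mem hxM 2)) hd)) (neg_mem (div_mem (pow_mem hxM 2) hd)) h3
  -- The field would be algebraic over ℂ(0, x), making 0 transcendental.
  exact (transcendental_of_relAlgClosure hK (hS _ hxM h4)).1.ne_zero_of_complex rfl

theorem IsKummerCoord.mem_of_mem (h : IsKummerCoord κ α x z d)
    (h0 : kummerA κ α z d ^ 2 + algebraMap ℂ K κ ^ 2 * (x / z) ≠ 0) {M : IntermediateField ℂ K}
    (hu : x / z ∈ M) (ha : kummerA κ α z d ∈ M) (hη : kummerH κ α x z d ∈ M) :
    x ∈ M ∧ z ∈ M ∧ d ∈ M := by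
  have := charZero_of_complex K
  have hκ := h.algebraMap_ne_zero
  have hz0 := h.ne_zero₂
  have hg := h.sym_ne_zero₂
  have hc (c : ℂ) : algebraMap ℂ K c ∈ M := M.algebraMap_mem c
  have hz : z ∈ M := by
    rw [eq_div_of_mul_eq (mul_ne_zero two_ne_zero h0) ((mul_comm _ _).trans h.two_mul_eq)]
    refine div_mem (sub_mem (neg_mem (mul_mem (mul_mem (hc _) (hc _)) (sub_mem (pow_mem ha 2)
      (hc _)))) (mul_mem (mul_mem (ofNat_mem _ 2) (hc _)) (mul_mem ha hη))) (mul_mem (ofNat_mem _ 2)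
      (add_mem (pow_mem ha 2) (mul_mem (pow_mem (hc _) 2) hu)))
  refine ⟨?_, hz, ?_⟩
  · rw [← div_mul_cancel₀ x hz0]
    exact mul_mem hu hz
  · have : d = kummerA κ α z d * sym (κ * α) z / algebraMap ℂ K κ := by
      rw [kummerA]
      field_simp
    rw [this]
    exact div_mem (mul_mem ha (add_mem (add_mem hz (inv_mem hz)) (hc _))) (hc _)

end KummerCoordField

/-! ### The Kummer surface of the two isogenous curves as the model field. -/

section KummerEquiv

/-- Put p = (1 - r²)/4, x = x₁/r and z = x₂/p. The square roots r² and p² of the ends of the two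
cubics give y₁² = r x₁² f and y₂² = p x₂² g. The choice q² = -rp, so q⁶ = -(rp)³, normalizes
y₁y₂/(q³xz) to have square -fg. -/
theorem isKummerCoord_of_equation {K : Type*} [Field K] [Algebra ℂ K] {r q : ℂ} (h0 : r ≠ 0)
    (h1 : 1 - r ^ 2 ≠ 0) (hq : q ^ 2 = -(r * ((1 - r ^ 2) / 4))) {x₁ y₁ x₂ y₂ : K} (hy₁ : y₁ ≠ 0)
    (hy₂ : y₂ ≠ 0)
    (e₁ : y₁ ^ 2 = x₁ ^ 3 + algebraMap ℂ K (-(1 + r ^ 2)) * x₁ ^ 2 + algebraMap ℂ K (r ^ 2) * x₁)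
    (e₂ : y₂ ^ 2 = x₂ ^ 3 + algebraMap ℂ K ((1 + r ^ 2) / 2) * x₂ ^ 2 +
      algebraMap ℂ K ((1 - r ^ 2) ^ 2 / 16) * x₂) :
    IsKummerCoord (2 * r / (1 - r ^ 2)) (r + r⁻¹) (x₁ / algebraMap ℂ K r)
      (x₂ / algebraMap ℂ K ((1 - r ^ 2) / 4)) (4 * y₁ * y₂ / (algebraMap ℂ K (4 * q ^ 3) *
        (x₁ / algebraMap ℂ K r) * (x₂ / algebraMap ℂ K ((1 - r ^ 2) / 4)))) := by
  have := charZero_of_complex K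
  have hx₁ : x₁ ≠ 0 := by
    rintro rfl
    refine pow_ne_zero 2 hy₁ ?_
    rw [e₁]
    ring
  have hx₂ : x₂ ≠ 0 := by
    rintro rfl
    refine pow_ne_zero 2 hy₂ ?_
    rw [e₂]
    ring
  have hr : algebraMap ℂ K r ≠ 0 := by rwa [Ne, FaithfulSMul.algebraMap_eq_zero_iff]
  have hp0 : (1 - r ^ 2) / 4 ≠ 0 := div_ne_zero h1 (by norm_num)
  have hp : algebraMap ℂ K ((1 - r ^ 2) / 4) ≠ 0 := by
    rwa [Ne, FaithfulSMul.algebraMap_eq_zero_iff]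
  have hq0 : q ≠ 0 := by
    rintro rfl
    refine mul_ne_zero h0 hp0 ?_
    linear_combination hq
  have hq' : algebraMap ℂ K q ≠ 0 := by rwa [Ne, FaithfulSMul.algebraMap_eq_zero_iff]
  have f₁ : y₁ ^ 2 = algebraMap ℂ K r * x₁ ^ 2 * sym (-(r + r⁻¹)) (x₁ / algebraMap ℂ K r) := by
    rw [e₁, sym]
    simp only [map_neg, map_add, map_one, map_pow, map_inv₀]
    field_simp
    ring
  have f₂ : y₂ ^ 2 = algebraMap ℂ K ((1 - r ^ 2) / 4) * x₂ ^ 2 *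
      sym (2 * r / (1 - r ^ 2) * (r + r⁻¹)) (x₂ / algebraMap ℂ K ((1 - r ^ 2) / 4)) := by
    have c1 : (1 + r ^ 2) / 2 = (1 - r ^ 2) / 4 * (2 * r / (1 - r ^ 2) * (r + r⁻¹)) := by
      field_simp
      ring
    have c2 : (1 - r ^ 2) ^ 2 / 16 = ((1 - r ^ 2) / 4) ^ 2 := by ring
    rw [e₂, sym, c1, c2, map_mul _ ((1 - r ^ 2) / 4), map_pow]
    generalize algebraMap ℂ K ((1 - r ^ 2) / 4) = p at *
    field_simp
    ring
  refine ⟨div_ne_zero (mul_ne_zero two_ne_zero h0) h1, ?_, div_ne_zero hx₁ hr,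
    div_ne_zero hx₂ hp, fun h => ?_, fun h => ?_, ?_⟩
  · field_simp
    ring
  · rw [h, mul_zero] at f₁
    exact pow_ne_zero 2 hy₁ f₁
  · rw [h, mul_zero] at f₂
    exact pow_ne_zero 2 hy₂ f₂
  · have hq2 : algebraMap ℂ K q ^ 2 = -(algebraMap ℂ K r * algebraMap ℂ K ((1 - r ^ 2) / 4)) := by
      rw [← map_pow, hq, map_neg, map_mul]
    have hq6 : algebraMap ℂ K q ^ 6 =
        -(algebraMap ℂ K r * algebraMap ℂ K ((1 - r ^ 2) / 4)) ^ 3 := by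
      rw [show 6 = 2 * 3 from rfl, pow_mul, hq2]
      ring
    simp only [div_pow, mul_pow, f₁, f₂, map_mul, map_pow, map_ofNat, ← pow_mul]
    rw [hq6]
    generalize algebraMap ℂ K ((1 - r ^ 2) / 4) = p at *
    generalize sym (-(r + r⁻¹)) (x₁ / algebraMap ℂ K r) = f at *
    generalize sym (2 * r / (1 - r ^ 2) * (r + r⁻¹)) (x₂ / p) = g at *
    field_simp

theorem ratForm_mul_congr {K : Type*} [Field K] [Algebra ℂ K] {b b' u a u' a' : K}
    (h : ratForm b u a = ratForm b' u' a') (c : K) :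
    ratForm (c * b) u a = ratForm (c * b') u' a' := by
  have h1 (b u a : K) : ratForm (c * b) u a = c⁻¹ • ratForm b u a := by
    rw [ratForm, ratForm, smul_smul, mul_inv]
  rw [h1, h1, h]

theorem ratForm_scale {K : Type*} [Field K] [Algebra ℂ K] {r p : ℂ} (hr : r ≠ 0) (hp : p ≠ 0)
    (b x z : K) : ratForm (algebraMap ℂ K (r * p) * b) x z =
      ratForm (algebraMap ℂ K ((r * p) ^ 2) * b) (algebraMap ℂ K r * x) (algebraMap ℂ K p * z) := by
  have hr' : algebraMap ℂ K r ≠ 0 := by rwa [Ne, FaithfulSMul.algebraMap_eq_zero_iff]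
  have hp' : algebraMap ℂ K p ≠ 0 := by rwa [Ne, FaithfulSMul.algebraMap_eq_zero_iff]
  symm
  refine ratForm_eq (dWedge_eq_of_D_eq (p := algebraMap ℂ K r) (q := 0) (r := 0)
    (s := algebraMap ℂ K p) ?_ ?_) ?_
  · rw [D_const_mul, zero_smul, add_zero]
  · rw [D_const_mul, zero_smul, zero_add]
  · simp only [map_mul, map_pow, mul_inv]
    field_simp
    simp

theorem IsKummerCoord.exists_ratForm_eq {K : Type*} [Field K] [Algebra ℂ K] {κ α r p q : ℂ}
    {x₁ x₂ e : K} (hr : r ≠ 0) (hp : p ≠ 0) (hq : q ≠ 0)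
    (h : IsKummerCoord κ α (x₁ / algebraMap ℂ K r) (x₂ / algebraMap ℂ K p)
      (e / (algebraMap ℂ K q * (x₁ / algebraMap ℂ K r) * (x₂ / algebraMap ℂ K p)))) {u a η : K}
    (hu : u = x₁ / algebraMap ℂ K r / (x₂ / algebraMap ℂ K p))
    (ha : a = kummerA κ α (x₂ / algebraMap ℂ K p)
      (e / (algebraMap ℂ K q * (x₁ / algebraMap ℂ K r) * (x₂ / algebraMap ℂ K p))))
    (hη : η = kummerH κ α (x₁ / algebraMap ℂ K r) (x₂ / algebraMap ℂ K p)
      (e / (algebraMap ℂ K q * (x₁ / algebraMap ℂ K r) * (x₂ / algebraMap ℂ K p))))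
    (hη0 : η ≠ 0) : ∃ c : ℂ, ratForm e x₁ x₂ = ratForm (algebraMap ℂ K c * (u * a * η)) u a := by
  have hr' : algebraMap ℂ K r ≠ 0 := by rwa [Ne, FaithfulSMul.algebraMap_eq_zero_iff]
  have hp' : algebraMap ℂ K p ≠ 0 := by rwa [Ne, FaithfulSMul.algebraMap_eq_zero_iff]
  have hq' : algebraMap ℂ K q ≠ 0 := by rwa [Ne, FaithfulSMul.algebraMap_eq_zero_iff]
  have h1 := h.ratForm_eq (hη ▸ hη0)
  rw [← hu, ← ha, ← hη] at h1
  have hx := h.ne_zero₁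
  have hz := h.ne_zero₂
  have hx' : x₁ = algebraMap ℂ K r * (x₁ / algebraMap ℂ K r) := by field_simp
  have hz' : x₂ = algebraMap ℂ K p * (x₂ / algebraMap ℂ K p) := by field_simp
  have he : e = algebraMap ℂ K ((r * p) ^ 2) * (algebraMap ℂ K (q / (r * p) ^ 2) *
      (x₁ / algebraMap ℂ K r * (x₂ / algebraMap ℂ K p) *
      (e / (algebraMap ℂ K q * (x₁ / algebraMap ℂ K r) * (x₂ / algebraMap ℂ K p))))) := by
    simp only [map_div₀, map_mul, map_pow]
    generalize x₁ / algebraMap ℂ K r = x at *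
    generalize x₂ / algebraMap ℂ K p = z at *
    field_simp
  refine ⟨r * p * (q / (r * p) ^ 2), ?_⟩
  conv_lhs => rw [he, hx', hz', ← ratForm_scale hr hp, ← mul_assoc, ← map_mul, ← hx', ← hz']
  exact ratForm_mul_congr h1.symm _

/-- If η = 0, then u + u⁻¹ + 4λ² = a² + a⁻² and u is algebraic over ℂ(a). -/
theorem modelEta_ne_zero {lam : ℂ} : modelEta lam ≠ 0 := by
  intro h
  have h1 := modelEta_sq (lam := lam)
  have hu0 := modelU_ne_zero (lam := lam)
  rw [h] at h1
  have ha := subset_relAlgClosure {0, modelA lam} (Or.inr rfl)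
  have hu : modelU lam ∈ relAlgClosure {0, modelA lam} := by
    refine mem_relAlgClosure_of_quadratic (b := algebraMap ℂ _ (4 * lam ^ 2) -
      (modelA lam ^ 2 + (modelA lam ^ 2)⁻¹)) (c := 1) (sub_mem
      (IntermediateField.algebraMap_mem _ _) (add_mem (pow_mem ha 2) (inv_mem (pow_mem ha 2))))
      (one_mem _) ?_
    have h2 : modelA lam ^ 2 + (modelA lam ^ 2)⁻¹ = middle lam (modelU lam) := by
      linear_combination -h1
    rw [h2, middle]
    field_simp
    ring
  refine (transcendental_of_relAlgClosure trdeg_modelField (relAlgClosure_eq_top_of_subset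
    relAlgClosure_model (S := {0, modelA lam}) ?_)).1.ne_zero_of_complex rfl
  rintro z (rfl | rfl)
  exacts [hu, ha]

/-- The birational identification of the model with the Kummer surface, under which the holomorphic
two-form is a multiple of `du ∧ da / (u a η)`. -/
theorem exists_kummer_equiv {lam r : ℂ} (h0 : r ≠ 0) (h1 : 1 - r ^ 2 ≠ 0)
    (hlam : 4 * r * (1 - r ^ 2) * lam ^ 2 = (r ^ 2 + 1) ^ 2) :
    ∃ (ρ : ModelField lam ≃ₐ[ℂ] KummerField (legendre (r ^ 2)) (legendreDual (r ^ 2))) (c : ℂ),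
      kummerForm (legendre (r ^ 2)) (legendreDual (r ^ 2)) =
        ratForm (algebraMap ℂ _ c * (ρ (modelU lam) * ρ (modelA lam) * ρ (modelEta lam)))
          (ρ (modelU lam)) (ρ (modelA lam)) := by
  set E := legendre (r ^ 2) with hE
  set E' := legendreDual (r ^ 2) with hE'
  obtain ⟨q, hq⟩ := IsAlgClosed.exists_pow_nat_eq (-(r * ((1 - r ^ 2) / 4))) two_pos
  have hP := isKummerCoord_of_equation h0 h1 hq (prodY₁_ne_zero E E') (prodY₂_ne_zero E E')
    (by simpa [hE, legendre] using prod_equation₁ E E')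
    (by simpa [hE', legendreDual] using prod_equation₂ E E')
  have hρ₀ : (1 - r ^ 2) / 4 ≠ 0 := div_ne_zero h1 (by norm_num)
  have hlam' : 8 * lam ^ 2 = 2 * r / (1 - r ^ 2) * (r + r⁻¹) ^ 2 := by
    field_simp
    linear_combination 2 * hlam
  have hq0 : 4 * q ^ 3 ≠ 0 := by
    refine mul_ne_zero (by norm_num) (pow_ne_zero 3 ?_)
    rintro rfl
    refine mul_ne_zero h0 hρ₀ ?_
    linear_combination hq
  generalize 2 * r / (1 - r ^ 2) = κ at *
  generalize r + r⁻¹ = α at *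
  generalize (1 - r ^ 2) / 4 = ρ₀ at *
  generalize 4 * q ^ 3 = q₀ at *
  let x : KummerField E E' := kummerX₁ E E' / algebraMap ℂ _ r
  let z : KummerField E E' := kummerX₂ E E' / algebraMap ℂ _ ρ₀
  let d : KummerField E E' := kummerEta E E' / (algebraMap ℂ _ q₀ * x * z)
  have hη : (kummerEta E E' : ProductField E E') = 4 * prodY₁ E E' * prodY₂ E E' :=
    coe_kummerEta rfl rfl rfl rfl
  rw [← hη] at hP
  let v := (KummerField E E').val
  have hP' : IsKummerCoord κ α (v x) (v z) (v d) := hP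
  have hC := hP'.of_map
  have hK := trdeg_productField E E'
  have hr : algebraMap ℂ (ProductField E E') r ≠ 0 := by
    rwa [Ne, FaithfulSMul.algebraMap_eq_zero_iff]
  have hρ : algebraMap ℂ (ProductField E E') ρ₀ ≠ 0 := by
    rwa [Ne, FaithfulSMul.algebraMap_eq_zero_iff]
  have hq' : algebraMap ℂ (ProductField E E') q₀ ≠ 0 := by
    rwa [Ne, FaithfulSMul.algebraMap_eq_zero_iff]
  have := charZero_of_complex (ProductField E E')
  have hmem (M : IntermediateField ℂ (ProductField E E')) (hx : v x ∈ M) (hz : v z ∈ M) :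
      prodX₁ E E' ∈ M ∧ prodX₂ E E' ∈ M := by
    constructor
    · rw [← div_mul_cancel₀ (prodX₁ E E') hr]
      exact mul_mem hx (M.algebraMap_mem _)
    · rw [← div_mul_cancel₀ (prodX₂ E E') hρ]
      exact mul_mem hz (M.algebraMap_mem _)
  have hS (S : Set (ProductField E E')) (hx : v x ∈ relAlgClosure S) (hz : v z ∈ relAlgClosure S) :
      relAlgClosure S = ⊤ :=
    relAlgClosure_productField rfl rfl rfl rfl (hmem _ hx hz).1 (hmem _ hx hz).2
  have hadd := hP'.add_ne_zero hK hS
  have hsq := hP'.kummerH_sq hlam'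
  have hS2 : relAlgClosure {v x / v z, kummerA κ α (v z) (v d)} = ⊤ := by
    have hu := subset_relAlgClosure {v x / v z, kummerA κ α (v z) (v d)} (Or.inl rfl)
    have ha := subset_relAlgClosure {v x / v z, kummerA κ α (v z) (v d)} (Or.inr rfl)
    have hm := hP'.mem_of_mem hadd hu ha (eta_mem_relAlgClosure hsq hu ha)
    exact hS _ hm.1 hm.2.1
  obtain ⟨F, F1, F2, F3⟩ := exists_model_hom hK hS2 hsq
  -- The image lies in the Kummer field because u, a and η are even; it is everything because x, z
  -- and d, hence x₁, x₂ and y₁y₂, are rational in them.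
  have hF : F.fieldRange = KummerField E E' := by
    have hm := hP'.mem_of_mem (M := F.fieldRange) hadd ⟨_, F1⟩ ⟨_, F2⟩ ⟨_, F3⟩
    refine eq_kummerField_of_mem rfl rfl _ (fieldRange_le_of_adjoin adjoin_model ?_)
      (hmem _ hm.1 hm.2.1).1 (hmem _ hm.1 hm.2.1).2 ?_
    · rintro w (rfl | rfl | rfl)
      · rw [F1]
        exact (x / z).2
      · rw [F2, ← map_kummerA]
        exact (kummerA κ α z d).2
      · rw [F3, ← map_kummerH]
        exact (kummerH κ α x z d).2
    · have hd : prodY₁ E E' * prodY₂ E E' = v d * (algebraMap ℂ _ q₀ * v x * v z) / 4 := by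
        have h2 : v d * (algebraMap ℂ _ q₀ * v x * v z) = 4 * prodY₁ E E' * prodY₂ E E' :=
          (div_mul_cancel₀ _ (mul_ne_zero (mul_ne_zero hq' hP'.ne_zero₁) hP'.ne_zero₂)).trans hη
        rw [h2]
        ring
      rw [hd]
      exact div_mem (mul_mem hm.2.2 (mul_mem (mul_mem (IntermediateField.algebraMap_mem _ _) hm.1)
        hm.2.1)) (ofNat_mem _ 4)
  let ρ := (AlgEquiv.ofInjectiveField F).trans (IntermediateField.equivOfEq hF)
  have ρ1 : ρ (modelU lam) = x / z := Subtype.ext F1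
  have ρ2 : ρ (modelA lam) = kummerA κ α z d := Subtype.ext (F2.trans (map_kummerA v z d).symm)
  have ρ3 : ρ (modelEta lam) = kummerH κ α x z d :=
    Subtype.ext (F3.trans (map_kummerH v x z d).symm)
  exact ⟨ρ, hC.exists_ratForm_eq h0 hρ₀ hq0 ρ1 ρ2 ρ3 ((map_ne_zero ρ).2 modelEta_ne_zero)⟩

end KummerEquiv

/-! ### Legendre curves -/

section Legendre

theorem legendre_isElliptic {t : ℂ} (h0 : t ≠ 0) (h1 : t ≠ 1) : (legendre t).IsElliptic := by
  have h : (legendre t).Δ = 16 * t ^ 2 * (t - 1) ^ 2 := by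
    simp only [WeierstrassCurve.Δ, WeierstrassCurve.b₂, WeierstrassCurve.b₄, WeierstrassCurve.b₆,
      WeierstrassCurve.b₈, legendre]
    ring
  refine ⟨isUnit_iff_ne_zero.2 ?_⟩
  rw [h]
  exact mul_ne_zero (mul_ne_zero (by norm_num) (pow_ne_zero 2 h0))
    (pow_ne_zero 2 (sub_ne_zero.2 h1))

theorem legendreDual_isElliptic {t : ℂ} (h0 : t ≠ 0) (h1 : t ≠ 1) :
    (legendreDual t).IsElliptic := by
  have h : (legendreDual t).Δ = t * (t - 1) ^ 4 / 16 := by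
    simp only [WeierstrassCurve.Δ, WeierstrassCurve.b₂, WeierstrassCurve.b₄, WeierstrassCurve.b₆,
      WeierstrassCurve.b₈, legendreDual]
    ring
  refine ⟨isUnit_iff_ne_zero.2 ?_⟩
  rw [h]
  exact div_ne_zero (mul_ne_zero h0 (pow_ne_zero 4 (sub_ne_zero.2 h1))) (by norm_num)

/-- The nonzero two-torsion abscissas are -(1 ± r)²/4. Scaling x by -(1 - r)²/4, the square of i(1 -
r)/2, sends one of them to 1 and the other to ((1 + r)/(1 - r))². -/
theorem exists_smul_legendreDual {r : ℂ} (hr : 1 - r ≠ 0) :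
    ∃ D : WeierstrassCurve.VariableChange ℂ,
      D • legendreDual (r ^ 2) = legendre (((1 + r) / (1 - r)) ^ 2) := by
  have hI := Complex.I_ne_zero
  refine ⟨⟨Units.mk0 (Complex.I * (1 - r) / 2) (div_ne_zero (mul_ne_zero hI hr) two_ne_zero),
    0, 0, 0⟩, ?_⟩
  have h2 : (Complex.I * (1 - r) / 2)⁻¹ ^ 2 = -4 / (1 - r) ^ 2 := by
    rw [inv_pow, div_pow, mul_pow, Complex.I_sq]
    field_simp
    norm_num
  have h4 : (Complex.I * (1 - r) / 2)⁻¹ ^ 4 = (-4 / (1 - r) ^ 2) ^ 2 := by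
    rw [← h2, ← pow_mul]
  ext <;> simp [WeierstrassCurve.variableChange_def, legendre, legendreDual, -inv_div, -inv_pow,
    -mul_inv_rev, h2, h4, -map_pow, -map_mul] <;> field_simp <;> ring

variable (t : ℂ)

/-- The function field of the Legendre curve. -/
abbrev LegendreField : Type := (legendre t).toAffine.FunctionField

theorem trdeg_functionField_complex (W : WeierstrassCurve ℂ) :
    Algebra.trdeg ℂ W.toAffine.FunctionField = 1 := by
  rw [trdeg_functionField, trdeg_eq_zero, zero_add]

theorem baseFun_complex (W : WeierstrassCurve ℂ) (c : ℂ) :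
    baseFun W c = algebraMap ℂ _ c := by
  rw [baseFun, ← IsScalarTower.algebraMap_apply]

theorem adjoin_functionField_complex (W : WeierstrassCurve ℂ) :
    IntermediateField.adjoin ℂ {xFun W, yFun W} = ⊤ := by
  have h := adjoin_functionField W (T := ∅) (by
    rw [Algebra.adjoin_empty]
    exact Subsingleton.elim _ _)
  rwa [Set.image_empty, Set.empty_union] at h

theorem legendre_equation : yFun (legendre t) ^ 2 = xFun (legendre t) ^ 3 -
    (1 + algebraMap ℂ _ t) * xFun (legendre t) ^ 2 + algebraMap ℂ _ t * xFun (legendre t) := by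
  have h := functionField_equation (legendre t)
  have h₁ : (legendre t).a₁ = 0 := rfl
  have h₂ : (legendre t).a₂ = -(1 + t) := rfl
  have h₃ : (legendre t).a₃ = 0 := rfl
  have h₄ : (legendre t).a₄ = t := rfl
  have h₆ : (legendre t).a₆ = 0 := rfl
  simp only [baseFun_complex, h₁, h₂, h₃, h₄, h₆, map_zero, map_neg, map_add, map_one] at h
  linear_combination h

theorem xFun_legendre_ne_zero : xFun (legendre t) ≠ 0 := by
  intro h
  have h1 := legendre_equation t
  rw [h] at h1
  refine pow_ne_zero 2 (yFun_ne_zero (legendre t)) ?_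
  rw [h1]
  ring

/-- The quotient of the Legendre curve by the two-torsion point `(0, 0)`. -/
theorem exists_legendre_isogeny {t : ℂ} (ht : t ≠ 0) :
    ∃ g : (legendreDual t).toAffine.FunctionField →ₐ[ℂ] (legendre t).toAffine.FunctionField,
      mapDegree g = 2 ∧
      g (xFun (legendreDual t)) = yFun (legendre t) ^ 2 / (4 * xFun (legendre t) ^ 2) := by
  classical
  have := charZero_of_complex (LegendreField t)
  set x : (LegendreField t) := xFun (legendre t) with hxdef
  set y : (LegendreField t) := yFun (legendre t) with hydef
  have hgen : IntermediateField.adjoin ℂ {x, y} = ⊤ := adjoin_functionField_complex _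
  have hx : x ≠ 0 := xFun_legendre_ne_zero t
  have hy : y ≠ 0 := yFun_ne_zero _
  have he : y ^ 2 = x ^ 3 - (1 + algebraMap ℂ (LegendreField t) t) * x ^ 2 +
      algebraMap ℂ (LegendreField t) t * x :=
    legendre_equation t
  have ht' : algebraMap ℂ (LegendreField t) t ≠ 0 := by
    rwa [Ne, FaithfulSMul.algebraMap_eq_zero_iff]
  have htr : Algebra.trdeg ℂ ℂ + 1 = Algebra.trdeg ℂ (LegendreField t) := by
    rw [trdeg_functionField_complex, trdeg_eq_zero, zero_add]
  have fin : Algebra.trdeg ℂ (LegendreField t) < Cardinal.aleph0 := by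
    rw [trdeg_functionField_complex]
    exact Cardinal.one_lt_aleph0
  set x' : (LegendreField t) := y ^ 2 / (4 * x ^ 2) with hx'
  have hquad : x ^ 2 + -(1 + algebraMap ℂ (LegendreField t) t + 4 * x') * x +
      algebraMap ℂ (LegendreField t) t = 0 := by
    rw [hx', he]
    field_simp
    ring
  have hy2 : y ^ 2 = 4 * x ^ 2 * x' := by
    rw [hx']
    field_simp
  have hS' (S : Set (LegendreField t)) (h : x ∈ relAlgClosure S) : relAlgClosure S = ⊤ := by
    refine relAlgClosure_eq_top hgen ?_
    rintro z (rfl | rfl)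
    · exact h
    · refine mem_relAlgClosure_of_pow 2 two_pos ?_
      rw [he]
      have hc := (relAlgClosure S).algebraMap_mem t
      exact add_mem (sub_mem (pow_mem h 3) (mul_mem (add_mem (one_mem _) hc) (pow_mem h 2)))
        (mul_mem hc h)
  have hS : relAlgClosure {x'} = ⊤ := by
    have hx'M := subset_relAlgClosure {x'} rfl
    have hc := (relAlgClosure {x'}).algebraMap_mem t
    exact hS' _ (mem_relAlgClosure_of_quadratic (neg_mem (add_mem (add_mem (one_mem _) hc)
      (mul_mem (ofNat_mem _ 4) hx'M))) hc hquad)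
  -- The companion coordinate y(x² - t)/(8x²) is the usual one for the quotient by (0, 0), with
  -- factors 1/4 and 1/8 matching the scaling of the dual curve.
  obtain ⟨g, -, g1, g2⟩ := exists_functionField_hom (legendreDual t)
    (Algebra.ofId ℂ (LegendreField t)) (x := x')
    (y := y * (x ^ 2 - algebraMap ℂ (LegendreField t) t) / (8 * x ^ 2)) (by
      simp only [legendreDual, Algebra.ofId_apply, map_zero, map_div₀, map_add, map_one, map_pow,
        map_sub, map_ofNat, hx']
      rw [div_pow, mul_pow, he]
      field_simp
      ring) htr fin hS (by rintro _ rfl; exact Or.inr (Or.inl rfl))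
  -- This is translation by (0, 0), the deck transformation of the isogeny.
  obtain ⟨σ, -, s1, s2⟩ := exists_functionField_hom (legendre t) (Algebra.ofId ℂ (LegendreField t))
    (x := algebraMap ℂ (LegendreField t) t / x)
    (y := -(algebraMap ℂ (LegendreField t) t * y / x ^ 2)) (by
      simp only [legendre, Algebra.ofId_apply, map_zero, map_add, map_one, map_neg]
      rw [neg_sq, div_pow, mul_pow, he]
      field_simp
      ring) htr fin (hS' {algebraMap ℂ (LegendreField t) t / x} (by
        have h1 := inv_mem (div_mem
          (subset_relAlgClosure {algebraMap ℂ (LegendreField t) t / x} rfl)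
          ((relAlgClosure {algebraMap ℂ (LegendreField t) t / x}).algebraMap_mem t))
        rwa [div_div_cancel_left' ht', inv_inv] at h1))
      (by rintro _ rfl; exact Or.inr (Or.inl rfl))
  have hσσ : σ.comp σ = AlgHom.id ℂ (LegendreField t) := by
    refine algHom_ext_of_adjoin hgen ?_
    rintro z (rfl | rfl)
    · change σ (σ x) = x
      rw [s1, map_div₀, AlgHom.commutes, s1]
      field_simp
    · change σ (σ y) = y
      rw [s2, map_neg, map_div₀, map_mul, map_pow, AlgHom.commutes, s1, s2]
      field_simp
  let τ : (LegendreField t) ≃ₐ[ℂ] (LegendreField t) := AlgEquiv.ofAlgHom σ σ hσσ hσσ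
  have τ1 : τ x = algebraMap ℂ (LegendreField t) t / x := s1
  have τ2 : τ y = -(algebraMap ℂ (LegendreField t) t * y / x ^ 2) := s2
  -- Were the translation trivial, its action on x would give x² = t and that on y would give x² =
  -- -t.
  have hτ : (1 : LegendreField t ≃ₐ[ℂ] LegendreField t) ≠ τ := by
    intro h
    rw [← h, AlgEquiv.one_apply, eq_div_iff hx] at τ1
    rw [← h, AlgEquiv.one_apply] at τ2
    have h3 : x ^ 2 = -algebraMap ℂ (LegendreField t) t := by
      field_simp at τ2
      exact τ2
    refine ht' ?_
    have : 2 * algebraMap ℂ (LegendreField t) t = 0 := by linear_combination h3 - τ1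
    simpa using this
  refine ⟨g, ?_, g1⟩
  have hx'g : x' ∈ g.fieldRange := ⟨_, g1⟩
  have hy'g : y * (x ^ 2 - algebraMap ℂ (LegendreField t) t) / (8 * x ^ 2) ∈ g.fieldRange := ⟨_, g2⟩
  have hne : x ^ 2 - algebraMap ℂ (LegendreField t) t ≠ 0 := by
    intro h
    rw [h, mul_zero, zero_div] at g2
    exact yFun_ne_zero _ ((map_eq_zero g).1 g2)
  set b : g.fieldRange := ⟨1 + algebraMap ℂ (LegendreField t) t + 4 * x', add_mem (add_mem
    (one_mem _) (g.fieldRange.algebraMap_mem t)) (mul_mem (ofNat_mem _ 4) hx'g)⟩ with hb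
  have hp2 : (-C b * X + C (algebraMap ℂ g.fieldRange t)).degree < ((2 : ℕ) : WithBot ℕ) := by
    rw [← C_neg]
    exact degree_linear_le.trans_lt (by norm_num)
  have hpd : (X ^ 2 + (-C b * X + C (algebraMap ℂ g.fieldRange t))).natDegree = 2 :=
    natDegree_X_pow_add_of_degree_lt hp2
  have hxM : x ∈ IntermediateField.adjoin g.fieldRange {x} :=
    IntermediateField.mem_adjoin_simple_self _ _
  have hfix : (τ : LegendreField t →ₐ[ℂ] LegendreField t).comp g = g := by
    refine algHom_ext_of_adjoin (adjoin_functionField_complex _) ?_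
    rintro z (rfl | rfl)
    · change τ (g _) = g _
      rw [g1, hx', map_div₀, map_pow, map_mul, map_pow, map_ofNat, τ1, τ2]
      field_simp
    · change τ (g _) = g _
      rw [g2, map_div₀, map_mul, map_sub, map_pow, map_mul, map_pow, map_ofNat, AlgEquiv.commutes,
        τ1, τ2]
      field_simp
      ring
  have h := eq_fixedField_of_simple (Subgroup.closure {τ}) g.fieldRange
    (fieldRange_le_fixedField_closure g (by
      rintro _ rfl
      exact hfix)) hgen x (by
      rintro z (rfl | rfl)
      · exact hxM
      · have : y = y * (x ^ 2 - algebraMap ℂ (LegendreField t) t) / (8 * x ^ 2) * (8 * x ^ 2) /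
            (x ^ 2 - algebraMap ℂ (LegendreField t) t) := by
          field_simp
        rw [this]
        exact div_mem (mul_mem (mem_adjoin_of_mem hy'g) (mul_mem (ofNat_mem _ 8) (pow_mem hxM 2)))
          (sub_mem (pow_mem hxM 2) (mem_adjoin_of_mem (g.fieldRange.algebraMap_mem t))))
    (monic_X_pow_add hp2) (by
      simp only [map_add, map_mul, map_pow, map_neg, aeval_X, aeval_C]
      change x ^ 2 + (-(1 + algebraMap ℂ (LegendreField t) t + 4 * x') * x +
        algebraMap ℂ (LegendreField t) t) = 0
      linear_combination hquad) {1, τ} (by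
      intro σ hσ
      rcases Finset.mem_insert.1 hσ with rfl | hσ
      · exact one_mem _
      · rw [Finset.mem_singleton.1 hσ]
        exact Subgroup.subset_closure rfl) (by
      rw [hpd, Finset.card_pair hτ])
  exact h.2.trans hpd

end Legendre

/-! ### The moduli -/

section Moduli

variable {lam s : ℂ} {l : ℂˣ} {t₁ t₂ : ℂ}

/-- If t₁t₂ = l², the condition (t₁ - 1)(t₂ - 1) = -4l prescribes the sum. So t₁ and t₂ are taken as
the roots of T² - (l² + 4l + 1)T + l²; the remaining relation follows from (l + 1)² = 4lλ². -/
theorem isModuli_exists (hs : s ^ 2 = lam ^ 2 - 1)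
    (hl : (l : ℂ) = 2 * lam ^ 2 - 1 - 2 * lam * s) : ∃ t₁ t₂ : ℂ, IsModuli lam l t₁ t₂ := by
  have hl0 : (l : ℂ) ≠ 0 := l.ne_zero
  have hll : ((l : ℂ) + 1) ^ 2 = 4 * l * lam ^ 2 := by
    rw [hl]
    linear_combination 4 * lam ^ 2 * hs
  obtain ⟨w, hw⟩ := IsAlgClosed.exists_pow_nat_eq
    (((l : ℂ) ^ 2 + 4 * l + 1) ^ 2 - 4 * (l : ℂ) ^ 2) two_pos
  refine ⟨((l : ℂ) ^ 2 + 4 * l + 1 + w) / 2, ((l : ℂ) ^ 2 + 4 * l + 1 - w) / 2, ?_⟩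
  generalize h1 : ((l : ℂ) ^ 2 + 4 * l + 1 + w) / 2 = t₁
  generalize h2 : ((l : ℂ) ^ 2 + 4 * l + 1 - w) / 2 = t₂
  have hsum : t₁ + t₂ = (l : ℂ) ^ 2 + 4 * l + 1 := by
    rw [← h1, ← h2]
    ring
  have hprod : t₁ * t₂ = (l : ℂ) ^ 2 := by
    rw [← h1, ← h2]
    linear_combination -hw / 4
  have hb : (t₁ - 1) * (t₂ - 1) = -4 * (l : ℂ) := by linear_combination hprod - hsum
  have hb0 : (t₁ - 1) * (t₂ - 1) ≠ 0 := by
    rw [hb]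
    exact mul_ne_zero (by norm_num) hl0
  have hp0 : t₁ * t₂ ≠ 0 := by
    rw [hprod]
    exact pow_ne_zero 2 hl0
  refine ⟨left_ne_zero_of_mul hp0, sub_ne_zero.1 (left_ne_zero_of_mul hb0),
    right_ne_zero_of_mul hp0, sub_ne_zero.1 (right_ne_zero_of_mul hb0), ?_, ?_, hb⟩
  · linear_combination (t₁ * t₂ + l ^ 2 - 2 * (t₁ + t₂) - 14) * hprod +
      (t₁ + t₂ + l ^ 2 + 4 * l + 1 - 2 - 2 * (l : ℂ) ^ 2) * hsum
  · rw [eq_div_iff (mul_ne_zero two_ne_zero hb0), hb]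
    linear_combination hprod + hsum + 2 * hll

/-- The isogeny relation is ((t₁ - 1)(t₂ - 1))² = 16t₁t₂ in expanded form. -/
theorem IsModuli.mul_eq (h : IsModuli lam l t₁ t₂) : t₁ * t₂ = (l : ℂ) ^ 2 := by
  have h1 : ((t₁ - 1) * (t₂ - 1)) ^ 2 = 16 * (t₁ * t₂) := by linear_combination h.isogenous
  rw [h.branch] at h1
  linear_combination -h1 / 16

theorem IsModuli.add_mul_add (h : IsModuli lam l t₁ t₂) :
    (t₁ + 1) * (t₂ + 1) = 8 * l * lam ^ 2 := by
  have h1 := h.lam_sq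
  have hb0 : (t₁ - 1) * (t₂ - 1) ≠ 0 :=
    mul_ne_zero (sub_ne_zero.2 h.ne_one₁) (sub_ne_zero.2 h.ne_one₂)
  rw [eq_div_iff (mul_ne_zero two_ne_zero hb0), h.branch] at h1
  linear_combination h1

theorem IsModuli.isParam (h : IsModuli lam l t₁ t₂) {m : ℂ} (hm : (l : ℂ) = m ^ 2) :
    IsParam lam m t₁ t₂ where
  ne_zero := by
    rintro rfl
    exact l.ne_zero (hm.trans (zero_pow two_ne_zero))
  sub_mul_sub := by rw [h.branch, hm]
  add_mul_add := by rw [h.add_mul_add, hm]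
  mul := by rw [h.mul_eq, hm, ← pow_mul]

/-- The Legendre parameters of two-isogenous curves in terms of a square root of the first. -/
theorem IsModuli.exists_sqrt (h : IsModuli lam l t₁ t₂) (hlam : lam ≠ 0) :
    ∃ r : ℂ, r ≠ 0 ∧ 1 - r ^ 2 ≠ 0 ∧ 4 * r * (1 - r ^ 2) * lam ^ 2 = (r ^ 2 + 1) ^ 2 ∧
      t₁ = r ^ 2 ∧ t₂ = ((1 + r) / (1 - r)) ^ 2 := by
  have hl0 : (l : ℂ) ≠ 0 := l.ne_zero
  have hp := h.mul_eq
  have hb := h.branch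
  have hll : ((l : ℂ) + 1) ^ 2 = 4 * l * lam ^ 2 := by
    linear_combination h.add_mul_add / 2 + hb / 2 - hp
  have hl1 : (l : ℂ) + 1 ≠ 0 := by
    intro h0
    rw [h0] at hll
    refine mul_ne_zero (mul_ne_zero (show (4 : ℂ) ≠ 0 by norm_num) hl0) (pow_ne_zero 2 hlam) ?_
    rw [← hll]
    ring
  -- The quadratic equation of t₁ reads (l - t₁)² = t₁(l + 1)², so this ratio is a square root of
  -- t₁. Its sign is the one with l(1 - r) = r(1 + r), from which t₂ = l²/t₁ takes the stated form.
  obtain ⟨r, hr⟩ : ∃ r, r = ((l : ℂ) - t₁) / (l + 1) := ⟨_, rfl⟩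
  have hr' : r * (l + 1) = l - t₁ := by rw [hr, div_mul_cancel₀ _ hl1]
  have hsq : ((l : ℂ) - t₁) ^ 2 = t₁ * (l + 1) ^ 2 := by
    linear_combination -t₁ * hb - (1 - t₁) * hp
  have ht : t₁ = r ^ 2 := by
    rw [hr, div_pow, hsq, mul_div_cancel_right₀ _ (pow_ne_zero 2 hl1)]
  have h0 : r ≠ 0 := by
    rintro rfl
    exact h.ne_zero₁ (ht.trans (zero_pow two_ne_zero))
  have h1 : 1 - r ^ 2 ≠ 0 := by
    rw [← ht]
    exact sub_ne_zero.2 h.ne_one₁.symm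
  have h2 : 1 - r ≠ 0 := by
    intro h2
    refine h1 ?_
    linear_combination (1 + r) * h2
  have h3 : (l : ℂ) * (1 - r) = r * (1 + r) := by linear_combination -hr' + ht
  refine ⟨r, h0, h1, ?_, ht, ?_⟩
  · have h4 : (l : ℂ) * (4 * r * (1 - r ^ 2) * lam ^ 2) = l * (r ^ 2 + 1) ^ 2 := by
      linear_combination -r * (1 - r ^ 2) * hll +
        (r * (1 + r) * (l + 1) + l * (1 + r ^ 2) - (l + 1) * (1 + r ^ 2)) * h3
    exact mul_left_cancel₀ hl0 h4
  · have h4 : (l : ℂ) = r * (1 + r) / (1 - r) := eq_div_of_mul_eq h2 h3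
    have h5 : r ^ 2 * t₂ = r ^ 2 * ((1 + r) / (1 - r)) ^ 2 := by
      rw [← ht, hp, h4, ht]
      ring
    exact mul_left_cancel₀ (pow_ne_zero 2 h0) h5

end Moduli

/-! ### The sandwich -/

section Sandwich

variable {lam m t₁ t₂ : ℂ}

theorem adjoin_map_equiv {A B : Type*} [Field A] [Field B] [Algebra ℂ A] [Algebra ℂ B]
    (ρ : A ≃ₐ[ℂ] B) {x y z : A} (h : IntermediateField.adjoin ℂ {x, y, z} = ⊤) :
    IntermediateField.adjoin ℂ {ρ x, ρ y, ρ z} = ⊤ := by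
  have h1 := congrArg (IntermediateField.map (ρ : A →ₐ[ℂ] B)) h
  rw [IntermediateField.adjoin_map, ← AlgHom.fieldRange_eq_map,
    AlgHom.fieldRange_eq_top.2 ρ.surjective, Set.image_insert_eq, Set.image_pair] at h1
  exact h1

/-- The chain of maps from the twisted Legendre pencil to the elliptic surface, and its two-form. -/
theorem ellipticSurfaceForm_eq_pullback (h : IsParam lam m t₁ t₂) {l : ℂˣ}
    {φ : ModelField lam →ₐ[ℂ] EllipticSurfaceField t₁ t₂} (hu : φ (modelU lam) = uFun t₁ t₂)
    (ht : φ (modelT lam) = (xiFun m t₁ t₂ + (xiFun m t₁ t₂)⁻¹) / 2)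
    (hs : φ (modelS lam) = etaFun m t₁ t₂ * (xiFun m t₁ t₂ - (xiFun m t₁ t₂)⁻¹) / 2)
    {χ : PencilField lam l →ₐ[ℂ] ModelField lam}
    (h0 : χ (coord (pencilPoly lam l) 0) =
      algebraMap ℂ _ m * modelS lam * (modelU lam - (modelU lam)⁻¹) / 4)
    (h1 : χ (coord (pencilPoly lam l) 1) = (modelT lam + 1) / 2)
    (h2 : χ (coord (pencilPoly lam l) 2) = (middle lam (modelU lam) + 2) / 4) :
    ellipticSurfaceForm t₁ t₂ = ratForm (φ (χ (coord (pencilPoly lam l) 0)))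
      (φ (χ (coord (pencilPoly lam l) 2))) (φ (χ (coord (pencilPoly lam l) 1))) := by
  rw [ellipticSurfaceForm, h0, h1, h2, yFun_eq_etaFun h.ne_zero, xFun_eq_xiFun h.ne_zero]
  simp only [map_div₀, map_mul, map_add, map_sub, map_inv₀, map_one, map_ofNat, AlgHom.commutes,
    map_middle, hu, ht, hs]
  have := ratForm_ellipticSurface_eq (lam := lam) (η := etaFun m t₁ t₂) h.ne_zero
    (uFun_ne_zero (t₁ := t₁) (t₂ := t₂))
    (xiFun_ne_zero h.ne_zero) ellipticSurface_transcendental.1.sub_inv_ne_zero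
    (xiFun_transcendental h.ne_zero).sub_inv_ne_zero
  simpa only [map_mul, map_pow, map_ofNat] using this

theorem algEquiv_ext_of_adjoin {K : Type*} [Field K] [Algebra ℂ K] {S : Set K}
    (hS : IntermediateField.adjoin ℂ S = ⊤) {σ τ : K ≃ₐ[ℂ] K} (h : ∀ z ∈ S, σ z = τ z) :
    σ = τ := by
  have : (σ : K →ₐ[ℂ] K) = τ := algHom_ext_of_adjoin hS h
  exact AlgEquiv.ext fun z => DFunLike.congr_fun this z

/-- Two commuting involutions `(u, a, η) ↦ (u, -a, η)` and `(u, a, η) ↦ (u, a⁻¹, -η)` of a field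
`ℂ(u, a, η)`, and maps that are invariant under them. -/
theorem sandwich_of_involutions {A B : Type*} [Field A] [Field B] [Algebra ℂ A] [Algebra ℂ B]
    {u a η : B} (hgen : IntermediateField.adjoin ℂ {u, a, η} = ⊤) (ha : Transcendental ℂ a)
    (hη : η ≠ 0) {i j : B ≃ₐ[ℂ] B} (i1 : i u = u) (i2 : i a = -a) (i3 : i η = η) (j1 : j u = u)
    (j2 : j a = a⁻¹) (j3 : j η = -η) {ψ : A →ₐ[ℂ] B} {φ : B →ₐ[ℂ] A}
    (hi : (i : B →ₐ[ℂ] B).comp ψ = ψ) (hj : (j : B →ₐ[ℂ] B).comp (ψ.comp φ) = ψ.comp φ)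
    (hψu : u ∈ ψ.fieldRange) (hψa : a ^ 2 ∈ ψ.fieldRange) (hψη : η ∈ ψ.fieldRange)
    (hφu : u ∈ (ψ.comp φ).fieldRange) (hφa : a ^ 2 + (a ^ 2)⁻¹ ∈ (ψ.comp φ).fieldRange)
    (hφη : η * (a ^ 2 - (a ^ 2)⁻¹) ∈ (ψ.comp φ).fieldRange) :
    (i ≠ 1 ∧ i * i = 1) ∧ (j ≠ 1 ∧ j * j = 1) ∧ i ≠ j ∧ i * j = j * i ∧
      ψ.fieldRange = IntermediateField.fixedField (Subgroup.zpowers i) ∧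
      (ψ.comp φ).fieldRange = IntermediateField.fixedField (Subgroup.closure {i, j}) ∧
      mapDegree ψ = 2 ∧ mapDegree φ = 2 := by
  have := charZero_of_complex B
  have ha0 := ha.ne_zero_of_complex
  have hi1 : i ≠ 1 := by
    rintro rfl
    exact self_ne_neg.2 ha0 i2
  have hj1 : j ≠ 1 := by
    rintro rfl
    exact self_ne_neg.2 hη j3
  have hij : i ≠ j := by
    rintro rfl
    exact self_ne_neg.2 hη (i3.symm.trans j3)
  have hii : i * i = 1 := algEquiv_ext_of_adjoin hgen (by
    rintro z (rfl | rfl | rfl) <;> simp [i1, i2, i3])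
  have hjj : j * j = 1 := algEquiv_ext_of_adjoin hgen (by
    rintro z (rfl | rfl | rfl) <;> simp [j1, j2, j3])
  have hcomm : i * j = j * i := algEquiv_ext_of_adjoin hgen (by
    rintro z (rfl | rfl | rfl) <;> simp [i1, i2, i3, j1, j2, j3, inv_neg])
  obtain ⟨r1, r2⟩ := fieldRange_eq_fixedField_zpowers hgen i hi1 ψ hi hψu hψa hψη
  obtain ⟨r3, r4⟩ := fieldRange_eq_fixedField_closure_pair hgen ha i j i2 j2 (ψ.comp φ)
    (by rw [← AlgHom.comp_assoc, hi]) hj hφu hφa hφη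
  refine ⟨⟨hi1, hii⟩, ⟨hj1, hjj⟩, hij, hcomm, r1, r3, r2, ?_⟩
  -- The tower formula 4 = deg φ · 2 gives the degree of φ.
  rw [mapDegree_comp, r2] at r4
  omega

theorem exists_conj {N K : Type*} [Field N] [Field K] [Algebra ℂ N] [Algebra ℂ K] (ρ : N ≃ₐ[ℂ] K)
    (σ : N ≃ₐ[ℂ] N) : ∃ τ : K ≃ₐ[ℂ] K, ∀ z, τ (ρ z) = ρ (σ z) :=
  ⟨(ρ.symm.trans σ).trans ρ, fun z => congrArg (fun y => ρ (σ y)) (ρ.symm_apply_apply z)⟩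

theorem exists_conj_hom {A B C D : Type*} [Field A] [Field B] [Field C] [Field D] [Algebra ℂ A]
    [Algebra ℂ B] [Algebra ℂ C] [Algebra ℂ D] (e : A ≃ₐ[ℂ] B) (ρ : C →ₐ[ℂ] D) (f : A →ₐ[ℂ] C) :
    ∃ g : B →ₐ[ℂ] D, ∀ z, g (e z) = ρ (f z) :=
  ⟨ρ.comp (f.comp e.symm.toAlgHom), fun z => congrArg (fun y => ρ (f y)) (e.symm_apply_apply z)⟩

theorem comp_eq_of_conj {A B C : Type*} [Field A] [Field B] [Field C] [Algebra ℂ A]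
    [Algebra ℂ B] [Algebra ℂ C] (e : A ≃ₐ[ℂ] B) {f g : B →ₐ[ℂ] C} (h : ∀ z, f (e z) = g (e z)) :
    f = g :=
  AlgHom.ext fun z => by
    obtain ⟨z, rfl⟩ := e.surjective z
    exact h z

/-- The images of t and s, namely (a² + a⁻²)/2 and η(a² - a⁻²)/2, are unchanged when a is inverted
and η negated. Since a and η are rational in u, t and s, this suffices. -/
theorem modelJ_comp {j : ModelField lam ≃ₐ[ℂ] ModelField lam}
    (j1 : j (modelU lam) = modelU lam) (j2 : j (modelA lam) = (modelA lam)⁻¹)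
    (j3 : j (modelEta lam) = -modelEta lam)
    {ψ : EllipticSurfaceField t₁ t₂ →ₐ[ℂ] ModelField lam}
    (q1 : ψ (uFun t₁ t₂) = modelU lam) (q2 : ψ (xiFun m t₁ t₂) = modelA lam ^ 2)
    (q3 : ψ (etaFun m t₁ t₂) = modelEta lam)
    {φ : ModelField lam →ₐ[ℂ] EllipticSurfaceField t₁ t₂} (f1 : φ (modelU lam) = uFun t₁ t₂)
    (f2 : φ (modelT lam) = (xiFun m t₁ t₂ + (xiFun m t₁ t₂)⁻¹) / 2)
    (f3 : φ (modelS lam) = etaFun m t₁ t₂ * (xiFun m t₁ t₂ - (xiFun m t₁ t₂)⁻¹) / 2) :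
    (j : ModelField lam →ₐ[ℂ] ModelField lam).comp (ψ.comp φ) = ψ.comp φ := by
  have hu : j (ψ (φ (modelU lam))) = ψ (φ (modelU lam)) := by rw [f1, q1, j1]
  have ht : j (ψ (φ (modelT lam))) = ψ (φ (modelT lam)) := by
    rw [f2]
    simp only [map_div₀, map_add, map_inv₀, map_ofNat, q2, map_pow, j2, inv_pow, inv_inv]
    ring
  have hs : j (ψ (φ (modelS lam))) = ψ (φ (modelS lam)) := by
    rw [f3]
    simp only [map_div₀, map_mul, map_sub, map_inv₀, map_ofNat, q2, q3, map_pow, j2, j3, inv_pow,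
      inv_inv]
    ring
  have ha : j (ψ (φ (modelA lam))) = ψ (φ (modelA lam)) := by
    have hc : j (ψ (φ (middle lam (modelU lam)))) = ψ (φ (middle lam (modelU lam))) := by
      simp only [middle, map_add, map_inv₀, AlgHom.commutes, AlgEquiv.commutes, hu]
    simp only [modelA, map_div₀, map_sub, map_mul, map_ofNat, hs, ht, hc]
  refine algHom_ext_of_adjoin adjoin_model ?_
  rintro z (rfl | rfl | rfl)
  · exact hu
  · exact ha
  · change j (ψ (φ (modelEta lam))) = ψ (φ (modelEta lam))
    simp only [modelEta, map_div₀, map_sub, ha, ht]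

/-- The sandwich for a field `K` isomorphic to the model field. -/
theorem exists_sandwich {K : Type} [Field K] [Algebra ℂ K] (ρ : ModelField lam ≃ₐ[ℂ] K)
    (h : IsParam lam m t₁ t₂) (l : ℂˣ) (hl : (l : ℂ) = m ^ 2) :
    ∃ (e : EllipticSurfaceField t₁ t₂ ≃ₐ[ℂ] MirrorField lam) (π : K →ₐ[ℂ] DworkField lam)
      (ψ : MirrorField lam →ₐ[ℂ] K) (φ : K →ₐ[ℂ] MirrorField lam) (χ : PencilField lam l →ₐ[ℂ] K)
      (i j : K ≃ₐ[ℂ] K),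
      (e (uFun t₁ t₂) : DworkField lam) = dworkU lam ∧
      π.comp ψ = (MirrorField lam).val ∧
      (i (ρ (modelU lam)) = ρ (modelU lam) ∧ i (ρ (modelA lam)) = -ρ (modelA lam) ∧
        i (ρ (modelEta lam)) = ρ (modelEta lam)) ∧
      (j (ρ (modelU lam)) = ρ (modelU lam) ∧ j (ρ (modelA lam)) = (ρ (modelA lam))⁻¹ ∧
        j (ρ (modelEta lam)) = -ρ (modelEta lam)) ∧
      (i ≠ 1 ∧ i * i = 1) ∧ (j ≠ 1 ∧ j * j = 1) ∧
      i ≠ j ∧ i * j = j * i ∧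
      ψ.fieldRange = IntermediateField.fixedField (Subgroup.zpowers i) ∧
      (ψ.comp φ).fieldRange = IntermediateField.fixedField (Subgroup.closure {i, j}) ∧
      mapDegree ψ = 2 ∧ mapDegree φ = 2 ∧ mapDegree χ = 2 ∧
      pullback (e : EllipticSurfaceField t₁ t₂ →ₐ[ℂ] MirrorField lam)
          (ellipticSurfaceForm t₁ t₂) = pullback φ (pullback χ (pencilForm lam l)) := by
  have := charZero_of_complex K
  obtain ⟨e, e1, e2, e3⟩ := exists_mirror_equiv h
  obtain ⟨π₀, p1, p2, p3⟩ := exists_model_dwork (lam := lam)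
  obtain ⟨ψ₀, q1, q2, q3⟩ := exists_modelPsi h
  obtain ⟨φ₀, f1, f2, f3⟩ := exists_modelPhi h
  obtain ⟨χ₀, c0, c1, c2⟩ := exists_modelChi h l hl
  obtain ⟨i₀, i1, i2, i3⟩ := exists_modelI (lam := lam)
  obtain ⟨j₀, j1, j2, j3⟩ := exists_modelJ (lam := lam)
  have hi₀ : (i₀ : ModelField lam →ₐ[ℂ] ModelField lam).comp ψ₀ = ψ₀ := by
    refine algHom_ext_of_adjoin (adjoin_ellipticSurface h.ne_zero) ?_
    rintro z (rfl | rfl | rfl)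
    · change i₀ (ψ₀ _) = ψ₀ _
      rw [q1, i1]
    · change i₀ (ψ₀ _) = ψ₀ _
      rw [q2, map_pow, i2, neg_sq]
    · change i₀ (ψ₀ _) = ψ₀ _
      rw [q3, i3]
  have hj₀ := modelJ_comp j1 j2 j3 q1 q2 q3 f1 f2 f3
  -- Both composites send u, ξ, η to the same functions on the quartic, so the composite is the
  -- Greene-Plesser map.
  have hπ₀ : π₀.comp ψ₀ = (MirrorField lam).val.comp e.toAlgHom := by
    refine algHom_ext_of_adjoin (adjoin_ellipticSurface h.ne_zero) ?_
    rintro z (rfl | rfl | rfl)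
    · exact (congrArg π₀ q1).trans (p1.trans e1.symm)
    · exact (congrArg π₀ q2).trans ((map_pow π₀ _ 2).trans ((congrArg (· ^ 2) p2).trans e2.symm))
    · exact (congrArg π₀ q3).trans (p3.trans e3.symm)
  -- All maps are carried from the models to `K` and the mirror field along `ρ` and `e`.
  obtain ⟨i, hi⟩ := exists_conj ρ i₀
  obtain ⟨j, hj⟩ := exists_conj ρ j₀
  obtain ⟨ψ, hψ⟩ := exists_conj_hom e (ρ : ModelField lam →ₐ[ℂ] K) ψ₀
  obtain ⟨φ, hφ⟩ := exists_conj_hom ρ e.toAlgHom φ₀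
  obtain ⟨π, hπ⟩ := exists_conj_hom ρ (AlgHom.id ℂ (DworkField lam)) π₀
  have hψφ (z : ModelField lam) : ψ (φ (ρ z)) = ρ (ψ₀ (φ₀ z)) :=
    (congrArg ψ (hφ z)).trans (hψ _)
  have hia : i (ρ (modelA lam)) = -ρ (modelA lam) := by rw [hi, i2, map_neg]
  have hja : j (ρ (modelA lam)) = (ρ (modelA lam))⁻¹ := by rw [hj, j2, map_inv₀]
  have hiη : i (ρ (modelEta lam)) = ρ (modelEta lam) := by rw [hi, i3]
  have hjη : j (ρ (modelEta lam)) = -ρ (modelEta lam) := by rw [hj, j3, map_neg]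
  have hiu : i (ρ (modelU lam)) = ρ (modelU lam) := by rw [hi, i1]
  have hju : j (ρ (modelU lam)) = ρ (modelU lam) := by rw [hj, j1]
  have hiψ : (i : K →ₐ[ℂ] K).comp ψ = ψ := comp_eq_of_conj e fun z =>
    (congrArg i (hψ z)).trans ((hi _).trans ((congrArg ρ (DFunLike.congr_fun hi₀ z)).trans
      (hψ z).symm))
  have hjφ : (j : K →ₐ[ℂ] K).comp (ψ.comp φ) = ψ.comp φ := comp_eq_of_conj ρ fun z =>
    (congrArg j (hψφ z)).trans ((hj _).trans ((congrArg ρ (DFunLike.congr_fun hj₀ z)).trans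
      (hψφ z).symm))
  have hgen := adjoin_map_equiv ρ (adjoin_model (lam := lam))
  have htr : Transcendental ℂ (ρ (modelA lam)) := fun h' => modelA_transcendental
    ((isAlgebraic_algHom_iff (ρ : ModelField lam →ₐ[ℂ] K) ρ.injective).1 h')
  have hT : ψ (φ (2 * ρ (modelT lam))) = ρ (modelA lam) ^ 2 + (ρ (modelA lam) ^ 2)⁻¹ := by
    rw [map_mul, map_mul, hψφ, f2]
    simp only [map_div₀, map_add, map_inv₀, map_ofNat, q2, map_pow]
    field_simp
  have hS : ψ (φ (2 * ρ (modelS lam))) =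
      ρ (modelEta lam) * (ρ (modelA lam) ^ 2 - (ρ (modelA lam) ^ 2)⁻¹) := by
    rw [map_mul, map_mul, hψφ, f3]
    simp only [map_div₀, map_mul, map_sub, map_inv₀, map_ofNat, q2, q3, map_pow]
    field_simp
  obtain ⟨r1, r2, r3, r4, r5, r6, r7, r8⟩ := sandwich_of_involutions hgen htr
    ((map_ne_zero ρ).2 modelEta_ne_zero) hiu hia hiη hju hja hjη hiψ hjφ
    ⟨_, (hψ _).trans (congrArg ρ q1)⟩ ⟨_, (hψ _).trans ((congrArg ρ q2).trans (map_pow ρ _ 2))⟩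
    ⟨_, (hψ _).trans (congrArg ρ q3)⟩
    ⟨_, (hψφ _).trans (congrArg ρ ((congrArg ψ₀ f1).trans q1))⟩ ⟨_, hT⟩ ⟨_, hS⟩
  refine ⟨e, π, ψ, φ, (ρ : ModelField lam →ₐ[ℂ] K).comp χ₀, i, j, e1, ?_, ⟨hiu, hia, hiη⟩,
    ⟨hju, hja, hjη⟩, r1, r2, r3, r4, r5, r6, r7, r8, ?_, ?_⟩
  · exact comp_eq_of_conj e fun z => (congrArg π (hψ z)).trans ((hπ _).trans
      (DFunLike.congr_fun hπ₀ z))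
  · rw [mapDegree_comp, mapDegree_equiv, mapDegree_modelChi h.ne_zero l χ₀ c0 c1 c2]
  · rw [ellipticSurfaceForm_eq_pullback h f1 f2 f3 c0 c1 c2, pencilForm, pullback_ratForm,
      pullback_ratForm, pullback_ratForm]
    exact congr (congrArg₂ ratForm (hφ _).symm (hφ _).symm) (hφ _).symm

end Sandwich

/-! ### Invariance of the holomorphic two-form. -/

section Nikulin

variable {E E' : WeierstrassCurve ℂ}

/-- The unknown constant is fixed by every ℂ-automorphism, so invariance need only be tested on the
normalized form. -/
theorem isNikulinInvolution_of_ratForm {σ : KummerField E E' ≃ₐ[ℂ] KummerField E E'}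
    {c : ℂ} {b u a : KummerField E E'}
    (hform : kummerForm E E' = ratForm (algebraMap ℂ _ c * b) u a) (h1 : σ ≠ 1 ∧ σ * σ = 1)
    (h : ratForm (σ b) (σ u) (σ a) = ratForm b u a) : IsNikulinInvolution E E' σ := by
  refine ⟨h1.1, h1.2, ?_⟩
  rw [hform, pullback_ratForm]
  change ratForm (σ (algebraMap ℂ _ c * b)) (σ u) (σ a) = _
  rw [map_mul, AlgEquiv.commutes]
  exact ratForm_mul_congr h _

variable {K : Type*} [Field K] [Algebra ℂ K] {u a η : K} {σ : K ≃ₐ[ℂ] K}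

theorem ratForm_map_of_neg (hu : σ u = u) (ha : σ a = -a) (hη : σ η = η) :
    ratForm (σ (u * a * η)) (σ u) (σ a) = ratForm (u * a * η) u a := by
  rw [map_mul, map_mul, hu, ha, hη, mul_neg, neg_mul, ratForm_neg]

theorem ratForm_map_of_inv (ha0 : a ≠ 0) (hu : σ u = u) (ha : σ a = a⁻¹) (hη : σ η = -η) :
    ratForm (σ (u * a * η)) (σ u) (σ a) = ratForm (u * a * η) u a := by
  rw [map_mul, map_mul, hu, ha, hη, ratForm_inv ha0]

end Nikulin

end KummerSandwich

end

/-! ### Assembly of the theorem. -/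

open KummerSandwich
theorem mainTheorem3 (lam s : ℂ) (l : ℂˣ) (hlam : lam ≠ 0) (hs : s ^ 2 = lam ^ 2 - 1)
    (hl : (l : ℂ) = 2 * lam ^ 2 - 1 - 2 * lam * s) :
    (∃ t₁ t₂ : ℂ, IsModuli lam l t₁ t₂) ∧
    ∀ t₁ t₂ : ℂ, IsModuli lam l t₁ t₂ →
      (t₁ * t₂ = (l : ℂ) ^ 2 ∧ (legendre t₁).IsElliptic ∧ (legendreDual t₁).IsElliptic ∧
        (∃ g : (legendreDual t₁).toAffine.FunctionField →ₐ[ℂ]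
            (legendre t₁).toAffine.FunctionField,
          mapDegree g = 2 ∧
          g (xFun (legendreDual t₁)) =
            yFun (legendre t₁) ^ 2 / (4 * xFun (legendre t₁) ^ 2)) ∧
        ∃ C : WeierstrassCurve.VariableChange ℂ, C • legendreDual t₁ = legendre t₂) ∧
      ∃ (e : EllipticSurfaceField t₁ t₂ ≃ₐ[ℂ] MirrorField lam)
        (π : KummerField (legendre t₁) (legendreDual t₁) →ₐ[ℂ] DworkField lam)
        (ψ : MirrorField lam →ₐ[ℂ] KummerField (legendre t₁) (legendreDual t₁))
        (φ : KummerField (legendre t₁) (legendreDual t₁) →ₐ[ℂ] MirrorField lam)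
        (χ : PencilField lam l →ₐ[ℂ] KummerField (legendre t₁) (legendreDual t₁))
        (i j : KummerField (legendre t₁) (legendreDual t₁) ≃ₐ[ℂ]
          KummerField (legendre t₁) (legendreDual t₁)),
        (e (uFun t₁ t₂) : DworkField lam) =
          -(coord (dworkPoly lam) 1 * coord (dworkPoly lam) 2 / coord (dworkPoly lam) 0) ^ 2 ∧
        π.comp ψ = (MirrorField lam).val ∧
        IsNikulinInvolution (legendre t₁) (legendreDual t₁) i ∧
        IsNikulinInvolution (legendre t₁) (legendreDual t₁) j ∧
        i ≠ j ∧ i * j = j * i ∧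
        ψ.fieldRange = IntermediateField.fixedField (Subgroup.zpowers i) ∧
        (ψ.comp φ).fieldRange = IntermediateField.fixedField (Subgroup.closure {i, j}) ∧
        mapDegree ψ = 2 ∧ mapDegree φ = 2 ∧ mapDegree χ = 2 ∧
        pullback (e : EllipticSurfaceField t₁ t₂ →ₐ[ℂ] MirrorField lam)
            (ellipticSurfaceForm t₁ t₂) =
          pullback φ (pullback χ (pencilForm lam l)) := by
  refine ⟨isModuli_exists hs hl, fun t₁ t₂ h => ?_⟩
  -- This choice of square root of l normalizes ξ, η and χ at once, so the two-forms agree exactly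
  -- and not only up to a constant.
  have hm : (l : ℂ) = (lam - s) ^ 2 := by
    rw [hl]
    linear_combination -hs
  have hP := h.isParam hm
  have h01 := h.ne_zero₁
  have h11 := h.ne_one₁
  have hmul := h.mul_eq
  obtain ⟨r, h0, h1, hr, rfl, rfl⟩ := h.exists_sqrt hlam
  have h2 : 1 - r ≠ 0 := fun h2 => h1 (by linear_combination (1 + r) * h2)
  refine ⟨⟨hmul, legendre_isElliptic h01 h11, legendreDual_isElliptic h01 h11,
    exists_legendre_isogeny h01, exists_smul_legendreDual h2⟩, ?_⟩
  obtain ⟨ρ, c, hc⟩ := exists_kummer_equiv h0 h1 hr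
  obtain ⟨e, π, ψ, φ, χ, i, j, he, hπ, ⟨i1, i2, i3⟩, ⟨j1, j2, j3⟩, i4, j4, h'⟩ :=
    exists_sandwich ρ hP l hm
  exact ⟨e, π, ψ, φ, χ, i, j, he, hπ,
    isNikulinInvolution_of_ratForm hc i4 (ratForm_map_of_neg i1 i2 i3),
    isNikulinInvolution_of_ratForm hc j4
      (ratForm_map_of_inv ((map_ne_zero ρ).2 modelA_ne_zero) j1 j2 j3), h'⟩
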